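/- Let $\mathcal D$ be the set of dyadic intervals $I=[\frac{i}{2^j},\frac{i+1}{2^j})$, $j\ge 0$, $0\le i<2^j$, put $|I|=2^{-j}$, let $h_I=\chi_{I^+}-\chi_{I^-}$ (indicator of the left half minus indicator of the right half), let $h_\varnothing=\chi_{[0,1)}$, and put $\mathcal D^+=\mathcal D\cup\{\varnothing\}$, $H=\operatorname{span}\{h_I: I\in\mathcal D^+\}$ (over $\mathbb R$). Put $\langle f,g\rangle=\int_0^1 fg$. Let $\|\cdot\|_X$ be a norm on $H$ such that $\|\chi_{[0,1)}\|_X=1$ and $\|f\|_X=\|g\|_X$ whenever $f,g\in H$ and $|f|,|g|$ have the same distribution. Let $r_n=\sum_{|I|=2^{-n}}h_I$ be the Rademacher functions, let $\iota(\varnothing)=0$ and $\iota([\frac{i}{2^j},\frac{i+1}{2^j}))=2^j+i$, and let $\mathbf r=(r_I)_{I\in\mathcal D^+}$ be either $(r_{\iota(I)})_{I\in\mathcal D^+}$ or the constant family $(r_0)_{I\in\mathcal D^+}$. For finite sums define $$\Bigl\|\sum_{I\in\mathcal D^+}a_Ih_I\Bigr\|_{X(\mathbf r)}=\Bigl\|s\mapsto\int_0^1\Bigl|\sum_{I\in\mathcal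 D^+}r_I(u)a_Ih_I(s)\Bigr|\,du\Bigr\|_X .$$ Let $Y$ be the Haar system Hardy space given by these data, i.e. the completion of $\operatorname{span}\{h_I:I\in\mathcal D\}$ under $\|\cdot\|_{X(\mathbf r)}$, and let $Y_n=\operatorname{span}\{h_I: I\in\mathcal D,\ |I|\ge 2^{-n}\}\subset Y$ for $n\ge 0$. For $K\ge 1$, the Haar system is called $K$-unconditional in $Y$ if $\|\sum_{I}\sigma_Ia_Ih_I\|_Y\le K\|\sum_I a_Ih_I\|_Y$ for all finite sums over $\mathcal D$ and all signs $\sigma_I\in\{\pm1\}$. For $\Gamma,\delta,\varepsilon>0$ and $n\in\mathbb N_0$ put $\eta=\frac{\varepsilon}{6(1+\varepsilon)}$ and $$N_{\min}(\Gamma,\delta,\varepsilon,n)=42n(n+1)\Bigl\lceil\frac{\Gamma}{\eta\delta}\Bigr\rceil+42+\Bigl\lfloor4\log_2\Bigl(\frac{\Gamma}{\eta\delta}\Bigr)\Bigr\rfloor,\qquad N_{\min}^K(\Gamma,\delta,\varepsilon,n)=42n\Bigl\lceil\frac{K\Gamma}{\eta\delta}\Bigr\rceil+42+\Bigl\lfloor4\log_2\Bigl(\frac{\Gamma}{\eta\delta}\Bigr)\Bigr\rfloor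 .$$ **Statement.** Let $\Gamma,\delta,\varepsilon>0$ and let $n,\widetilde N\in\mathbb N_0$ satisfy $$\widetilde N\ge 2N\Bigl\lceil\frac N\varepsilon+1\Bigr\rceil2^N,$$ where $N=N_{\min}(2(1+\varepsilon)\Gamma,\delta,\varepsilon,n)$, or where $N=N_{\min}^K(2(1+\varepsilon)\Gamma,\delta,\varepsilon,n)$ for some $K\ge1$ such that the Haar system is $K$-unconditional in $Y$. Then for every linear operator $\widetilde T\colon Y_{\widetilde N}\to Y_{\widetilde N}$ with $\|\widetilde T\|\le\Gamma$ and with $|\langle h_I,\widetilde Th_I\rangle|\ge\delta|I|$ for all $I\in\mathcal D$ with $|I|\ge2^{-\widetilde N}$, there are linear operators $B\colon Y_n\to Y_{\widetilde N}$ and $A\colon Y_{\widetilde N}\to Y_n$ with $$A\widetilde TB=I_{Y_n}\qquad\text{and}\qquad\|A\|\,\|B\|\le\frac{2(1+\varepsilon)^2}{\delta}.$$ -/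

import Mathlib

open MeasureTheory Set

noncomputable section

namespace HaarHardy

/-! ### Dyadic intervals and the Haar system -/

/-- The index of the dyadic interval `[i / 2 ^ j, (i + 1) / 2 ^ j)` in `[0, 1)`, where `j` is the
`level` and `0 ≤ i < 2 ^ j` is the `index`. -/
@[ext] structure DyadicInterval where
  level : ℕ
  index : Fin (2 ^ level)

namespace DyadicInterval

/-- The dyadic interval as a subset of the real line. -/
def toSet (I : DyadicInterval) : Set ℝ :=
  Ico ((I.index : ℝ) / 2 ^ I.level) (((I.index : ℝ) + 1) / 2 ^ I.level)

/-- The length `|I|` of a dyadic interval. -/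
def length (I : DyadicInterval) : ℝ := 1 / 2 ^ I.level

/-- The left half of a dyadic interval. -/
def left (I : DyadicInterval) : DyadicInterval :=
  ⟨I.level + 1, ⟨2 * I.index, by have := I.index.2; rw [pow_succ]; omega⟩⟩

/-- The right half of a dyadic interval. -/
def right (I : DyadicInterval) : DyadicInterval :=
  ⟨I.level + 1, ⟨2 * I.index + 1, by have := I.index.2; rw [pow_succ]; omega⟩⟩

end DyadicInterval

/-- The Haar system, as functions on the real line that vanish outside `[0, 1)`. The index `none`
stands for the empty set, with Haar function the indicator of `[0, 1)`; for a dyadic interval `I`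
the Haar function is the indicator of the left half minus the indicator of the right half. -/
def haar : Option DyadicInterval → ℝ → ℝ
  | none => (Ico (0 : ℝ) 1).indicator 1
  | some I => I.left.toSet.indicator 1 - I.right.toSet.indicator 1

/-- The enumeration of the index set of the Haar system: the empty set has number `0` and
`[i / 2 ^ j, (i + 1) / 2 ^ j)` has number `2 ^ j + i`. -/
def haarNumber : Option DyadicInterval → ℕ
  | none => 0
  | some I => 2 ^ I.level + I.index

/-- The standard Rademacher functions: the sum of the Haar functions of a given level. -/
def rademacher (n : ℕ) : ℝ → ℝ := ∑ i : Fin (2 ^ n), haar (some ⟨n, i⟩)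

/-- The linear span `H` of the Haar system. -/
def haarSpan : Submodule ℝ (ℝ → ℝ) := Submodule.span ℝ (range haar)

/-- Lebesgue measure on `[0, 1)`. -/
def unitMeasure : Measure ℝ := volume.restrict (Ico (0 : ℝ) 1)

/-! ### Step functions, linear independence of the Haar system -/

/-- `f` vanishes outside `[0, 1)` and is constant on each dyadic interval of level `n`. -/
def IsStep (n : ℕ) (f : ℝ → ℝ) : Prop :=
  ∃ c : ℤ → ℝ, ∀ x, f x = if x ∈ Ico (0 : ℝ) 1 then c ⌊2 ^ n * x⌋ else 0

lemma DyadicInterval.mem_toSet (I : DyadicInterval) (x : ℝ) :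
    x ∈ I.toSet ↔ ⌊2 ^ I.level * x⌋ = (I.index : ℕ) := by
  have h : (0 : ℝ) < 2 ^ I.level := by positivity
  rw [Int.floor_eq_iff, DyadicInterval.toSet, mem_Ico, div_le_iff₀' h, lt_div_iff₀' h]
  simp

lemma DyadicInterval.toSet_subset (I : DyadicInterval) : I.toSet ⊆ Ico (0 : ℝ) 1 := by
  intro x hx
  have h : (0 : ℝ) < 2 ^ I.level := by positivity
  have h2 : ((I.index : ℕ) : ℝ) + 1 ≤ 2 ^ I.level := by exact_mod_cast I.index.2
  rw [DyadicInterval.toSet, mem_Ico, div_le_iff₀' h, lt_div_iff₀' h] at hx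
  have h3 : (0 : ℝ) ≤ ((I.index : ℕ) : ℝ) := by positivity
  constructor
  · by_contra hx0
    nlinarith [hx.1, mul_neg_of_pos_of_neg h (not_le.mp hx0)]
  · by_contra hx1
    nlinarith [hx.2, not_lt.mp hx1]

lemma floor_refine {n m : ℕ} (h : n ≤ m) (x : ℝ) :
    ⌊(2 : ℝ) ^ n * x⌋ = ⌊(2 : ℝ) ^ m * x⌋ / ((2 ^ (m - n) : ℕ) : ℤ) := by
  rw [← Int.floor_div_natCast]
  congr 1
  have : (2 : ℝ) ^ m = 2 ^ n * 2 ^ (m - n) := by rw [← pow_add]; congr 1; omega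
  rw [this]
  push_cast
  field_simp

lemma IsStep.mono {n m : ℕ} (h : n ≤ m) {f : ℝ → ℝ} (hf : IsStep n f) : IsStep m f := by
  obtain ⟨c, hc⟩ := hf
  exact ⟨fun k => c (k / ((2 ^ (m - n) : ℕ) : ℤ)), fun x => by rw [hc x, floor_refine h x]⟩

lemma isStep_indicator (I : DyadicInterval) : IsStep I.level (I.toSet.indicator 1) := by
  classical
  refine ⟨fun k => if k = (I.index : ℕ) then 1 else 0, fun x => ?_⟩
  by_cases hx : x ∈ I.toSet
  · rw [indicator_of_mem hx, if_pos (I.toSet_subset hx)]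
    simp [(I.mem_toSet x).1 hx]
  · rw [indicator_of_notMem hx]
    have h : ⌊2 ^ I.level * x⌋ ≠ (I.index : ℕ) := fun h => hx ((I.mem_toSet x).2 h)
    simp [h]

lemma IsStep.add {n : ℕ} {f g : ℝ → ℝ} (hf : IsStep n f) (hg : IsStep n g) :
    IsStep n (f + g) := by
  obtain ⟨c, hc⟩ := hf
  obtain ⟨d, hd⟩ := hg
  refine ⟨c + d, fun x => ?_⟩
  rw [Pi.add_apply, hc x, hd x]
  split_ifs <;> simp

lemma IsStep.smul {n : ℕ} {f : ℝ → ℝ} (a : ℝ) (hf : IsStep n f) : IsStep n (a • f) := by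
  obtain ⟨c, hc⟩ := hf
  refine ⟨a • c, fun x => ?_⟩
  rw [Pi.smul_apply, hc x]
  split_ifs <;> simp

/-- The level from which on a Haar function is a step function. -/
def haarLevel : Option DyadicInterval → ℕ
  | none => 0
  | some I => I.level + 1

lemma isStep_haar (I : Option DyadicInterval) : IsStep (haarLevel I) (haar I) := by
  cases I with
  | none =>
    refine ⟨fun _ => 1, fun x => ?_⟩
    simp [haar, indicator_apply]
  | some I =>
    have h := (isStep_indicator I.left).add ((isStep_indicator I.right).smul (-1))
    have e : haar (some I) = I.left.toSet.indicator 1 + (-1 : ℝ) • I.right.toSet.indicator 1 := by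
      simp [haar, sub_eq_add_neg]
    rw [e]
    exact h

lemma exists_isStep {f : ℝ → ℝ} (hf : f ∈ haarSpan) : ∃ n, IsStep n f := by
  refine Submodule.span_induction ?_ ?_ ?_ ?_ hf
  · rintro _ ⟨I, rfl⟩
    exact ⟨_, isStep_haar I⟩
  · exact ⟨0, 0, fun x => by simp⟩
  · rintro f g - - ⟨n, hn⟩ ⟨m, hm⟩
    exact ⟨max n m, (hn.mono (le_max_left _ _)).add (hm.mono (le_max_right _ _))⟩
  · rintro a f - ⟨n, hn⟩
    exact ⟨n, hn.smul a⟩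

lemma indicator_left_add_right (I : DyadicInterval) :
    I.left.toSet.indicator (1 : ℝ → ℝ) + I.right.toSet.indicator 1 = I.toSet.indicator 1 := by
  classical
  funext x
  have h := floor_refine (Nat.le_succ I.level) x
  have e : ((2 ^ (I.level.succ - I.level) : ℕ) : ℤ) = 2 := by simp
  rw [e] at h
  have hl : x ∈ I.left.toSet ↔ ⌊(2 : ℝ) ^ (I.level + 1) * x⌋ = 2 * ((I.index : ℕ) : ℤ) := by
    rw [DyadicInterval.mem_toSet]; simp [DyadicInterval.left]
  have hr : x ∈ I.right.toSet ↔ ⌊(2 : ℝ) ^ (I.level + 1) * x⌋ = 2 * ((I.index : ℕ) : ℤ) + 1 := by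
    rw [DyadicInterval.mem_toSet]; simp [DyadicInterval.right]
  have hm := I.mem_toSet x
  simp only [Pi.add_apply, indicator_apply, hl, hr, hm, Pi.one_apply]
  rw [h]
  simp only [Nat.succ_eq_add_one]
  split_ifs <;> first | omega | norm_num

lemma indicator_mem_haarSpan (I : DyadicInterval) : I.toSet.indicator 1 ∈ haarSpan := by
  obtain ⟨n, i⟩ := I
  induction n with
  | zero =>
    have : (⟨0, i⟩ : DyadicInterval).toSet = Ico (0 : ℝ) 1 := by
      simp [DyadicInterval.toSet]
    rw [this]
    exact Submodule.subset_span ⟨none, rfl⟩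
  | succ n ih =>
    have hi : (i : ℕ) / 2 < 2 ^ n := by
      have h2 : (i : ℕ) < 2 ^ (n + 1) := i.2
      have h3 : 2 ^ (n + 1) = 2 ^ n * 2 := pow_succ 2 n
      omega
    set J : DyadicInterval := ⟨n, ⟨(i : ℕ) / 2, hi⟩⟩ with hJ
    have h1 : J.toSet.indicator 1 ∈ haarSpan := ih _
    have h2 : haar (some J) ∈ haarSpan := Submodule.subset_span ⟨_, rfl⟩
    have h3 := indicator_left_add_right J
    have h4 : haar (some J) = J.left.toSet.indicator 1 - J.right.toSet.indicator 1 := rfl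
    rcases Nat.mod_two_eq_zero_or_one (i : ℕ) with h | h
    · have e : (⟨n + 1, i⟩ : DyadicInterval) = J.left := by
        have : (i : ℕ) = 2 * ((i : ℕ) / 2) := by omega
        simp only [hJ, DyadicInterval.left, DyadicInterval.mk.injEq, heq_eq_eq, true_and]
        exact Fin.ext this
      rw [e]
      have : J.left.toSet.indicator (1 : ℝ → ℝ)
          = (1 / 2 : ℝ) • (J.toSet.indicator 1 + haar (some J)) := by
        rw [← h3, h4]; funext x; simp; ring
      rw [this]
      exact Submodule.smul_mem _ _ (Submodule.add_mem _ h1 h2)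
    · have e : (⟨n + 1, i⟩ : DyadicInterval) = J.right := by
        have : (i : ℕ) = 2 * ((i : ℕ) / 2) + 1 := by omega
        simp only [hJ, DyadicInterval.right, DyadicInterval.mk.injEq, heq_eq_eq, true_and]
        exact Fin.ext this
      rw [e]
      have : J.right.toSet.indicator (1 : ℝ → ℝ)
          = (1 / 2 : ℝ) • (J.toSet.indicator 1 - haar (some J)) := by
        rw [← h3, h4]; funext x; simp; ring
      rw [this]
      exact Submodule.smul_mem _ _ (Submodule.sub_mem _ h1 h2)

lemma IsStep.mem {n : ℕ} {f : ℝ → ℝ} (hf : IsStep n f) : f ∈ haarSpan := by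
  classical
  obtain ⟨c, hc⟩ := hf
  have : f = ∑ i : Fin (2 ^ n), c (i : ℕ) • (⟨n, i⟩ : DyadicInterval).toSet.indicator 1 := by
    funext x
    rw [hc x, Finset.sum_apply]
    by_cases hx : x ∈ Ico (0 : ℝ) 1
    · rw [if_pos hx]
      have h0 : 0 ≤ ⌊2 ^ n * x⌋ := Int.floor_nonneg.2 (mul_nonneg (by positivity) hx.1)
      have h1 : ⌊2 ^ n * x⌋ < 2 ^ n := by
        rw [Int.floor_lt]
        push_cast
        nlinarith [hx.2, pow_pos (two_pos : (0 : ℝ) < 2) n]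
      obtain ⟨k, hk⟩ := Int.eq_ofNat_of_zero_le h0
      have hk' : k < 2 ^ n := by rw [hk] at h1; exact_mod_cast h1
      rw [Finset.sum_eq_single ⟨k, hk'⟩]
      · have : x ∈ (⟨n, ⟨k, hk'⟩⟩ : DyadicInterval).toSet := by
          rw [DyadicInterval.mem_toSet]; exact hk
        simp [indicator_of_mem this, hk]
      · intro b _ hb
        have : x ∉ (⟨n, b⟩ : DyadicInterval).toSet := by
          rw [DyadicInterval.mem_toSet]
          simp only [hk]
          intro h
          apply hb
          ext
          exact_mod_cast h.symm
        simp [indicator_of_notMem this]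
      · simp
    · rw [if_neg hx]
      symm
      apply Finset.sum_eq_zero
      intro b _
      have : x ∉ (⟨n, b⟩ : DyadicInterval).toSet := fun h => hx (DyadicInterval.toSet_subset _ h)
      simp [indicator_of_notMem this]
  rw [this]
  exact Submodule.sum_mem _ fun i _ => Submodule.smul_mem _ _ (indicator_mem_haarSpan _)

lemma haar_some_apply (I : DyadicInterval) (x : ℝ) :
    haar (some I) x = if ⌊(2 : ℝ) ^ (I.level + 1) * x⌋ = 2 * ((I.index : ℕ) : ℤ) then 1 else
      if ⌊(2 : ℝ) ^ (I.level + 1) * x⌋ = 2 * ((I.index : ℕ) : ℤ) + 1 then -1 else 0 := by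
  classical
  have hl : x ∈ I.left.toSet ↔ ⌊(2 : ℝ) ^ (I.level + 1) * x⌋ = 2 * ((I.index : ℕ) : ℤ) := by
    rw [DyadicInterval.mem_toSet]; simp [DyadicInterval.left]
  have hr : x ∈ I.right.toSet ↔ ⌊(2 : ℝ) ^ (I.level + 1) * x⌋ = 2 * ((I.index : ℕ) : ℤ) + 1 := by
    rw [DyadicInterval.mem_toSet]; simp [DyadicInterval.right]
  simp only [haar, Pi.sub_apply, indicator_apply, hl, hr, Pi.one_apply]
  split_ifs <;> first | omega | norm_num

/-- The Haar system is linearly independent. -/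
theorem haar_linearIndependent : LinearIndependent ℝ haar := by
  classical
  rw [linearIndependent_iff']
  intro s g hg
  by_contra hne
  push Not at hne
  obtain ⟨I₀, hI₀, hgI₀⟩ := hne
  obtain ⟨I, hI, hmax⟩ := Finset.exists_max_image (s.filter fun J => g J ≠ 0) haarLevel
    ⟨I₀, by simp [hI₀, hgI₀]⟩
  have hIs : I ∈ s := (Finset.mem_filter.1 hI).1
  have hgI : g I ≠ 0 := (Finset.mem_filter.1 hI).2
  have key : ∀ x, ∑ J ∈ s, g J * haar J x = 0 := fun x => by
    have := congrFun hg x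
    simpa [Finset.sum_apply] using this
  cases I with
  | none =>
    have h := key 0
    rw [Finset.sum_eq_single none] at h
    · simp [haar] at h
      exact hgI h
    · intro J hJ hJn
      by_cases hgJ : g J = 0
      · simp [hgJ]
      · have := hmax J (by simp [hJ, hgJ])
        cases J with
        | none => exact absurd rfl hJn
        | some J => simp [haarLevel] at this
    · exact fun h' => absurd hIs h'
  | some I =>
    -- compare the values at the left end points of the two halves of `I`
    set x : ℝ := ((2 * (I.index : ℕ) : ℕ) : ℝ) / 2 ^ (I.level + 1) with hx
    set y : ℝ := ((2 * (I.index : ℕ) + 1 : ℕ) : ℝ) / 2 ^ (I.level + 1) with hy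
    have fx : ⌊(2 : ℝ) ^ (I.level + 1) * x⌋ = 2 * ((I.index : ℕ) : ℤ) := by
      rw [hx, mul_div_cancel₀ _ (by positivity)]
      rw [Int.floor_natCast]; push_cast; rfl
    have fy : ⌊(2 : ℝ) ^ (I.level + 1) * y⌋ = 2 * ((I.index : ℕ) : ℤ) + 1 := by
      rw [hy, mul_div_cancel₀ _ (by positivity)]
      rw [Int.floor_natCast]; push_cast; rfl
    have hx1 : haar (some I) x = 1 := by rw [haar_some_apply, if_pos fx]
    have hy1 : haar (some I) y = -1 := by
      rw [haar_some_apply, if_neg (by omega), if_pos fy]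
    have hxI : x ∈ Ico (0 : ℝ) 1 := I.left.toSet_subset (by
      rw [DyadicInterval.mem_toSet]; simpa [DyadicInterval.left] using fx)
    have hyI : y ∈ Ico (0 : ℝ) 1 := I.right.toSet_subset (by
      rw [DyadicInterval.mem_toSet]; simpa [DyadicInterval.right] using fy)
    have h : ∑ J ∈ s, g J * (haar J x - haar J y) = 0 := by
      simp only [mul_sub, Finset.sum_sub_distrib, key, sub_zero]
    rw [Finset.sum_eq_single (some I)] at h
    · rw [hx1, hy1] at h
      norm_num at h
      exact hgI h
    · intro J hJ hJI
      by_cases hgJ : g J = 0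
      · simp [hgJ]
      have hlev := hmax J (by simp [hJ, hgJ])
      suffices haar J x = haar J y by rw [this]; simp
      cases J with
      | none => simp only [haar]; rw [indicator_of_mem hxI, indicator_of_mem hyI]; rfl
      | some J =>
        simp only [haarLevel] at hlev
        rcases Nat.lt_or_ge J.level I.level with hlt | hge
        · have h1 := floor_refine hlt x
          have h2 := floor_refine hlt y
          have h3 := floor_refine (Nat.le_succ I.level) x
          have h4 := floor_refine (Nat.le_succ I.level) y
          have e : ((2 ^ (I.level.succ - I.level) : ℕ) : ℤ) = 2 := by simp
          rw [e] at h3 h4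
          simp only [Nat.succ_eq_add_one] at h1 h2 h3 h4
          have h5 : ⌊(2 : ℝ) ^ I.level * x⌋ = ⌊(2 : ℝ) ^ I.level * y⌋ := by
            rw [h3, h4, fx, fy]; omega
          rw [haar_some_apply, haar_some_apply, h1, h2, h5]
        · obtain ⟨l, i⟩ := I
          obtain ⟨l', j⟩ := J
          simp only at hlev hge
          obtain rfl : l' = l := by omega
          have hij : (j : ℕ) ≠ (i : ℕ) := fun h' => hJI (by
            congr 2; exact Fin.ext h')
          rw [haar_some_apply, haar_some_apply]
          simp only at fx fy ⊢
          rw [fx, fy]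
          rw [if_neg (by omega), if_neg (by omega), if_neg (by omega), if_neg (by omega)]
    · exact fun h' => absurd hIs h'

/-- The Haar system as a basis of its linear span. -/
def haarBasis : Module.Basis (Option DyadicInterval) ℝ haarSpan :=
  Module.Basis.span haar_linearIndependent

lemma haarBasis_apply (I : Option DyadicInterval) : ((haarBasis I : haarSpan) : ℝ → ℝ) = haar I :=
  congrArg Subtype.val (Module.Basis.span_apply haar_linearIndependent I)

/-! ### Haar system spaces -/

lemma isStep_iff (n : ℕ) (f : ℝ → ℝ) : IsStep n f ↔ (∀ x ∉ Ico (0 : ℝ) 1, f x = 0) ∧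
    ∀ x ∈ Ico (0 : ℝ) 1, ∀ y ∈ Ico (0 : ℝ) 1, ⌊(2 : ℝ) ^ n * x⌋ = ⌊(2 : ℝ) ^ n * y⌋ →
      f x = f y := by
  constructor
  · rintro ⟨c, hc⟩
    refine ⟨fun x hx => by rw [hc x, if_neg hx], fun x hx y hy h => ?_⟩
    rw [hc x, hc y, if_pos hx, if_pos hy, h]
  · rintro ⟨h0, h1⟩
    have hp : (0 : ℝ) < 2 ^ n := by positivity
    refine ⟨fun k => f ((k : ℝ) / 2 ^ n), fun x => ?_⟩
    split_ifs with hx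
    · apply h1 x hx
      · constructor
        · have : 0 ≤ ⌊2 ^ n * x⌋ := Int.floor_nonneg.2 (mul_nonneg hp.le hx.1)
          have : (0 : ℝ) ≤ (⌊2 ^ n * x⌋ : ℝ) := by exact_mod_cast this
          positivity
        · rw [div_lt_one hp]
          exact (Int.floor_le _).trans_lt (by nlinarith [hx.2])
      · rw [mul_div_cancel₀ _ hp.ne', Int.floor_intCast]
    · exact h0 x hx

lemma haar_eq_zero (I : Option DyadicInterval) {x : ℝ} (hx : x ∉ Ico (0 : ℝ) 1) : haar I x = 0 :=
  ((isStep_iff _ _).1 (isStep_haar I)).1 x hx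

lemma measurable_of_mem {f : ℝ → ℝ} (hf : f ∈ haarSpan) : Measurable f := by
  classical
  obtain ⟨n, c, hc⟩ := exists_isStep hf
  have : f = fun x => if x ∈ Ico (0 : ℝ) 1 then c ⌊2 ^ n * x⌋ else 0 := funext hc
  rw [this]
  refine Measurable.ite measurableSet_Ico ?_ measurable_const
  exact (measurable_from_top (f := c)).comp (Int.measurable_floor.comp (measurable_const_mul _))

lemma integrable_haar (I : Option DyadicInterval) : Integrable (haar I) unitMeasure := by
  have h1 : IsFiniteMeasure unitMeasure := by unfold unitMeasure; infer_instance
  have key : ∀ s : Set ℝ, MeasurableSet s →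
      Integrable (s.indicator (1 : ℝ → ℝ)) unitMeasure := fun s hs =>
    Integrable.indicator (integrable_const (1 : ℝ)) hs
  cases I with
  | none => exact key _ measurableSet_Ico
  | some I => exact (key _ measurableSet_Ico).sub (key _ measurableSet_Ico)

lemma integrable_of_mem {f : ℝ → ℝ} (hf : f ∈ haarSpan) : Integrable f unitMeasure := by
  refine Submodule.span_induction ?_ ?_ ?_ ?_ hf
  · rintro _ ⟨I, rfl⟩
    exact integrable_haar I
  · exact integrable_zero _ _ _
  · intro f g _ _ h1 h2
    exact h1.add h2
  · intro a f _ h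
    exact h.smul a

/-- A norm on `H` whose completion is a Haar system space: the norm of `f` only depends on the
distribution of `|f|`, and the indicator of `[0, 1)` has norm `1`. -/
structure HaarSystemNorm extends Seminorm ℝ haarSpan where
  eq_zero_of_norm_eq_zero : ∀ f : haarSpan, toFun f = 0 → f = 0
  norm_eq_of_identDistrib : ∀ f g : haarSpan,
    ProbabilityTheory.IdentDistrib (fun x => |(f : ℝ → ℝ) x|) (fun x => |(g : ℝ → ℝ) x|)
      unitMeasure unitMeasure → toFun f = toFun g
  norm_one : toFun ⟨haar none, Submodule.subset_span ⟨none, rfl⟩⟩ = 1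

namespace HaarSystemNorm

lemma eq_of_abs_eq (X : HaarSystemNorm) (f g : haarSpan)
    (h : ∀ x, |(f : ℝ → ℝ) x| = |(g : ℝ → ℝ) x|) : X.toSeminorm f = X.toSeminorm g := by
  apply X.norm_eq_of_identDistrib
  have : (fun x => |(f : ℝ → ℝ) x|) = fun x => |(g : ℝ → ℝ) x| := funext h
  rw [this]
  apply ProbabilityTheory.IdentDistrib.refl
  exact (measurable_norm.comp (measurable_of_mem g.2)).aemeasurable

/-- The norm is monotone with respect to the pointwise order of absolute values. -/
lemma mono (X : HaarSystemNorm) (f g : haarSpan)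
    (h : ∀ x, |(f : ℝ → ℝ) x| ≤ |(g : ℝ → ℝ) x|) : X.toSeminorm f ≤ X.toSeminorm g := by
  classical
  obtain ⟨n₁, hf⟩ := exists_isStep f.2
  obtain ⟨n₂, hg⟩ := exists_isStep g.2
  set n := max n₁ n₂
  have hf' := hf.mono (le_max_left n₁ n₂)
  obtain ⟨d, hd⟩ := hg.mono (le_max_right n₁ n₂)
  have hfs := (isStep_iff _ _).1 hf'
  obtain ⟨c, hc⟩ := hf'
  -- `w s` agrees with `f` on the cells in `s` and with `g` on the other cells
  have hw : ∀ c' : ℤ → ℝ, (fun x => if x ∈ Ico (0 : ℝ) 1 then c' ⌊2 ^ n * x⌋ else 0) ∈ haarSpan :=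
    fun c' => IsStep.mem (n := n) ⟨c', fun _ => rfl⟩
  let W : (ℤ → ℝ) → haarSpan := fun c' => ⟨_, hw c'⟩
  have hWf : W c = f := Subtype.ext (funext fun x => (hc x).symm)
  have hWg : W d = g := Subtype.ext (funext fun x => (hd x).symm)
  -- the modification on a single cell
  have single : ∀ (e : ℤ → ℝ) (k : ℤ) (t : ℝ), |t| ≤ |e k| →
      X.toSeminorm (W (Function.update e k t)) ≤ X.toSeminorm (W e) := by
    intro e k t ht
    obtain ⟨l, hl0, hl1, hl⟩ : ∃ l : ℝ, 0 ≤ l ∧ l ≤ 1 ∧ t = l * e k + (1 - l) * (- e k) := by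
      by_cases he : e k = 0
      · have : t = 0 := by rw [he, abs_zero] at ht; exact abs_nonpos_iff.1 ht
        exact ⟨0, le_rfl, zero_le_one, by simp [this, he]⟩
      · have hq : |t / e k| ≤ 1 := by
          rw [abs_div]; exact div_le_one_of_le₀ ht (abs_nonneg _)
        refine ⟨(1 + t / e k) / 2, ?_, ?_, ?_⟩
        · linarith [(abs_le.1 hq).1]
        · linarith [(abs_le.1 hq).2]
        · field_simp; ring
    have e1 : W (Function.update e k t) = l • W e + (1 - l) • W (Function.update e k (- e k)) := by
      apply Subtype.ext
      funext x
      change (if x ∈ Ico (0 : ℝ) 1 then _ else 0) = l * (if x ∈ Ico (0 : ℝ) 1 then _ else 0) +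
        (1 - l) * (if x ∈ Ico (0 : ℝ) 1 then _ else 0)
      split_ifs
      · by_cases hk : ⌊2 ^ n * x⌋ = k
        · rw [hk]; simp [hl]
        · rw [Function.update_of_ne hk, Function.update_of_ne hk]; ring
      · ring
    have e2 : X.toSeminorm (W (Function.update e k (- e k))) = X.toSeminorm (W e) := by
      apply X.eq_of_abs_eq
      intro x
      change |if x ∈ Ico (0 : ℝ) 1 then _ else 0| = |if x ∈ Ico (0 : ℝ) 1 then _ else 0|
      split_ifs
      · by_cases hk : ⌊2 ^ n * x⌋ = k
        · rw [hk]; simp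
        · rw [Function.update_of_ne hk]
      · rfl
    rw [e1]
    refine (map_add_le_add _ _ _).trans ?_
    rw [map_smul_eq_mul, map_smul_eq_mul, e2, Real.norm_of_nonneg hl0,
      Real.norm_of_nonneg (sub_nonneg.2 hl1)]
    linarith
  -- the comparison on a cell
  have cell : ∀ k : ℤ, 0 ≤ k → k < 2 ^ n → |c k| ≤ |d k| := by
    intro k hk0 hk1
    have hp : (0 : ℝ) < 2 ^ n := by positivity
    have hk0' : (0 : ℝ) ≤ k := by exact_mod_cast hk0
    have hk1' : (k : ℝ) < 2 ^ n := by exact_mod_cast hk1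
    have hx : (k : ℝ) / 2 ^ n ∈ Ico (0 : ℝ) 1 := ⟨by positivity, by rwa [div_lt_one hp]⟩
    have := h ((k : ℝ) / 2 ^ n)
    rw [hc, hd, if_pos hx, if_pos hx, mul_div_cancel₀ _ hp.ne', Int.floor_intCast] at this
    exact this
  have main : ∀ s : Finset ℤ, s ⊆ Finset.Ico 0 (2 ^ n) →
      X.toSeminorm (W fun k => if k ∈ s then c k else d k) ≤ X.toSeminorm g := by
    intro s
    induction s using Finset.induction_on with
    | empty => intro _; simp [hWg]
    | insert k s hks ih =>
      intro hsub
      have hk := Finset.mem_Ico.1 (hsub (Finset.mem_insert_self k s))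
      have h1 := ih (fun j hj => hsub (Finset.mem_insert_of_mem hj))
      have h2 := single (fun j => if j ∈ s then c j else d j) k (c k)
        (by simpa [hks] using cell k hk.1 hk.2)
      have h3 : (fun j => if j ∈ insert k s then c j else d j)
          = Function.update (fun j => if j ∈ s then c j else d j) k (c k) := by
        funext j
        by_cases hj : j = k
        · subst hj; simp
        · rw [Function.update_of_ne hj]; simp [hj]
      rw [h3]
      exact h2.trans h1
  refine le_trans (le_of_eq ?_) (main (Finset.Ico 0 (2 ^ n)) subset_rfl)
  congr 1
  rw [← hWf]
  apply Subtype.ext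
  funext x
  change (if x ∈ Ico (0 : ℝ) 1 then _ else 0) = (if x ∈ Ico (0 : ℝ) 1 then _ else 0)
  by_cases hx : x ∈ Ico (0 : ℝ) 1
  · have h0 : 0 ≤ ⌊2 ^ n * x⌋ := Int.floor_nonneg.2 (mul_nonneg (by positivity) hx.1)
    have h1 : ⌊2 ^ n * x⌋ < 2 ^ n := by
      rw [Int.floor_lt]
      push_cast
      nlinarith [hx.2, pow_pos (two_pos : (0 : ℝ) < 2) n]
    rw [if_pos hx, if_pos hx, if_pos (Finset.mem_Ico.2 ⟨h0, h1⟩)]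
  · rw [if_neg hx, if_neg hx]

end HaarSystemNorm

/-! ### Haar system Hardy spaces -/

/-- The two admissible choices of the family `r`, indexed by the Haar system: an independent
sequence of Rademacher functions, or a constant sequence. -/
inductive RademacherChoice
  | independent
  | constant

/-- The family `r` of sign-valued functions attached to a choice. -/
def RademacherChoice.family : RademacherChoice → Option DyadicInterval → ℝ → ℝ
  | independent, I => rademacher (haarNumber I)
  | constant, _ => rademacher 0

/-- The function `u ↦ ∑ r_I(u) a_I h_I(s)`. -/
def randomSum (r : RademacherChoice) (a : Option DyadicInterval →₀ ℝ) (s u : ℝ) : ℝ :=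
  a.sum fun I t => r.family I u * t * haar I s

/-- The function `s ↦ ∫ |∑ r_I(u) a_I h_I(s)| du`, the integral being over `[0, 1)`. -/
def averagedSum (r : RademacherChoice) (a : Option DyadicInterval →₀ ℝ) (s : ℝ) : ℝ :=
  ∫ u, |randomSum r a s u| ∂unitMeasure

lemma averagedSum_mem (r : RademacherChoice) (a : Option DyadicInterval →₀ ℝ) :
    averagedSum r a ∈ haarSpan := by
  refine IsStep.mem (n := a.support.sup haarLevel) ((isStep_iff _ _).2 ⟨fun x hx => ?_, ?_⟩)
  · simp [averagedSum, randomSum, haar_eq_zero _ hx]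
  · intro x hx y hy hxy
    have : ∀ u, randomSum r a x u = randomSum r a y u := fun u => by
      refine Finset.sum_congr rfl fun I hI => ?_
      have e := ((isStep_iff _ _).1 ((isStep_haar I).mono (Finset.le_sup hI))).2 x hx y hy hxy
      simp only [e]
    simp only [averagedSum, this]

lemma rademacher_mem (n : ℕ) : rademacher n ∈ haarSpan :=
  Submodule.sum_mem _ fun _ _ => Submodule.subset_span ⟨_, rfl⟩

lemma family_mem (r : RademacherChoice) (I : Option DyadicInterval) : r.family I ∈ haarSpan := by
  cases r <;> exact rademacher_mem _

lemma randomSum_mem (r : RademacherChoice) (a : Option DyadicInterval →₀ ℝ) (s : ℝ) :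
    randomSum r a s ∈ haarSpan := by
  have : randomSum r a s = ∑ I ∈ a.support, (a I * haar I s) • r.family I := by
    funext u
    rw [Finset.sum_apply]
    exact Finset.sum_congr rfl fun I _ => by simp; ring
  rw [this]
  exact Submodule.sum_mem _ fun I _ => Submodule.smul_mem _ _ (family_mem r I)

lemma averagedSum_nonneg (r : RademacherChoice) (a : Option DyadicInterval →₀ ℝ) (s : ℝ) :
    0 ≤ averagedSum r a s := integral_nonneg fun _ => abs_nonneg _

lemma averagedSum_add_le (r : RademacherChoice) (a b : Option DyadicInterval →₀ ℝ) (s : ℝ) :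
    averagedSum r (a + b) s ≤ averagedSum r a s + averagedSum r b s := by
  have h : ∀ u, randomSum r (a + b) s u = randomSum r a s u + randomSum r b s u := fun u =>
    Finsupp.sum_add_index' (by simp) (by intros; ring)
  have ia := (integrable_of_mem (randomSum_mem r a s)).abs
  have ib := (integrable_of_mem (randomSum_mem r b s)).abs
  unfold averagedSum
  rw [← integral_add ia ib]
  refine integral_mono (integrable_of_mem (randomSum_mem r (a + b) s)).abs (ia.add ib) fun u => ?_
  simp only [h]
  exact abs_add_le _ _

lemma averagedSum_smul (r : RademacherChoice) (t : ℝ) (a : Option DyadicInterval →₀ ℝ) (s : ℝ) :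
    averagedSum r (t • a) s = |t| * averagedSum r a s := by
  have h : ∀ u, randomSum r (t • a) s u = t * randomSum r a s u := fun u => by
    unfold randomSum
    rw [Finsupp.sum_smul_index' (by simp), Finsupp.mul_sum]
    exact Finset.sum_congr rfl fun I _ => by simp; ring
  unfold averagedSum
  simp only [h, abs_mul]
  exact integral_const_mul _ _

/-- An element of the linear span of the Haar system that vanishes almost everywhere is zero. -/
lemma eq_zero_of_ae {f : ℝ → ℝ} (hf : f ∈ haarSpan) (h0 : f =ᵐ[unitMeasure] 0) : f = 0 := by
  obtain ⟨n, hn⟩ := exists_isStep hf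
  have hs := (isStep_iff _ _).1 hn
  funext x
  by_cases hx : x ∈ Ico (0 : ℝ) 1
  · by_contra hne
    have hp : (0 : ℝ) < 2 ^ n := by positivity
    have hk0 : 0 ≤ ⌊2 ^ n * x⌋ := Int.floor_nonneg.2 (mul_nonneg hp.le hx.1)
    have hk1 : ⌊2 ^ n * x⌋ < 2 ^ n := by
      rw [Int.floor_lt]; push_cast; nlinarith [hx.2]
    obtain ⟨k, hk⟩ := Int.eq_ofNat_of_zero_le hk0
    have hk' : k < 2 ^ n := by rw [hk] at hk1; exact_mod_cast hk1
    set J : DyadicInterval := ⟨n, ⟨k, hk'⟩⟩ with hJ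
    have hsub : J.toSet ⊆ {y | ¬ f y = (0 : ℝ → ℝ) y} ∩ Ico 0 1 := by
      intro y hy
      have hy1 := J.toSet_subset hy
      refine ⟨?_, hy1⟩
      have e : ⌊(2 : ℝ) ^ n * y⌋ = ⌊(2 : ℝ) ^ n * x⌋ := by
        rw [hk]; exact (J.mem_toSet y).1 hy
      have := hs.2 y hy1 x hx e
      simp only [mem_ofPred_eq, this]
      exact hne
    have hz : volume J.toSet = 0 := by
      have h1 : unitMeasure {y | ¬ f y = (0 : ℝ → ℝ) y} = 0 := h0
      unfold unitMeasure at h1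
      rw [Measure.restrict_apply' measurableSet_Ico] at h1
      exact measure_mono_null hsub h1
    rw [DyadicInterval.toSet, Real.volume_Ico, ENNReal.ofReal_eq_zero] at hz
    have : (0 : ℝ) < 1 / 2 ^ J.level := by positivity
    rw [add_div] at hz
    linarith
  · exact hs.1 x hx

lemma rademacher_apply (n : ℕ) {x : ℝ} (hx : x ∈ Ico (0 : ℝ) 1) :
    rademacher n x = if Even ⌊(2 : ℝ) ^ (n + 1) * x⌋ then 1 else -1 := by
  have hk0 : 0 ≤ ⌊(2 : ℝ) ^ (n + 1) * x⌋ := Int.floor_nonneg.2 (mul_nonneg (by positivity) hx.1)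
  have hk1 : ⌊(2 : ℝ) ^ (n + 1) * x⌋ < 2 ^ (n + 1) := by
    rw [Int.floor_lt]
    push_cast
    nlinarith [hx.2, pow_pos (two_pos : (0 : ℝ) < 2) (n + 1)]
  obtain ⟨k, hk⟩ := Int.eq_ofNat_of_zero_le hk0
  have hk2 : k < 2 ^ n * 2 := by rw [hk, pow_succ] at hk1; exact_mod_cast hk1
  have hk' : k / 2 < 2 ^ n := by omega
  unfold rademacher
  rw [Finset.sum_apply, Finset.sum_eq_single ⟨k / 2, hk'⟩]
  · rw [haar_some_apply]
    simp only [hk]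
    rcases Nat.even_or_odd' k with ⟨j, rfl | rfl⟩
    · have e1 : ((2 * j : ℕ) : ℤ) = 2 * ((2 * j / 2 : ℕ) : ℤ) := by omega
      have e2 : Even ((2 * j : ℕ) : ℤ) := ⟨j, by push_cast; ring⟩
      rw [if_pos e2]
      exact if_pos e1
    · have e1 : ((2 * j + 1 : ℕ) : ℤ) ≠ 2 * (((2 * j + 1) / 2 : ℕ) : ℤ) := by omega
      have e3 : ((2 * j + 1 : ℕ) : ℤ) = 2 * (((2 * j + 1) / 2 : ℕ) : ℤ) + 1 := by omega
      have e2 : ¬ Even ((2 * j + 1 : ℕ) : ℤ) := by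
        rw [Int.not_even_iff_odd]; exact ⟨j, by push_cast; ring⟩
      rw [if_neg e2]
      exact (if_neg e1).trans (if_pos e3)
  · intro i _ hi
    have hne : (i : ℕ) ≠ k / 2 := fun h => hi (Fin.ext h)
    rw [haar_some_apply]
    simp only [hk]
    rw [if_neg, if_neg]
    · intro h
      have h : (k : ℤ) = 2 * ((i : ℕ) : ℤ) + 1 := h
      omega
    · intro h
      have h : (k : ℤ) = 2 * ((i : ℕ) : ℤ) := h
      omega
  · simp

lemma rademacher_zero_right (n : ℕ) : rademacher n 0 = 1 := by
  rw [rademacher_apply n (by simp)]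
  simp

lemma haarNumber_injective : Function.Injective haarNumber := by
  have aux : ∀ I J : DyadicInterval, I.level < J.level →
      haarNumber (some I) < haarNumber (some J) := by
    intro I J h
    have h1 : 2 ^ (I.level + 1) ≤ 2 ^ J.level := Nat.pow_le_pow_right (by norm_num) h
    have h2 := I.index.2
    simp only [haarNumber]
    have h3 : 2 ^ (I.level + 1) = 2 ^ I.level * 2 := pow_succ 2 _
    omega
  intro I J h
  cases I with
  | none =>
    cases J with
    | none => rfl
    | some J => have : 0 < 2 ^ J.level := by positivity
                simp only [haarNumber] at h; omega
  | some I =>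
    cases J with
    | none => have : 0 < 2 ^ I.level := by positivity
              simp only [haarNumber] at h; omega
    | some J =>
      rcases lt_trichotomy I.level J.level with hl | hl | hl
      · exact absurd h (aux I J hl).ne
      · obtain ⟨l, i⟩ := I
        obtain ⟨l', j⟩ := J
        obtain rfl : l = l' := hl
        simp only [haarNumber] at h
        have : i = j := Fin.ext (by omega)
        rw [this]
      · exact absurd h (aux J I hl).ne'

lemma eq_zero_of_averagedSum (r : RademacherChoice) (a : Option DyadicInterval →₀ ℝ) (s : ℝ)
    (h : averagedSum r a s = 0) : (a.sum fun I t => t * haar I s) = 0 := by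
  classical
  have hmem := randomSum_mem r a s
  have hz : randomSum r a s = 0 := by
    apply eq_zero_of_ae hmem
    have := (integral_eq_zero_iff_of_nonneg (fun _ => abs_nonneg _)
      (integrable_of_mem hmem).abs).1 h
    filter_upwards [this] with u hu
    simpa using hu
  cases r with
  | constant =>
    have := congrFun hz 0
    simpa [randomSum, RademacherChoice.family, rademacher_zero_right] using this
  | independent =>
    refine Finset.sum_eq_zero fun J hJ => ?_
    set n := haarNumber J with hn
    set y : ℝ := 1 / 2 ^ (n + 1) with hy
    have hyI : y ∈ Ico (0 : ℝ) 1 := by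
      refine ⟨by positivity, ?_⟩
      rw [hy, div_lt_one (by positivity)]
      exact one_lt_pow₀ one_lt_two (by omega)
    have h1 := congrFun hz 0
    have h2 := congrFun hz y
    have h3 : ∑ I ∈ a.support,
        (rademacher (haarNumber I) 0 - rademacher (haarNumber I) y) * (a I * haar I s) = 0 := by
      have e : ∑ I ∈ a.support,
          (rademacher (haarNumber I) 0 - rademacher (haarNumber I) y) * (a I * haar I s)
          = randomSum .independent a s 0 - randomSum .independent a s y := by
        unfold randomSum Finsupp.sum
        rw [← Finset.sum_sub_distrib]
        exact Finset.sum_congr rfl fun I _ => by simp only [RademacherChoice.family]; ring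
      rw [e, h1, h2]; simp
    rw [Finset.sum_eq_single J] at h3
    · have e : ⌊(2 : ℝ) ^ (n + 1) * y⌋ = 1 := by
        rw [hy, mul_one_div_cancel (by positivity)]; simp
      rw [rademacher_zero_right, rademacher_apply _ hyI, e, if_neg (by decide)] at h3
      linarith
    · intro I _ hIJ
      have hne : haarNumber I ≠ n := fun h' => hIJ (haarNumber_injective h')
      suffices rademacher (haarNumber I) y = 1 by rw [rademacher_zero_right, this]; ring
      rw [rademacher_apply _ hyI, if_pos]
      rcases lt_or_gt_of_ne hne with hlt | hgt
      · have : ⌊(2 : ℝ) ^ (haarNumber I + 1) * y⌋ = 0 := by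
          rw [Int.floor_eq_zero_iff]
          refine ⟨mul_nonneg (by positivity) hyI.1, ?_⟩
          rw [hy, mul_one_div, div_lt_one (by positivity)]
          exact pow_lt_pow_right₀ one_lt_two (by omega)
        rw [this]; exact Even.zero
      · have : (2 : ℝ) ^ (haarNumber I + 1) * y = ((2 ^ (haarNumber I - n) : ℤ) : ℝ) := by
          rw [hy, mul_one_div, div_eq_iff (by positivity)]
          push_cast
          rw [← pow_add]; congr 1; omega
        rw [this, Int.floor_intCast]
        exact (even_two).pow_of_ne_zero (by omega)
    · exact fun h' => absurd hJ h'

/-- The space `H`, to be equipped with the norm of the Haar system Hardy space `X(r)`. This is the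
dense subspace of `X(r)` that contains all the finite-dimensional spaces `Y_n`. -/
def HardySpan (_X : HaarSystemNorm) (_r : RademacherChoice) : Type := haarSpan

namespace HardySpan

variable (X : HaarSystemNorm) (r : RademacherChoice)

instance : AddCommGroup (HardySpan X r) := inferInstanceAs (AddCommGroup haarSpan)

instance : Module ℝ (HardySpan X r) := inferInstanceAs (Module ℝ haarSpan)

variable {X r}

/-- The underlying function of an element of `H`. -/
def toFunction (f : HardySpan X r) : ℝ → ℝ := (show haarSpan from f).1

/-- The coefficients of an element of `H` in the Haar system. -/
def coeff (f : HardySpan X r) : Option DyadicInterval →₀ ℝ := haarBasis.repr f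

variable (X r)

/-- The norm of `X(r)`: the norm in `X` of `s ↦ ∫ |∑ r_I(u) a_I h_I(s)| du`, where the `a_I` are
the Haar coefficients of the function. -/
instance : Norm (HardySpan X r) where
  norm f := X.toSeminorm ⟨averagedSum r f.coeff, averagedSum_mem r f.coeff⟩

lemma norm_def (f : HardySpan X r) :
    ‖f‖ = X.toSeminorm ⟨averagedSum r f.coeff, averagedSum_mem r f.coeff⟩ := rfl

lemma normedSpaceCore : NormedSpace.Core ℝ (HardySpan X r) where
  norm_nonneg f := apply_nonneg _ _
  norm_smul t f := by
    rw [norm_def, norm_def, ← map_smul_eq_mul]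
    have h : (t • f).coeff = t • f.coeff := map_smul haarBasis.repr t _
    apply X.eq_of_abs_eq
    intro x
    simp only [h, averagedSum_smul, Submodule.coe_smul, Pi.smul_apply, smul_eq_mul, abs_mul,
      abs_abs]
  norm_triangle f g := by
    rw [norm_def, norm_def, norm_def]
    refine le_trans ?_ (map_add_le_add _ _ _)
    apply X.mono
    intro x
    have h : (f + g).coeff = f.coeff + g.coeff := map_add haarBasis.repr _ _
    simp only [h, Submodule.coe_add, Pi.add_apply]
    rw [abs_of_nonneg (averagedSum_nonneg _ _ _),
      abs_of_nonneg (add_nonneg (averagedSum_nonneg _ _ _) (averagedSum_nonneg _ _ _))]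
    exact averagedSum_add_le _ _ _ _
  norm_eq_zero_iff f := by
    constructor
    · intro h
      have h1 := X.eq_zero_of_norm_eq_zero _ h
      have h2 : averagedSum r f.coeff = 0 := congrArg Subtype.val h1
      have h3 : Finsupp.linearCombination ℝ haarBasis f.coeff = (show haarSpan from f) :=
        haarBasis.linearCombination_repr _
      change (show haarSpan from f) = 0
      rw [← h3]
      apply Subtype.ext
      funext s
      have h4 := eq_zero_of_averagedSum r f.coeff s (congrFun h2 s)
      rw [Finsupp.linearCombination_apply, Finsupp.sum, AddSubmonoidClass.coe_finsetSum,
        Finset.sum_apply]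
      simp only [Submodule.coe_smul, haarBasis_apply, Pi.smul_apply, smul_eq_mul]
      exact h4
    · rintro rfl
      have h : (0 : HardySpan X r).coeff = 0 := map_zero haarBasis.repr
      rw [norm_def]
      have : (⟨averagedSum r (0 : HardySpan X r).coeff, averagedSum_mem r _⟩ : haarSpan) = 0 := by
        apply Subtype.ext
        funext s
        simp [h, averagedSum, randomSum]
      rw [this, map_zero]

instance : NormedAddCommGroup (HardySpan X r) := NormedAddCommGroup.ofCore (normedSpaceCore X r)

instance : NormedSpace ℝ (HardySpan X r) := NormedSpace.ofCore (normedSpaceCore X r)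

end HardySpan

/-- The Haar function `h_I` as an element of the Haar system Hardy space. -/
def haarVec (X : HaarSystemNorm) (r : RademacherChoice) (I : DyadicInterval) : HardySpan X r :=
  haarBasis (some I)

/-- The subspace `Y_n`, spanned by the Haar functions `h_I` with `|I| ≥ 2 ^ (-n)`, with the norm of
`Y = X_0(r)`. -/
def levelSpace (X : HaarSystemNorm) (r : RademacherChoice) (n : ℕ) :
    Submodule ℝ (HardySpan X r) :=
  Submodule.span ℝ (haarVec X r '' {I | I.level ≤ n})

/-- The Haar function `h_I`, for `|I| ≥ 2 ^ (-n)`, as an element of `Y_n`. -/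
def levelHaar (X : HaarSystemNorm) (r : RademacherChoice) (n : ℕ) (I : DyadicInterval)
    (hI : I.level ≤ n) : levelSpace X r n :=
  ⟨haarVec X r I, Submodule.subset_span ⟨I, hI, rfl⟩⟩

/-- The pairing of two functions on `[0, 1)`, the integral of the product. -/
def pairing (f g : ℝ → ℝ) : ℝ := ∫ x, f x * g x ∂unitMeasure

/-- An operator on `Y_n` has `δ`-large diagonal with respect to the Haar system if
`|⟨h_I, T h_I⟩| ≥ δ |I|` for all dyadic intervals with `|I| ≥ 2 ^ (-n)`. -/
def HasLargeDiagonal {X : HaarSystemNorm} {r : RademacherChoice} {n : ℕ}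
    (T : levelSpace X r n →L[ℝ] levelSpace X r n) (δ : ℝ) : Prop :=
  ∀ (I : DyadicInterval) (hI : I.level ≤ n),
    δ * I.length ≤
      |pairing (haar (some I)) (T (levelHaar X r n I hI) : HardySpan X r).toFunction|

/-- The operator `S` factors through the operator `T` with constant `C`. -/
def FactorsThrough {E F : Type*} [NormedAddCommGroup E] [NormedSpace ℝ E]
    [NormedAddCommGroup F] [NormedSpace ℝ F] (S : E →L[ℝ] E) (T : F →L[ℝ] F) (C : ℝ) : Prop :=
  ∃ (B : E →L[ℝ] F) (A : F →L[ℝ] E), ‖A‖ * ‖B‖ ≤ C ∧ S = A ∘L T ∘L B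

/-- The Haar system `(h_I)`, indexed by the dyadic intervals, is `K`-unconditional in `Y`. -/
def IsUnconditional (X : HaarSystemNorm) (r : RademacherChoice) (K : ℝ) : Prop :=
  ∀ (s : Finset DyadicInterval) (a σ : DyadicInterval → ℝ), (∀ I, σ I = 1 ∨ σ I = -1) →
    ‖∑ I ∈ s, (σ I * a I) • haarVec X r I‖ ≤ K * ‖∑ I ∈ s, a I • haarVec X r I‖

/-! ### The dimension bounds -/

/-- The quantity `Γ / (η δ)` with `η = ε / (6 (1 + ε))`. -/
def ratio (Γ δ ε : ℝ) : ℝ := Γ / (ε / (6 * (1 + ε)) * δ)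

/-- The bound `N_min(Γ, δ, ε, n)`. -/
def NMin (Γ δ ε : ℝ) (n : ℕ) : ℤ :=
  42 * n * (n + 1) * ⌈ratio Γ δ ε⌉ + 42 + ⌊4 * Real.logb 2 (ratio Γ δ ε)⌋

/-- The bound `N_min^K(Γ, δ, ε, n)`. -/
def NMinK (K Γ δ ε : ℝ) (n : ℕ) : ℤ :=
  42 * n * ⌈K * ratio Γ δ ε⌉ + 42 + ⌊4 * Real.logb 2 (ratio Γ δ ε)⌋

/-- The bound `2 N ⌈N / ε + 1⌉ 2 ^ N`. -/
def NTildeMin (ε : ℝ) (N : ℤ) : ℝ := 2 * N * ⌈(N : ℝ) / ε + 1⌉ * (2 : ℝ) ^ N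

end HaarHardy

end

open scoped BigOperators

namespace HaarHardy

/-! ### Discretization of step functions -/

/-! The identity is factored through functions `g_I = ∑ β_{I,K} h_K` in the large space, one for
each `I` of level at most `n`, with `B h_I = g_I` and `A f = ∑ |I|⁻¹ ⟨f, g_I⟩ h_I`. Both maps must
be contractions, and `A T B`, whose entries are `|J|⁻¹ ⟨g_J, T g_I⟩`, must be close to a multiple
`c` of the identity with `c ≥ δ / 2`. Inverting `A T B` then costs at most `2 (1 + ε) / δ`.

Contractivity: on functions of mean zero, `A` and `B` are integration against the kernel `1 + ∑
|I|⁻¹ h_I(x) g_I(s)` in one or the other variable. If the kernel is nonnegative, it is doubly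
stochastic, hence a mixture of permutations of dyadic cells, and such averages contract a
rearrangement-invariant norm. The Rademacher signs of the Hardy norm pass through the kernel when
the intervals in `g_I` share one sign, that of the level of `I` (`IsBlockSystem.norm_blockSum_le`,
`IsBlockSystem.norm_blockCoord_le`). Nested layers `G_0, …, G_n` of disjoint intervals with signs
`θ` give such a system: its kernel is the Riesz product `∏ (1 + r_j(x) f_j(s))`, where `f_j = ∑_{K ∈
G_j} θ_K h_K` (`IsLayering.blockKernel_eq`). The layers need not cover `[0, 1)`.

Choice of layers: the diagonal is at least `δ |K|` on some intervals and at most `-δ |K|` on the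
others. In one of the two classes each of the first `R` layers has total length at least `1 / 2`
(`half_le_sum_length_layer`); this is the source of the factor `2`. Up to the sign of `T`, the
traces of `T` over these layers lie in `[δ / 2, Γ]`, and the pigeonhole principle selects `n + 1`
deep layers with nearly equal traces.

Choice of signs: for random `θ`, the off-diagonal part of `⟨g_J, T g_I⟩` has second moment
controlled by the Hilbert–Schmidt norm of `T` between two layers. This norm is small for short
intervals, by Khintchine's inequality and smallness of the entries (`sum_sq_opEntry_le`). The
diagonal part concentrates around its mean because intervals below different members of `G_0` are
uncorrelated. Hence some choice of signs makes all entries good at once (`IsLayering.exists_signs`).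
-/

/-- The index of the dyadic cell of level `m` that contains a given point of `[0, 1)`. -/
noncomputable def cellOf (m : ℕ) (x : ℝ) : Fin (2 ^ m) :=
  Fin.ofNat (2 ^ m) ⌊(2 : ℝ) ^ m * x⌋.toNat

/-- The left end point of a dyadic cell of level `m`. -/
noncomputable def cellPoint (m : ℕ) (s : Fin (2 ^ m)) : ℝ := (s : ℕ) / 2 ^ m

lemma cellPoint_mem (m : ℕ) (s : Fin (2 ^ m)) : cellPoint m s ∈ Ico (0 : ℝ) 1 := by
  refine ⟨by unfold cellPoint; positivity, ?_⟩
  rw [cellPoint, div_lt_one (by positivity)]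
  exact_mod_cast s.2

lemma floor_mem {m : ℕ} {x : ℝ} (hx : x ∈ Ico (0 : ℝ) 1) :
    0 ≤ ⌊(2 : ℝ) ^ m * x⌋ ∧ ⌊(2 : ℝ) ^ m * x⌋ < 2 ^ m := by
  refine ⟨Int.floor_nonneg.2 (mul_nonneg (by positivity) hx.1), ?_⟩
  rw [Int.floor_lt]
  push_cast
  nlinarith [hx.2, pow_pos (two_pos : (0 : ℝ) < 2) m]

lemma cellOf_eq_iff {m : ℕ} {x : ℝ} (hx : x ∈ Ico (0 : ℝ) 1) (s : Fin (2 ^ m)) :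
    cellOf m x = s ↔ ⌊(2 : ℝ) ^ m * x⌋ = ((s : ℕ) : ℤ) := by
  obtain ⟨h0, h1⟩ := floor_mem (m := m) hx
  obtain ⟨k, hk⟩ := Int.eq_ofNat_of_zero_le h0
  rw [hk] at h1 ⊢
  have hk' : k < 2 ^ m := by exact_mod_cast h1
  rw [Fin.ext_iff, cellOf, hk]
  simp [Fin.ofNat, Nat.mod_eq_of_lt hk']

lemma measurable_cellOf (m : ℕ) : Measurable (cellOf m) :=
  (measurable_from_top (f := fun k : ℤ => Fin.ofNat (2 ^ m) k.toNat)).comp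
    (Int.measurable_floor.comp (measurable_const_mul _))

instance : IsProbabilityMeasure unitMeasure := ⟨by simp [unitMeasure]⟩

lemma ae_mem_unit : ∀ᵐ x ∂unitMeasure, x ∈ Ico (0 : ℝ) 1 :=
  ae_restrict_mem measurableSet_Ico

lemma map_cellOf_singleton (m : ℕ) (s : Fin (2 ^ m)) :
    (unitMeasure.map (cellOf m)) {s} = ENNReal.ofReal (1 / 2 ^ m) := by
  rw [Measure.map_apply (measurable_cellOf m) (measurableSet_singleton _), unitMeasure,
    Measure.restrict_apply' measurableSet_Ico]
  have : cellOf m ⁻¹' {s} ∩ Ico 0 1 = (⟨m, s⟩ : DyadicInterval).toSet := by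
    ext x
    constructor
    · rintro ⟨h, hx⟩
      rw [DyadicInterval.mem_toSet]
      exact (cellOf_eq_iff hx s).1 h
    · intro h
      have hx := DyadicInterval.toSet_subset _ h
      rw [DyadicInterval.mem_toSet] at h
      exact ⟨(cellOf_eq_iff hx s).2 h, hx⟩
  rw [this, DyadicInterval.toSet, Real.volume_Ico]
  congr 1
  simp only
  ring

/-- All cells have the same mass. This is what turns dependence on the distribution alone into
invariance under permutations of cells. -/
lemma map_perm_cellOf (m : ℕ) (e : Equiv.Perm (Fin (2 ^ m))) :
    (unitMeasure.map (cellOf m)).map e = unitMeasure.map (cellOf m) := by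
  refine Measure.ext_of_singleton fun s => ?_
  rw [Measure.map_apply (measurable_of_finite _) (measurableSet_singleton _)]
  have : e ⁻¹' {s} = {e.symm s} := by
    ext x; simp [Equiv.eq_symm_apply]
  rw [this, map_cellOf_singleton, map_cellOf_singleton]

/-- The step function with given values on the dyadic cells of level `m`. -/
noncomputable def stepVec (m : ℕ) : (Fin (2 ^ m) → ℝ) →ₗ[ℝ] haarSpan where
  toFun v := ⟨fun x => if x ∈ Ico (0 : ℝ) 1 then v (cellOf m x) else 0,
    IsStep.mem (n := m) ⟨fun k => v (Fin.ofNat (2 ^ m) k.toNat), fun _ => rfl⟩⟩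
  map_add' v w := by
    ext x
    simp only [Pi.add_apply, Submodule.coe_add]
    split_ifs <;> simp
  map_smul' t v := by
    ext x
    simp only [Pi.smul_apply, RingHom.id_apply, Submodule.coe_smul]
    split_ifs <;> simp

lemma stepVec_apply (m : ℕ) (v : Fin (2 ^ m) → ℝ) (x : ℝ) :
    (stepVec m v : ℝ → ℝ) x = if x ∈ Ico (0 : ℝ) 1 then v (cellOf m x) else 0 := rfl

lemma IsStep.eq_stepVec {m : ℕ} {f : ℝ → ℝ} (hf : IsStep m f) :
    f = stepVec m fun s => f (cellPoint m s) := by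
  have h := (isStep_iff _ _).1 hf
  funext x
  rw [stepVec_apply]
  split_ifs with hx
  · refine h.2 x hx _ (cellPoint_mem m _) ?_
    rw [(cellOf_eq_iff hx (cellOf m x)).1 rfl, cellPoint, mul_div_cancel₀ _ (by positivity)]
    exact (Int.floor_natCast _).symm
  · exact h.1 x hx

lemma integral_cellOf (m : ℕ) (v : Fin (2 ^ m) → ℝ) :
    ∫ x, v (cellOf m x) ∂unitMeasure = 𝔼 s, v s := by
  rw [← integral_map (f := v) (measurable_cellOf m).aemeasurable
    (measurable_of_finite v).aestronglyMeasurable]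
  have : IsProbabilityMeasure (unitMeasure.map (cellOf m)) :=
    Measure.isProbabilityMeasure_map (measurable_cellOf m).aemeasurable
  rw [integral_fintype (Integrable.of_finite), Fintype.expect_eq_sum_div_card, Finset.sum_div]
  refine Finset.sum_congr rfl fun s _ => ?_
  rw [Measure.real, map_cellOf_singleton, ENNReal.toReal_ofReal (by positivity)]
  simp [div_eq_inv_mul]

/-- The integral of a step function is the average of its values. -/
lemma IsStep.integral_comp {m : ℕ} {f : ℝ → ℝ} (hf : IsStep m f) (φ : ℝ → ℝ) :
    ∫ x, φ (f x) ∂unitMeasure = 𝔼 s, φ (f (cellPoint m s)) := by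
  rw [← integral_cellOf m fun s => φ (f (cellPoint m s))]
  refine integral_congr_ae ?_
  filter_upwards [ae_mem_unit] with x hx
  have := congrFun hf.eq_stepVec x
  rw [stepVec_apply, if_pos hx] at this
  rw [this]

/-- The norm in `X` of the step function with given values. -/
noncomputable def HaarSystemNorm.stepNorm (X : HaarSystemNorm) (m : ℕ) :
    Seminorm ℝ (Fin (2 ^ m) → ℝ) := X.toSeminorm.comp (stepVec m)

namespace HaarSystemNorm

variable (X : HaarSystemNorm) {m : ℕ}

lemma stepNorm_apply (v : Fin (2 ^ m) → ℝ) : X.stepNorm m v = X.toSeminorm (stepVec m v) := rfl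

lemma stepNorm_mono {v w : Fin (2 ^ m) → ℝ} (h : ∀ s, |v s| ≤ |w s|) :
    X.stepNorm m v ≤ X.stepNorm m w := by
  refine X.mono _ _ fun x => ?_
  rw [stepVec_apply, stepVec_apply]
  split_ifs
  · exact h _
  · exact le_rfl

lemma stepNorm_perm (e : Equiv.Perm (Fin (2 ^ m))) (v : Fin (2 ^ m) → ℝ) :
    X.stepNorm m (v ∘ e) = X.stepNorm m v := by
  refine X.norm_eq_of_identDistrib _ _ ?_
  have hm : ∀ w : Fin (2 ^ m) → ℝ, AEMeasurable (fun x => |(stepVec m w : ℝ → ℝ) x|) unitMeasure :=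
    fun w => (measurable_norm.comp (measurable_of_mem (stepVec m w).2)).aemeasurable
  have key : ∀ w : Fin (2 ^ m) → ℝ, unitMeasure.map (fun x => |(stepVec m w : ℝ → ℝ) x|)
      = (unitMeasure.map (cellOf m)).map fun s => |w s| := by
    intro w
    rw [Measure.map_map (measurable_of_finite _) (measurable_cellOf m)]
    refine Measure.map_congr ?_
    filter_upwards [ae_mem_unit] with x hx
    rw [stepVec_apply, if_pos hx]
    rfl
  refine ⟨hm _, hm _, ?_⟩
  rw [key, key]
  conv_rhs => rw [← map_perm_cellOf m e, Measure.map_map (measurable_of_finite _)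
    (measurable_of_finite _)]
  rfl

/-- Averaging with respect to a doubly stochastic kernel is a contraction. -/
lemma stepNorm_average_le (w : Fin (2 ^ m) → Fin (2 ^ m) → ℝ) (h0 : ∀ x s, 0 ≤ w x s)
    (h1 : ∀ x, 𝔼 s, w x s = 1) (h2 : ∀ s, 𝔼 x, w x s = 1) (v : Fin (2 ^ m) → ℝ) :
    X.stepNorm m (fun x => 𝔼 s, w x s * v s) ≤ X.stepNorm m v := by
  classical
  have hc : (0 : ℝ) < 2 ^ m := by positivity
  have hcard : (Fintype.card (Fin (2 ^ m)) : ℝ) = 2 ^ m := by simp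
  simp only [Fintype.expect_eq_sum_div_card, hcard] at h1 h2 ⊢
  -- Dividing by the number of cells turns means into sums, so that `W` is doubly stochastic.
  let W : Matrix (Fin (2 ^ m)) (Fin (2 ^ m)) ℝ := fun x s => w x s / 2 ^ m
  have hW : W ∈ doublyStochastic ℝ (Fin (2 ^ m)) := by
    rw [mem_doublyStochastic_iff_sum]
    refine ⟨fun x s => div_nonneg (h0 x s) hc.le, fun x => ?_, fun s => ?_⟩
    · rw [← h1 x, Finset.sum_div]
    · rw [← h2 s, Finset.sum_div]
  -- Birkhoff's theorem: `W` is a convex combination of permutation matrices, each of which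
  -- preserves the norm.
  obtain ⟨c, hc0, hc1, hcW⟩ := exists_eq_sum_perm_of_mem_doublyStochastic hW
  have e : (fun x => (∑ s, w x s * v s) / 2 ^ m) = ∑ σ, c σ • (v ∘ σ) := by
    funext x
    have e1 : (∑ s, w x s * v s) / 2 ^ m = (W.mulVec v) x := by
      rw [Finset.sum_div]
      exact Finset.sum_congr rfl fun s _ => by simp only [W]; ring
    rw [e1, ← hcW, Matrix.sum_mulVec, Finset.sum_apply, Finset.sum_apply]
    refine Finset.sum_congr rfl fun σ _ => ?_
    rw [Matrix.smul_mulVec, Matrix.permMatrix_mulVec]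
  rw [e]
  calc X.stepNorm m (∑ σ, c σ • (v ∘ σ)) ≤ ∑ σ, X.stepNorm m (c σ • (v ∘ σ)) :=
        Finset.le_sum_of_subadditive _ (map_zero _).le (map_add_le_add _) _ _
    _ = ∑ σ, c σ * X.stepNorm m v := by
        refine Finset.sum_congr rfl fun σ _ => ?_
        rw [map_smul_eq_mul, stepNorm_perm, Real.norm_of_nonneg (hc0 σ)]
    _ = X.stepNorm m v := by rw [← Finset.sum_mul, hc1, one_mul]

end HaarSystemNorm

/-! ### Random signs -/

/-- The sign attached to a truth value. -/
def sgn (b : Bool) : ℝ := if b then 1 else -1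

lemma sgn_mul_self (b : Bool) : sgn b * sgn b = 1 := by cases b <;> simp [sgn]

lemma sgn_not (b : Bool) : sgn (!b) = -sgn b := by cases b <;> simp [sgn]

lemma abs_sgn (b : Bool) : |sgn b| = 1 := by cases b <;> simp [sgn]

/-- The signs that occur in the norm of a Haar system Hardy space: arbitrary signs for an
independent family, and a constant sign (without loss of generality `1`) for a constant family. -/
def RademacherChoice.sign : RademacherChoice → Bool → ℝ
  | independent, b => sgn b
  | constant, _ => 1

/-- The signs with labels outside the range of `κ` do not enter and average out. -/
lemma expect_comp_injective {ι ι' : Type*} [Fintype ι] [DecidableEq ι] [Fintype ι']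
    [DecidableEq ι'] {κ : ι → ι'} (hκ : Function.Injective κ) (F : (ι → Bool) → ℝ) :
    𝔼 b : ι' → Bool, F (b ∘ κ) = 𝔼 ε, F ε := by
  classical
  let e : (ι' → Bool) ≃ (ι → Bool) × ({i // ¬ i ∈ range κ} → Bool) :=
    (Equiv.piEquivPiSubtypeProd (fun i => i ∈ range κ) fun _ => Bool).trans
      (Equiv.prodCongr (Equiv.arrowCongr (Equiv.ofInjective κ hκ).symm (Equiv.refl _))
        (Equiv.refl _))
  rw [Fintype.expect_equiv e (fun b => F (b ∘ κ)) (fun p => F p.1) fun b => rfl,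
    ← Finset.univ_product_univ, Finset.expect_product]
  simp

lemma expect_abs_sum_relabel (r : RademacherChoice) {ι ι' : Type*} [DecidableEq ι] [Fintype ι']
    [DecidableEq ι'] (S : Finset ι) {κ : ι → ι'} (hκ : InjOn κ S) (c : ι → ℝ) :
    𝔼 b : ι' → Bool, |∑ i ∈ S, r.sign (b (κ i)) * c i|
      = 𝔼 ε : S → Bool, |∑ i : S, r.sign (ε i) * c i| := by
  classical
  have hinj : Function.Injective fun i : S => κ i := fun i j h =>
    Subtype.ext (hκ i.2 j.2 h)
  rw [← expect_comp_injective hinj]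
  refine Finset.expect_congr rfl fun b _ => ?_
  rw [← Finset.sum_coe_sort]
  rfl

/-- Random sums with signs labelled in two different ways have the same mean absolute value,
as soon as distinct nonzero terms have distinct labels. -/
lemma expect_abs_sum_labels (r : RademacherChoice) {ι ι₁ ι₂ : Type*} [Fintype ι] [Fintype ι₁]
    [DecidableEq ι₁] [Fintype ι₂] [DecidableEq ι₂] {κ₁ : ι → ι₁} {κ₂ : ι → ι₂} (c : ι → ℝ)
    (h₁ : InjOn κ₁ {i | c i ≠ 0}) (h₂ : InjOn κ₂ {i | c i ≠ 0}) :
    𝔼 b : ι₁ → Bool, |∑ i, r.sign (b (κ₁ i)) * c i|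
      = 𝔼 b : ι₂ → Bool, |∑ i, r.sign (b (κ₂ i)) * c i| := by
  classical
  set S : Finset ι := Finset.univ.filter fun i => c i ≠ 0 with hS
  have hSc : (S : Set ι) = {i | c i ≠ 0} := by ext; simp [hS]
  have key : ∀ f : ι → ℝ, ∑ i, f i * c i = ∑ i ∈ S, f i * c i := fun f => by
    rw [hS, Finset.sum_filter]
    refine Finset.sum_congr rfl fun i _ => ?_
    split_ifs with h
    · rfl
    · rw [not_not.1 h, mul_zero]
  simp only [key]
  rw [expect_abs_sum_relabel r S (by rwa [hSc]), expect_abs_sum_relabel r S (by rwa [hSc])]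

/-- A Rademacher function reads one binary digit of the point. Digits are counted from the top and
bits of the cell index from the bottom, whence `m - 1 - k`; the digit `0` gives the value `1`,
whence the negation. -/
lemma rademacher_cellPoint {m k : ℕ} (hk : k < m) (u : Fin (2 ^ m)) :
    rademacher k (cellPoint m u) = sgn (!(u : ℕ).testBit (m - 1 - k)) := by
  rw [rademacher_apply k (cellPoint_mem m u)]
  have h : ⌊(2 : ℝ) ^ (k + 1) * cellPoint m u⌋ = (((u : ℕ) / 2 ^ (m - 1 - k) : ℕ) : ℤ) := by
    rw [floor_refine hk, cellPoint, mul_div_cancel₀ _ (by positivity)]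
    push_cast
    rw [show m - (k + 1) = m - 1 - k by omega]
    rw [Int.floor_natCast]
  simp only [h, Int.even_coe_nat, Nat.even_iff, Nat.testBit_eq_decide_div_mod_eq, sgn]
  rcases Nat.mod_two_eq_zero_or_one ((u : ℕ) / 2 ^ (m - 1 - k)) with h | h <;> simp [h]

/-- The binary digits of a uniformly chosen cell are independent fair bits. -/
lemma expect_testBit (m : ℕ) (F : (Fin m → Bool) → ℝ) :
    𝔼 u : Fin (2 ^ m), F (fun i => !(u : ℕ).testBit i) = 𝔼 b, F b := by
  have hb : Function.Bijective fun (u : Fin (2 ^ m)) (i : Fin m) => !(u : ℕ).testBit i := by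
    rw [Fintype.bijective_iff_injective_and_card]
    refine ⟨fun u v h => Fin.ext (Nat.eq_of_testBit_eq fun i => ?_), by simp⟩
    by_cases hi : i < m
    · simpa using congrFun h ⟨i, hi⟩
    · have : 2 ^ m ≤ 2 ^ i := Nat.pow_le_pow_right (by norm_num) (not_lt.1 hi)
      rw [Nat.testBit_lt_two_pow (u.2.trans_le this), Nat.testBit_lt_two_pow (v.2.trans_le this)]
  exact Fintype.expect_bijective _ hb _ _ fun u => rfl

/-- Distinct Rademacher functions behave like independent signs, so the integral over `u` is a mean
over sign patterns. At a fixed `x` only nonzero terms matter; labels may therefore coincide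
elsewhere. For the constant family the common sign has modulus one and drops out. -/
lemma averagedSum_eq_expect (r : RademacherChoice) {ι ι' : Type*} [Fintype ι] [Fintype ι']
    [DecidableEq ι'] (a : Option DyadicInterval →₀ ℝ) {j : ι → Option DyadicInterval}
    (hj : Function.Injective j) (ha : ∀ I, I ∉ range j → a I = 0) (x : ℝ) {κ : ι → ι'}
    (hκ : InjOn κ {i | a (j i) * haar (j i) x ≠ 0}) :
    averagedSum r a x
      = 𝔼 b : ι' → Bool, |∑ i, r.sign (b (κ i)) * (a (j i) * haar (j i) x)| := by
  classical
  obtain ⟨l, hl⟩ := exists_isStep (randomSum_mem r a x)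
  -- Level `m` resolves the random sum in `u` and exceeds all Haar numbers involved, so each
  -- Rademacher function is a digit of the cell index.
  set m := max (l + 1) (Finset.univ.sup (fun i => haarNumber (j i)) + 1) with hm
  have hlm : IsStep m (randomSum r a x) := hl.mono (by omega)
  have hjm : ∀ i, haarNumber (j i) < m := fun i => by
    have : haarNumber (j i) ≤ Finset.univ.sup fun i => haarNumber (j i) :=
      Finset.le_sup (f := fun i => haarNumber (j i)) (Finset.mem_univ i)
    omega
  have hsum : ∀ u, randomSum r a x u = ∑ i, r.family (j i) u * (a (j i) * haar (j i) x) := by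
    intro u
    rw [randomSum, Finsupp.sum, ← Finset.sum_image (s := Finset.univ) (g := j)
      (f := fun I => r.family I u * (a I * haar I x)) (fun i _ i' _ h => hj h)]
    simp only [← mul_assoc]
    refine Finset.sum_subset (fun I hI => ?_) fun I _ hI => ?_
    · by_contra h
      refine Finsupp.mem_support_iff.1 hI (ha I fun ⟨i, hi⟩ => h ?_)
      exact Finset.mem_image.2 ⟨i, Finset.mem_univ i, hi⟩
    · rw [Finsupp.notMem_support_iff.1 hI]; simp
  unfold averagedSum
  rw [hlm.integral_comp (fun t => |t|)]
  simp only [hsum]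
  cases r with
  | independent =>
    let κ₀ : ι → Fin m := fun i => ⟨m - 1 - haarNumber (j i), by have := hjm i; omega⟩
    have h0 : Function.Injective κ₀ := fun i i' h => hj (haarNumber_injective (by
      have := Fin.ext_iff.1 h
      have h1 := hjm i
      have h2 := hjm i'
      simp only [κ₀] at this
      omega))
    rw [← expect_abs_sum_labels .independent (κ₁ := κ₀) _ h0.injOn hκ, ← expect_testBit]
    refine Finset.expect_congr rfl fun u _ => ?_
    congr 1
    refine Finset.sum_congr rfl fun i _ => ?_
    rw [RademacherChoice.family, rademacher_cellPoint (hjm i)]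
    rfl
  | constant =>
    simp only [RademacherChoice.family, RademacherChoice.sign, one_mul]
    rw [Fintype.expect_const]
    rw [← Fintype.expect_const (ι := Fin (2 ^ m)) (|∑ i, a (j i) * haar (j i) x|)]
    refine Finset.expect_congr rfl fun u _ => ?_
    rw [← Finset.mul_sum, abs_mul, rademacher_cellPoint (by omega), abs_sgn, one_mul]

section

/-! ### The Haar functions on the dyadic cells of a fixed level -/

/-- The value of a Haar function on a dyadic cell. -/
noncomputable def cellHaar (m : ℕ) (I : DyadicInterval) (s : Fin (2 ^ m)) : ℝ :=
  haar (some I) (cellPoint m s)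

/-- The dyadic interval contains the given cell of level `m` (which is at least its own level). -/
def DyadicInterval.HasCell (I : DyadicInterval) {m : ℕ} (s : Fin (2 ^ m)) : Prop :=
  (s : ℕ) / 2 ^ (m - I.level) = I.index

lemma floor_cellPoint {m j : ℕ} (h : j ≤ m) (s : Fin (2 ^ m)) :
    ⌊(2 : ℝ) ^ j * cellPoint m s⌋ = (((s : ℕ) / 2 ^ (m - j) : ℕ) : ℤ) := by
  rw [floor_refine h, cellPoint, mul_div_cancel₀ _ (by positivity)]
  push_cast
  rw [Int.floor_natCast]

variable {m : ℕ} {I J : DyadicInterval} {s : Fin (2 ^ m)}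

lemma cellHaar_apply (h : I.level < m) (s : Fin (2 ^ m)) : cellHaar m I s =
    if (s : ℕ) / 2 ^ (m - (I.level + 1)) = 2 * I.index then 1 else
      if (s : ℕ) / 2 ^ (m - (I.level + 1)) = 2 * I.index + 1 then -1 else 0 := by
  rw [cellHaar, haar_some_apply, floor_cellPoint h]
  simp only [← Nat.cast_ofNat (R := ℤ) (n := 2), ← Nat.cast_mul, ← Nat.cast_one (R := ℤ),
    ← Nat.cast_add, Nat.cast_inj]

lemma div_pow_succ {l : ℕ} (h : l < m) (s : ℕ) : s / 2 ^ (m - (l + 1)) / 2 = s / 2 ^ (m - l) := by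
  rw [Nat.div_div_eq_div_mul, ← pow_succ]
  congr 2
  omega

lemma DyadicInterval.hasCell_iff (h : I.level < m) :
    I.HasCell s ↔ (s : ℕ) / 2 ^ (m - (I.level + 1)) = 2 * I.index ∨
      (s : ℕ) / 2 ^ (m - (I.level + 1)) = 2 * I.index + 1 := by
  rw [HasCell, ← div_pow_succ h]
  omega

lemma cellHaar_eq_zero (h : I.level < m) (hs : ¬ I.HasCell s) : cellHaar m I s = 0 := by
  rw [DyadicInterval.hasCell_iff h, not_or] at hs
  rw [cellHaar_apply h, if_neg hs.1, if_neg hs.2]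

lemma abs_cellHaar (h : I.level < m) (hs : I.HasCell s) : |cellHaar m I s| = 1 := by
  rw [DyadicInterval.hasCell_iff h] at hs
  rw [cellHaar_apply h]
  split_ifs <;> simp_all

lemma cellHaar_ne_zero_iff (h : I.level < m) : cellHaar m I s ≠ 0 ↔ I.HasCell s := by
  refine ⟨fun hs => not_not.1 fun h' => hs (cellHaar_eq_zero h h'), fun hs h' => ?_⟩
  have := abs_cellHaar h hs
  simp [h'] at this

lemma abs_cellHaar_le (h : I.level < m) (s : Fin (2 ^ m)) : |cellHaar m I s| ≤ 1 := by
  by_cases hs : I.HasCell s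
  · exact (abs_cellHaar h hs).le
  · simp [cellHaar_eq_zero h hs]

lemma cellHaar_mul_self (h : I.level < m) (hs : I.HasCell s) :
    cellHaar m I s * cellHaar m I s = 1 := by
  rw [← abs_mul_abs_self, abs_cellHaar h hs, one_mul]

lemma div_pow_of_le {j l : ℕ} (hl : l ≤ m) (h : j ≤ l) (s : ℕ) :
    s / 2 ^ (m - j) = s / 2 ^ (m - l) / 2 ^ (l - j) := by
  rw [Nat.div_div_eq_div_mul, ← pow_add]
  congr 2
  omega

/-- Two cells lying in a common interval lie in the same intervals of smaller level. -/
lemma DyadicInterval.HasCell.congr {s' : Fin (2 ^ m)} (hJ : J.HasCell s) (hJ' : J.HasCell s')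
    (hl : I.level ≤ J.level) (hm : J.level ≤ m) : I.HasCell s ↔ I.HasCell s' := by
  rw [HasCell, HasCell, div_pow_of_le hm hl, div_pow_of_le hm hl s', hJ, hJ']

lemma cellHaar_congr {s' : Fin (2 ^ m)} (hJ : J.HasCell s) (hJ' : J.HasCell s')
    (hl : I.level < J.level) (hm : J.level ≤ m) : cellHaar m I s = cellHaar m I s' := by
  rw [cellHaar_apply (hl.trans_le hm), cellHaar_apply (hl.trans_le hm),
    div_pow_of_le hm (Nat.succ_le_of_lt hl), div_pow_of_le hm (Nat.succ_le_of_lt hl) s', hJ, hJ']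

/-- Intervals of the same level with a common cell agree. -/
lemma DyadicInterval.HasCell.eq (hI : I.HasCell s) (hJ : J.HasCell s) (hl : I.level = J.level) :
    I = J := by
  obtain ⟨l, i⟩ := I
  obtain ⟨l', j⟩ := J
  obtain rfl : l = l' := hl
  have : i = j := Fin.ext (hI.symm.trans hJ)
  rw [this]

/-- The interval of level `l` that contains a given cell. -/
def intervalAt {m : ℕ} (s : Fin (2 ^ m)) (l : ℕ) (h : l ≤ m) : DyadicInterval :=
  ⟨l, (s : ℕ) / 2 ^ (m - l), by
    rw [Nat.div_lt_iff_lt_mul (by positivity), ← pow_add, Nat.add_sub_cancel' h]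
    exact s.2⟩

lemma hasCell_intervalAt (s : Fin (2 ^ m)) (l : ℕ) (h : l ≤ m) : (intervalAt s l h).HasCell s :=
  rfl

lemma exists_hasCell (hI : I.level ≤ m) : ∃ s : Fin (2 ^ m), I.HasCell s := by
  refine ⟨⟨I.index * 2 ^ (m - I.level), ?_⟩, ?_⟩
  · calc (I.index : ℕ) * 2 ^ (m - I.level) < 2 ^ I.level * 2 ^ (m - I.level) :=
        Nat.mul_lt_mul_of_pos_right I.index.2 (by positivity)
      _ = 2 ^ m := by rw [← pow_add, Nat.add_sub_cancel' hI]
  · exact Nat.mul_div_cancel _ (by positivity)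

/-- The permutation of the cells of level `m` that exchanges the halves of all intervals of
level `l`. -/
def swapHalves (m l : ℕ) : Equiv.Perm (Fin (2 ^ (m + l + 1))) :=
  Function.Involutive.toPerm
    (fun s => ⟨(s : ℕ) ^^^ 2 ^ m, Nat.xor_lt_two_pow s.2
      (Nat.pow_lt_pow_right (by norm_num) (by omega))⟩)
    fun s => Fin.ext (by simp)

lemma swapHalves_div {l j : ℕ} (h : j ≤ l) (s : Fin (2 ^ (m + l + 1))) :
    (swapHalves m l s : ℕ) / 2 ^ (m + l + 1 - j) = (s : ℕ) / 2 ^ (m + l + 1 - j) := by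
  change ((s : ℕ) ^^^ 2 ^ m) / _ = _
  rw [← Nat.shiftRight_eq_div_pow, Nat.shiftRight_xor_distrib, Nat.shiftRight_eq_div_pow,
    Nat.shiftRight_eq_div_pow, Nat.div_eq_of_lt (a := 2 ^ m)
      (Nat.pow_lt_pow_right (by norm_num) (by omega)), Nat.xor_zero]

lemma swapHalves_div_succ {l : ℕ} (s : Fin (2 ^ (m + l + 1))) :
    (swapHalves m l s : ℕ) / 2 ^ m = ((s : ℕ) / 2 ^ m) ^^^ 1 := by
  change ((s : ℕ) ^^^ 2 ^ m) / _ = _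
  rw [← Nat.shiftRight_eq_div_pow, Nat.shiftRight_xor_distrib, Nat.shiftRight_eq_div_pow,
    Nat.shiftRight_eq_div_pow, Nat.div_self (by positivity)]

/-- The bit of the cell index that is flipped by the swap decides in which half of its interval of
level `I.level` the cell lies. -/
lemma cellHaar_swapHalves (s : Fin (2 ^ (m + I.level + 1))) :
    cellHaar _ I (swapHalves m I.level s) = -cellHaar _ I s := by
  have h2 := swapHalves_div_succ s
  have h1 := swapHalves_div le_rfl s
  have h3 : (((s : ℕ) / 2 ^ m) ^^^ 1) % 2 ≠ ((s : ℕ) / 2 ^ m) % 2 := by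
    rcases Nat.mod_two_eq_zero_or_one ((s : ℕ) / 2 ^ m) with h | h <;>
    simp [Nat.xor_mod_two_eq, Nat.add_mod, h]
  have e1 : m + I.level + 1 - (I.level + 1) = m := by omega
  rw [← div_pow_succ (l := I.level) (by omega) (s : ℕ),
    ← div_pow_succ (l := I.level) (by omega) (swapHalves m I.level s : ℕ), e1, h2] at h1
  rw [cellHaar_apply (by omega), cellHaar_apply (by omega), e1, h2]
  split_ifs <;> first | omega | norm_num

/-- A Haar function is orthogonal to the functions that do not distinguish its two halves. -/
lemma expect_cellHaar_mul (h : I.level < m) (φ : Fin (2 ^ m) → ℝ)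
    (hφ : ∀ s s', I.HasCell s → I.HasCell s' → φ s = φ s') :
    𝔼 s, cellHaar m I s * φ s = 0 := by
  obtain ⟨k, rfl⟩ : ∃ k, m = k + I.level + 1 := ⟨m - I.level - 1, by omega⟩
  -- Exchanging the halves of `I` preserves the mean and `φ` on `I`, but changes the sign of `h_I`;
  -- the mean equals its own negative.
  have key : 𝔼 s, cellHaar (k + I.level + 1) I s * φ s
      = 𝔼 s, -(cellHaar (k + I.level + 1) I s * φ s) := by
    rw [← Fintype.expect_equiv (swapHalves k I.level)
      (fun s => cellHaar _ I (swapHalves k I.level s) * φ (swapHalves k I.level s))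
      (fun s => cellHaar _ I s * φ s) fun s => rfl]
    refine Finset.expect_congr rfl fun s _ => ?_
    rw [cellHaar_swapHalves]
    by_cases hs : I.HasCell s
    · have hs' : I.HasCell (swapHalves k I.level s) := (swapHalves_div le_rfl s).trans hs
      rw [hφ _ _ hs' hs, neg_mul]
    · simp [cellHaar_eq_zero h hs]
  rw [Finset.expect_neg_distrib] at key
  linarith

lemma expect_cellHaar (h : I.level < m) : 𝔼 s, cellHaar m I s = 0 := by
  simpa using expect_cellHaar_mul h (fun _ => 1) fun _ _ _ _ => rfl

/-- Distinct intervals of equal level are disjoint; otherwise the Haar function of smaller level is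
constant on the other interval. -/
lemma expect_cellHaar_mul_cellHaar (hI : I.level < m) (hJ : J.level < m) (hne : I ≠ J) :
    𝔼 s, cellHaar m I s * cellHaar m J s = 0 := by
  rcases lt_trichotomy I.level J.level with h | h | h
  · simp only [mul_comm (cellHaar m I _)]
    exact expect_cellHaar_mul hJ _ fun s s' hs hs' => cellHaar_congr hs hs' h hJ.le
  · refine Finset.expect_eq_zero fun s _ => ?_
    by_cases hs : I.HasCell s
    · rw [cellHaar_eq_zero (I := J) hJ fun h' => hne (hs.eq h' h), mul_zero]
    · rw [cellHaar_eq_zero hI hs, zero_mul]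
  · exact expect_cellHaar_mul hI _ fun s s' hs hs' => cellHaar_congr hs hs' h hI.le

lemma abs_haar_some (I : DyadicInterval) (x : ℝ) :
    |haar (some I) x| = I.toSet.indicator 1 x := by
  classical
  rw [haar_some_apply, indicator_apply, Pi.one_apply]
  have h := floor_refine (Nat.le_succ I.level) x
  have e : ((2 ^ (I.level.succ - I.level) : ℕ) : ℤ) = 2 := by simp
  rw [e] at h
  have hm := I.mem_toSet x
  simp only [hm, h, Nat.succ_eq_add_one]
  split_ifs <;> first | omega | norm_num

lemma expect_abs_cellHaar (h : I.level < m) : 𝔼 s, |cellHaar m I s| = I.length := by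
  have h' := ((isStep_haar (some I)).mono h).integral_comp (fun t => |t|)
  refine h'.symm.trans ?_
  simp only [abs_haar_some]
  have hI : MeasurableSet I.toSet := measurableSet_Ico
  rw [integral_indicator_one hI, unitMeasure, measureReal_restrict_apply hI,
    inter_eq_left.2 I.toSet_subset, DyadicInterval.toSet, Real.volume_real_Ico,
    DyadicInterval.length, add_div, add_sub_cancel_left]
  exact max_eq_left (by positivity)

lemma expect_cellHaar_sq (h : I.level < m) :
    𝔼 s, cellHaar m I s * cellHaar m I s = I.length := by
  rw [← expect_abs_cellHaar h]
  refine Finset.expect_congr rfl fun s _ => ?_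
  by_cases hs : I.HasCell s
  · rw [abs_cellHaar h hs, cellHaar_mul_self h hs]
  · simp [cellHaar_eq_zero h hs]

end

section

/-! ### Coordinates on the level spaces -/

noncomputable instance : DecidableEq DyadicInterval := Classical.decEq _

/-- The dyadic intervals of level at most `n`. -/
abbrev LevelIndex (n : ℕ) : Type := {I : DyadicInterval // I.level ≤ n}

lemma haarNumber_lt {n : ℕ} (I : LevelIndex n) : haarNumber (some I.1) < 2 ^ (n + 1) := by
  have h1 : 2 ^ I.1.level ≤ 2 ^ n := Nat.pow_le_pow_right (by norm_num) I.2
  have h2 := I.1.index.2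
  rw [haarNumber, pow_succ]
  omega

lemma haarNumber_levelIndex_injective (n : ℕ) : Function.Injective fun I : LevelIndex n =>
    (⟨haarNumber (some I.1), haarNumber_lt I⟩ : Fin (2 ^ (n + 1))) := fun _ _ h =>
  Subtype.ext (Option.some_injective _ (haarNumber_injective (Fin.ext_iff.1 h)))

noncomputable instance (n : ℕ) : Fintype (LevelIndex n) :=
  Fintype.ofInjective _ (haarNumber_levelIndex_injective n)

lemma card_levelIndex_le (n : ℕ) : Fintype.card (LevelIndex n) ≤ 2 ^ (n + 1) := by
  simpa using Fintype.card_le_of_injective _ (haarNumber_levelIndex_injective n)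

variable (X : HaarSystemNorm) (r : RademacherChoice)

/-- The coordinates with respect to the Haar basis of `Y_n`. -/
noncomputable def levelVec (n : ℕ) : (LevelIndex n → ℝ) ≃ₗ[ℝ] levelSpace X r n :=
  LinearEquiv.ofBijective
    (Fintype.linearCombination ℝ fun I : LevelIndex n => levelHaar X r n I.1 I.2) (by
    have hli : LinearIndependent ℝ fun I : LevelIndex n => haarVec X r I.1 :=
      (haarBasis.linearIndependent).comp (fun I : LevelIndex n => some I.1) fun I J h =>
        Subtype.ext (Option.some_injective _ h)
    have hcoe : ∀ a : LevelIndex n → ℝ,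
        ((Fintype.linearCombination ℝ (fun I : LevelIndex n => levelHaar X r n I.1 I.2) a :
          levelSpace X r n) : HardySpan X r) = ∑ I, a I • haarVec X r I.1 := fun a => by
      rw [Fintype.linearCombination_apply, AddSubmonoidClass.coe_finsetSum]
      rfl
    constructor
    · rw [← LinearMap.ker_eq_bot, LinearMap.ker_eq_bot']
      intro a ha
      have h := congrArg (Subtype.val) ha
      rw [hcoe] at h
      funext I
      exact Fintype.linearIndependent_iff.1 hli a h I
    · rintro ⟨f, hf⟩
      have : haarVec X r '' {I | I.level ≤ n} = range fun I : LevelIndex n => haarVec X r I.1 := by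
        ext g; simp
      have hf' := hf
      rw [levelSpace, this, Submodule.mem_span_range_iff_exists_fun] at hf'
      obtain ⟨a, ha⟩ := hf'
      exact ⟨a, Subtype.ext ((hcoe a).trans ha)⟩)

variable {X r} {n : ℕ}

lemma levelVec_coe (a : LevelIndex n → ℝ) :
    (levelVec X r n a : HardySpan X r) = ∑ I, a I • haarVec X r I.1 := by
  change ((Fintype.linearCombination ℝ (fun I : LevelIndex n => levelHaar X r n I.1 I.2) a :
          levelSpace X r n) : HardySpan X r) = _
  rw [Fintype.linearCombination_apply, AddSubmonoidClass.coe_finsetSum]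
  rfl

lemma levelVec_single (I : LevelIndex n) :
    levelVec X r n (Pi.single I 1) = levelHaar X r n I.1 I.2 := by
  change Fintype.linearCombination ℝ (fun I : LevelIndex n => levelHaar X r n I.1 I.2) _ = _
  rw [Fintype.linearCombination_apply_single, one_smul]

lemma coeff_levelVec (a : LevelIndex n → ℝ) :
    (levelVec X r n a : HardySpan X r).coeff = ∑ I, a I • Finsupp.single (some I.1) 1 := by
  rw [levelVec_coe]
  change haarBasis.repr (∑ I, a I • (haarBasis (some I.1) : haarSpan)) = _
  simp [map_sum]

lemma coeff_levelVec_some (a : LevelIndex n → ℝ) (I : LevelIndex n) :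
    (levelVec X r n a : HardySpan X r).coeff (some I.1) = a I := by
  rw [coeff_levelVec, Finsupp.finsetSum_apply, Finset.sum_eq_single I]
  · simp
  · intro J _ hJ
    simp only [Finsupp.smul_apply, smul_eq_mul]
    rw [Finsupp.single_eq_of_ne, mul_zero]
    exact fun h => hJ (Subtype.ext (Option.some_injective _ h)).symm
  · simp

lemma coeff_levelVec_of_notMem (a : LevelIndex n → ℝ) (J : Option DyadicInterval)
    (hJ : J ∉ range fun I : LevelIndex n => some I.1) :
    (levelVec X r n a : HardySpan X r).coeff J = 0 := by
  rw [coeff_levelVec, Finsupp.finsetSum_apply]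
  refine Finset.sum_eq_zero fun I _ => ?_
  simp only [Finsupp.smul_apply, smul_eq_mul]
  rw [Finsupp.single_eq_of_ne, mul_zero]
  exact fun h => hJ ⟨I, h.symm⟩

/-! ### Norms through freely labelled random signs -/

/-- The labels of the intervals of level at most `n` that contain a given cell are distinct. -/
def SeparatesCells {n : ℕ} {ι : Type*} (m : ℕ) (κ : LevelIndex n → ι) : Prop :=
  ∀ s : Fin (2 ^ m), InjOn κ {I | I.1.HasCell s}

/-- The function whose norm in `X` is the norm of `∑ a_I h_I`, on the cells of level `m`; the
random signs are labelled by `κ`. -/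
noncomputable def squareFun (r : RademacherChoice) {n : ℕ} {ι : Type*} [Fintype ι]
    [DecidableEq ι] (m : ℕ) (κ : LevelIndex n → ι) (a : LevelIndex n → ℝ) (s : Fin (2 ^ m)) : ℝ :=
  𝔼 b : ι → Bool, |∑ I, r.sign (b (κ I)) * (a I * cellHaar m I.1 s)|

lemma squareFun_nonneg {ι : Type*} [Fintype ι] [DecidableEq ι] (m : ℕ) (κ : LevelIndex n → ι)
    (a : LevelIndex n → ℝ) (s : Fin (2 ^ m)) : 0 ≤ squareFun r m κ a s :=
  Finset.expect_nonneg fun _ _ => abs_nonneg _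

/-- At any cell only the intervals containing it contribute, so each labelling that separates those
gives the same norm. This freedom allows the same random signs to be used in `Y_n` and in the large
space. -/
lemma norm_levelVec {ι : Type*} [Fintype ι] [DecidableEq ι] {m : ℕ} (hm : n < m)
    {κ : LevelIndex n → ι} (hκ : SeparatesCells m κ) (a : LevelIndex n → ℝ) :
    ‖levelVec X r n a‖ = X.stepNorm m (squareFun r m κ a) := by
  have hj : Function.Injective fun I : LevelIndex n => some I.1 := fun I J h =>
    Subtype.ext (Option.some_injective _ h)
  have hstep : IsStep m (averagedSum r (levelVec X r n a : HardySpan X r).coeff) := by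
    have hI : ∀ I : LevelIndex n, IsStep m (haar (some I.1)) := fun I =>
      (isStep_haar (some I.1)).mono (Nat.succ_le_of_lt (I.2.trans_lt hm))
    refine (isStep_iff _ _).2 ⟨fun x hx => ?_, fun x hx y hy hxy => ?_⟩
    · simp [averagedSum, randomSum, haar_eq_zero _ hx]
    · rw [averagedSum_eq_expect r _ hj (coeff_levelVec_of_notMem a) x
        (Function.injective_id (α := LevelIndex n)).injOn,
        averagedSum_eq_expect r _ hj (coeff_levelVec_of_notMem a) y
        (Function.injective_id (α := LevelIndex n)).injOn]
      simp only [((isStep_iff _ _).1 (hI _)).2 x hx y hy hxy]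
  rw [Submodule.coe_norm, HardySpan.norm_def, HaarSystemNorm.stepNorm_apply]
  congr 1
  apply Subtype.ext
  change averagedSum r (levelVec X r n a : HardySpan X r).coeff = _
  rw [hstep.eq_stepVec]
  congr 2
  funext s
  rw [averagedSum_eq_expect r _ hj (coeff_levelVec_of_notMem a) (cellPoint m s) (κ := κ)]
  · simp only [coeff_levelVec_some]
    rfl
  · intro I hI J hJ h
    have aux : ∀ I : LevelIndex n, cellHaar m I.1 s ≠ 0 → I.1.HasCell s := fun I =>
      (cellHaar_ne_zero_iff (I.2.trans_lt hm)).1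
    exact hκ s (aux I (right_ne_zero_of_mul hI)) (aux J (right_ne_zero_of_mul hJ)) h

lemma separatesCells_id (m n : ℕ) : SeparatesCells m (id : LevelIndex n → LevelIndex n) :=
  fun _ => Function.injective_id.injOn

/-- Pairing an element of `Y_n` with a Haar function extracts a coefficient. -/
lemma pairing_levelVec (a : LevelIndex n → ℝ) (I : LevelIndex n) :
    pairing (haar (some I.1)) (levelVec X r n a : HardySpan X r).toFunction
      = I.1.length * a I := by
  have hf : (levelVec X r n a : HardySpan X r).toFunction
      = fun x => ∑ J, a J * haar (some J.1) x := by
    rw [levelVec_coe]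
    funext x
    change ((∑ J, a J • (haarBasis (some J.1) : haarSpan) : haarSpan) : ℝ → ℝ) x = _
    rw [AddSubmonoidClass.coe_finsetSum, Finset.sum_apply]
    simp only [Submodule.coe_smul, haarBasis_apply, Pi.smul_apply, smul_eq_mul]
  have hcell : ∀ (J : LevelIndex n) (x : ℝ), x ∈ Ico (0 : ℝ) 1 →
      haar (some J.1) x = cellHaar (n + 1) J.1 (cellOf (n + 1) x) := by
    intro J x hx
    have := congrFun ((isStep_haar (some J.1)).mono (Nat.succ_le_succ J.2)).eq_stepVec x
    rwa [stepVec_apply, if_pos hx] at this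
  have hl : ∀ J : LevelIndex n, J.1.level < n + 1 := fun J => Nat.lt_succ_of_le J.2
  calc pairing (haar (some I.1)) (levelVec X r n a : HardySpan X r).toFunction
      = ∫ x, (fun s => cellHaar (n + 1) I.1 s * ∑ J, a J * cellHaar (n + 1) J.1 s)
          (cellOf (n + 1) x) ∂unitMeasure := by
        rw [hf, pairing]
        refine integral_congr_ae ?_
        filter_upwards [ae_mem_unit] with x hx
        simp only [hcell _ x hx]
    _ = ∑ J, a J * 𝔼 s, cellHaar (n + 1) I.1 s * cellHaar (n + 1) J.1 s := by
        refine (integral_cellOf (n + 1) fun s =>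
          cellHaar (n + 1) I.1 s * ∑ J, a J * cellHaar (n + 1) J.1 s).trans ?_
        simp only [Finset.mul_sum, Finset.mul_expect]
        rw [Finset.expect_sum_comm]
        exact Finset.sum_congr rfl fun J _ => Finset.expect_congr rfl fun s _ => by ring
    _ = I.1.length * a I := by
        rw [Finset.sum_eq_single I, expect_cellHaar_sq (hl I), mul_comm]
        · intro J _ hJ
          rw [expect_cellHaar_mul_cellHaar (hl I) (hl J) fun h => hJ (Subtype.ext h).symm, mul_zero]
        · simp

end

section

/-! ### Block systems -/

variable {n M : ℕ}

/-- The kernel `1 + ∑ |I|⁻¹ h_I(x) g_I(s)` of a system `g_I = ∑ β_{I,K} h_K`. -/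
noncomputable def blockKernel (β : LevelIndex n → LevelIndex M → ℝ)
    (x s : Fin (2 ^ (M + 1))) : ℝ :=
  1 + ∑ I, ∑ K, 2 ^ I.1.level * cellHaar (M + 1) I.1 x * β I K * cellHaar (M + 1) K.1 s

/-- The functions `g_I = ∑ β_{I,K} h_K` form a block system: their kernel is nonnegative, and the
intervals `K` can be labelled in such a way that those that occur in `g_I` are labelled by the
level of `I`, while distinct intervals with a common point have distinct labels. -/
structure IsBlockSystem (β : LevelIndex n → LevelIndex M → ℝ)
    (κ : LevelIndex M → Fin (n + 1) ⊕ LevelIndex M) : Prop where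
  le : n ≤ M
  label_eq : ∀ I K, β I K ≠ 0 → κ K = .inl ⟨I.1.level, Nat.lt_succ_of_le I.2⟩
  separates : SeparatesCells (M + 1) κ
  kernel_nonneg : ∀ x s, 0 ≤ blockKernel β x s

/-- The coordinates of `∑ a_I g_I`. -/
noncomputable def blockSum (β : LevelIndex n → LevelIndex M → ℝ) :
    (LevelIndex n → ℝ) →ₗ[ℝ] (LevelIndex M → ℝ) where
  toFun a K := ∑ I, a I * β I K
  map_add' a b := by
    funext K; simp [add_mul, Finset.sum_add_distrib]
  map_smul' t a := by
    funext K; simp [Finset.mul_sum, mul_assoc]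

/-- The coordinates of `∑ |I|⁻¹ ⟨f, g_I⟩ h_I`. -/
noncomputable def blockCoord (β : LevelIndex n → LevelIndex M → ℝ) :
    (LevelIndex M → ℝ) →ₗ[ℝ] (LevelIndex n → ℝ) where
  toFun b I := ∑ K, 2 ^ I.1.level * β I K * K.1.length * b K
  map_add' a b := by
    funext I; simp [mul_add, Finset.sum_add_distrib]
  map_smul' t a := by
    funext I; simp only [Pi.smul_apply, smul_eq_mul, RingHom.id_apply, Finset.mul_sum]
    exact Finset.sum_congr rfl fun K _ => by ring

lemma level_lt (K : LevelIndex M) : K.1.level < M + 1 := Nat.lt_succ_of_le K.2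

lemma expect_cellHaar_mul_ite (K L : LevelIndex M) :
    𝔼 s, cellHaar (M + 1) K.1 s * cellHaar (M + 1) L.1 s = if K = L then K.1.length else 0 := by
  split_ifs with h
  · subst h
    exact expect_cellHaar_sq (level_lt K)
  · exact expect_cellHaar_mul_cellHaar (level_lt K) (level_lt L) fun h' => h (Subtype.ext h')

/-- The label of an interval by its level separates the cells. -/
def levelLabel (ι : Type*) (I : LevelIndex n) : Fin (n + 1) ⊕ ι :=
  .inl ⟨I.1.level, Nat.lt_succ_of_le I.2⟩

lemma separatesCells_levelLabel (m : ℕ) (ι : Type*) :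
    SeparatesCells m (levelLabel ι : LevelIndex n → Fin (n + 1) ⊕ ι) := by
  intro s I hI J hJ h
  simp only [levelLabel, Sum.inl.injEq, Fin.mk.injEq] at h
  exact Subtype.ext (DyadicInterval.HasCell.eq hI hJ h)

/-- Haar functions have mean zero, so only the constant term survives. Together with
`IsBlockSystem.expect_right` this makes the kernel doubly stochastic. -/
lemma expect_blockKernel (β : LevelIndex n → LevelIndex M → ℝ) (x : Fin (2 ^ (M + 1))) :
    𝔼 s, blockKernel β x s = 1 := by
  simp only [blockKernel]
  rw [Finset.expect_add_distrib, Fintype.expect_one, Finset.expect_sum_comm]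
  rw [Finset.sum_eq_zero, add_zero]
  intro I _
  rw [Finset.expect_sum_comm]
  refine Finset.sum_eq_zero fun K _ => ?_
  rw [← Finset.mul_expect, expect_cellHaar (level_lt K), mul_zero]

/-- By orthogonality, integration in `s` realizes the coordinate map `blockCoord` on Haar functions.
-/
lemma expect_kernel_mul_cellHaar (β : LevelIndex n → LevelIndex M → ℝ) (x : Fin (2 ^ (M + 1)))
    (K : LevelIndex M) :
    𝔼 s, blockKernel β x s * cellHaar (M + 1) K.1 s
      = ∑ I, 2 ^ I.1.level * cellHaar (M + 1) I.1 x * β I K * K.1.length := by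
  simp only [blockKernel, add_mul, one_mul, Finset.sum_mul]
  rw [Finset.expect_add_distrib, expect_cellHaar (level_lt K), zero_add, Finset.expect_sum_comm]
  refine Finset.sum_congr rfl fun I _ => ?_
  rw [Finset.expect_sum_comm]
  simp only [mul_assoc, ← Finset.mul_expect, expect_cellHaar_mul_ite]
  rw [Finset.sum_eq_single K]
  · simp
  · intro L _ hL
    simp [hL]
  · simp

namespace IsBlockSystem

variable {β : LevelIndex n → LevelIndex M → ℝ} {κ : LevelIndex M → Fin (n + 1) ⊕ LevelIndex M}
  {X : HaarSystemNorm} {r : RademacherChoice}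

lemma level_lt_left (h : IsBlockSystem β κ) (I : LevelIndex n) : I.1.level < M + 1 :=
  Nat.lt_succ_of_le (I.2.trans h.le)

lemma expect_right (h : IsBlockSystem β κ)
    (s : Fin (2 ^ (M + 1))) : 𝔼 x, blockKernel β x s = 1 := by
  simp only [blockKernel]
  rw [Finset.expect_add_distrib, Fintype.expect_one, Finset.expect_sum_comm]
  rw [Finset.sum_eq_zero, add_zero]
  intro I _
  rw [Finset.expect_sum_comm]
  refine Finset.sum_eq_zero fun K _ => ?_
  rw [← Finset.expect_mul, ← Finset.expect_mul, ← Finset.mul_expect,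
    expect_cellHaar (h.level_lt_left I)]
  ring

/-- By orthogonality in the other variable, integration in `x` sends `h_I` to `g_I`, which realizes
`blockSum`. -/
lemma expect_kernel_mul_cellHaar_left (h : IsBlockSystem β κ)
    (s : Fin (2 ^ (M + 1))) (I : LevelIndex n) :
    𝔼 x, blockKernel β x s * cellHaar (M + 1) I.1 x = ∑ K, β I K * cellHaar (M + 1) K.1 s := by
  let e : LevelIndex n → LevelIndex M := fun I => ⟨I.1, I.2.trans h.le⟩
  have key : ∀ J : LevelIndex n, 𝔼 x, cellHaar (M + 1) J.1 x * cellHaar (M + 1) I.1 x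
      = if J = I then I.1.length else 0 := by
    intro J
    rw [expect_cellHaar_mul_ite (e J) (e I)]
    by_cases hJ : J = I
    · rw [if_pos hJ, if_pos (by rw [hJ]), hJ]
    · have hne : e J ≠ e I := fun h' => hJ (Subtype.ext (congrArg (fun K => K.1) h'))
      rw [if_neg hJ, if_neg hne]
  simp only [blockKernel, add_mul, one_mul, Finset.sum_mul]
  rw [Finset.expect_add_distrib, expect_cellHaar (h.level_lt_left I), zero_add,
    Finset.expect_sum_comm, Finset.sum_eq_single I]
  · rw [Finset.expect_sum_comm]
    refine Finset.sum_congr rfl fun K _ => ?_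
    have : ∀ x, 2 ^ I.1.level * cellHaar (M + 1) I.1 x * β I K * cellHaar (M + 1) K.1 s
        * cellHaar (M + 1) I.1 x = (2 ^ I.1.level * β I K * cellHaar (M + 1) K.1 s)
          * (cellHaar (M + 1) I.1 x * cellHaar (M + 1) I.1 x) := fun x => by ring
    simp only [this]
    rw [← Finset.mul_expect, key, if_pos rfl, DyadicInterval.length]
    field_simp
  · intro J _ hJ
    rw [Finset.expect_sum_comm]
    refine Finset.sum_eq_zero fun K _ => ?_
    have : ∀ x, 2 ^ J.1.level * cellHaar (M + 1) J.1 x * β J K * cellHaar (M + 1) K.1 s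
        * cellHaar (M + 1) I.1 x = (2 ^ J.1.level * β J K * cellHaar (M + 1) K.1 s)
          * (cellHaar (M + 1) J.1 x * cellHaar (M + 1) I.1 x) := fun x => by ring
    simp only [this]
    rw [← Finset.mul_expect, key, if_neg hJ, mul_zero]
  · simp

/-- For each fixed sign pattern the kernel maps the signed sum of `b` to the signed sum of its
coordinates, because every `K` occurring in `g_I` has the label of `I`. The triangle inequality for
the nonnegative kernel is then averaged over the signs. -/
lemma squareFun_blockCoord_le (h : IsBlockSystem β κ)
    (b : LevelIndex M → ℝ) (x : Fin (2 ^ (M + 1))) :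
    squareFun r (M + 1) (levelLabel (LevelIndex M)) (blockCoord β b) x
      ≤ 𝔼 s, blockKernel β x s * squareFun r (M + 1) κ b s := by
  simp only [squareFun, Finset.mul_expect]
  rw [Finset.expect_comm]
  refine Finset.expect_le_expect fun ε _ => ?_
  calc |∑ I, r.sign (ε (levelLabel (LevelIndex M) I)) *
          (blockCoord β b I * cellHaar (M + 1) I.1 x)|
      = |𝔼 s, blockKernel β x s * ∑ K, r.sign (ε (κ K)) * (b K * cellHaar (M + 1) K.1 s)| := by
        congr 1
        simp only [Finset.mul_sum]
        rw [Finset.expect_sum_comm]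
        have : ∀ (K : LevelIndex M) (s : Fin (2 ^ (M + 1))), blockKernel β x s *
            (r.sign (ε (κ K)) * (b K * cellHaar (M + 1) K.1 s)) = r.sign (ε (κ K)) * b K *
              (blockKernel β x s * cellHaar (M + 1) K.1 s) := fun K s => by ring
        simp only [this, ← Finset.mul_expect, expect_kernel_mul_cellHaar, Finset.mul_sum]
        rw [Finset.sum_comm]
        refine Finset.sum_congr rfl fun I _ => ?_
        simp only [blockCoord, LinearMap.coe_mk, AddHom.coe_mk, Finset.sum_mul, Finset.mul_sum]
        refine Finset.sum_congr rfl fun K _ => ?_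
        by_cases hβ : β I K = 0
        · simp [hβ]
        · rw [h.label_eq I K hβ, levelLabel]; ring
    _ ≤ 𝔼 s, |blockKernel β x s * ∑ K, r.sign (ε (κ K)) * (b K * cellHaar (M + 1) K.1 s)| :=
        Finset.abs_expect_le _ _
    _ = 𝔼 s, blockKernel β x s * |∑ K, r.sign (ε (κ K)) * (b K * cellHaar (M + 1) K.1 s)| := by
        simp only [abs_mul, abs_of_nonneg (h.kernel_nonneg _ _)]

/-- The same argument with the two variables of the kernel exchanged. -/
lemma squareFun_blockSum_le (h : IsBlockSystem β κ) (a : LevelIndex n → ℝ) (s : Fin (2 ^ (M + 1))) :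
    squareFun r (M + 1) κ (blockSum β a) s
      ≤ 𝔼 x, blockKernel β x s * squareFun r (M + 1) (levelLabel (LevelIndex M)) a x := by
  simp only [squareFun, Finset.mul_expect]
  rw [Finset.expect_comm]
  refine Finset.expect_le_expect fun ε _ => ?_
  calc |∑ K, r.sign (ε (κ K)) * (blockSum β a K * cellHaar (M + 1) K.1 s)|
      = |𝔼 x, blockKernel β x s * ∑ I, r.sign (ε (levelLabel (LevelIndex M) I)) *
          (a I * cellHaar (M + 1) I.1 x)| := by
        congr 1
        simp only [Finset.mul_sum]
        rw [Finset.expect_sum_comm]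
        have : ∀ (I : LevelIndex n) (x : Fin (2 ^ (M + 1))), blockKernel β x s *
            (r.sign (ε (levelLabel (LevelIndex M) I)) * (a I * cellHaar (M + 1) I.1 x)) =
            r.sign (ε (levelLabel (LevelIndex M) I)) * a I *
              (blockKernel β x s * cellHaar (M + 1) I.1 x) := fun I x => by ring
        simp only [this, ← Finset.mul_expect, h.expect_kernel_mul_cellHaar_left, Finset.mul_sum]
        rw [Finset.sum_comm]
        refine Finset.sum_congr rfl fun K _ => ?_
        simp only [blockSum, LinearMap.coe_mk, AddHom.coe_mk, Finset.sum_mul, Finset.mul_sum]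
        refine Finset.sum_congr rfl fun I _ => ?_
        by_cases hβ : β I K = 0
        · simp [hβ]
        · rw [h.label_eq I K hβ, levelLabel]; ring
    _ ≤ 𝔼 x, |blockKernel β x s * ∑ I, r.sign (ε (levelLabel (LevelIndex M) I)) *
          (a I * cellHaar (M + 1) I.1 x)| := Finset.abs_expect_le _ _
    _ = _ := by
        simp only [abs_mul, abs_of_nonneg (h.kernel_nonneg _ _)]

/-- The block system spans the level space contractively. -/
theorem norm_blockSum_le (h : IsBlockSystem β κ) (a : LevelIndex n → ℝ) :
    ‖levelVec X r M (blockSum β a)‖ ≤ ‖levelVec X r n a‖ := by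
  rw [norm_levelVec M.lt_succ_self h.separates, norm_levelVec (Nat.lt_succ_of_le h.le)
    (separatesCells_levelLabel (M + 1) (LevelIndex M))]
  refine le_trans (X.stepNorm_mono fun s => ?_) (X.stepNorm_average_le
    (fun s x => blockKernel β x s) (fun s x => h.kernel_nonneg x s) h.expect_right
    (expect_blockKernel β) _)
  rw [abs_of_nonneg (squareFun_nonneg _ _ _ _)]
  exact (h.squareFun_blockSum_le a s).trans (le_abs_self _)

/-- The coordinates with respect to the block system are contractive. -/
theorem norm_blockCoord_le (h : IsBlockSystem β κ) (b : LevelIndex M → ℝ) :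
    ‖levelVec X r n (blockCoord β b)‖ ≤ ‖levelVec X r M b‖ := by
  rw [norm_levelVec M.lt_succ_self h.separates, norm_levelVec (Nat.lt_succ_of_le h.le)
    (separatesCells_levelLabel (M + 1) (LevelIndex M))]
  refine le_trans (X.stepNorm_mono fun s => ?_) (X.stepNorm_average_le
    (blockKernel β) h.kernel_nonneg (expect_blockKernel β) h.expect_right _)
  rw [abs_of_nonneg (squareFun_nonneg _ _ _ _)]
  exact (h.squareFun_blockCoord_le b s).trans (le_abs_self _)

end IsBlockSystem

end

section

/-! ### Estimates for coefficients and matrix entries -/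

variable {X : HaarSystemNorm} {r : RademacherChoice} {n M : ℕ}

lemma squareFun_single {m : ℕ} (L : LevelIndex n) (s : Fin (2 ^ m)) :
    squareFun r m (id : LevelIndex n → LevelIndex n) (Pi.single L 1) s = |cellHaar m L.1 s| := by
  have hs : ∀ b, |r.sign b| = 1 := fun b => by
    cases r
    · exact abs_sgn b
    · exact abs_one
  rw [squareFun, ← Fintype.expect_const (ι := LevelIndex n → Bool) |cellHaar m L.1 s|]
  refine Finset.expect_congr rfl fun b _ => ?_
  rw [Finset.sum_eq_single L]
  · simp [abs_mul, hs]
  · intro J _ hJ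
    simp [Pi.single_eq_of_ne hJ]
  · simp

lemma norm_levelVec_single {m : ℕ} (hm : n < m) (L : LevelIndex n) :
    ‖levelVec X r n (Pi.single L 1)‖ = X.stepNorm m fun s => |cellHaar m L.1 s| := by
  rw [norm_levelVec hm (separatesCells_id m n)]
  congr 1
  funext s
  exact squareFun_single L s

lemma norm_levelVec_single_pos (L : LevelIndex n) : 0 < ‖levelVec X r n (Pi.single L 1)‖ := by
  rw [norm_pos_iff]
  intro h
  have := (levelVec X r n).map_eq_zero_iff.1 h
  simpa using congrFun this L

lemma stepNorm_one (X : HaarSystemNorm) (m : ℕ) : X.stepNorm m (fun _ => 1) = 1 := by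
  rw [HaarSystemNorm.stepNorm_apply]
  refine Eq.trans ?_ X.norm_one
  refine congrArg X.toSeminorm (Subtype.ext (funext fun x => ?_))
  classical
  simp [stepVec_apply, haar, indicator_apply]

lemma norm_levelVec_single_le (L : LevelIndex n) : ‖levelVec X r n (Pi.single L 1)‖ ≤ 1 := by
  rw [norm_levelVec_single n.lt_succ_self, ← stepNorm_one X (n + 1)]
  refine X.stepNorm_mono fun s => ?_
  rw [abs_abs, abs_one]
  exact abs_cellHaar_le (level_lt L) s

/-- The interval `[0, 1)`, as an index of `Y_n`. -/
def rootIndex (n : ℕ) : LevelIndex n := ⟨⟨0, 0⟩, Nat.zero_le n⟩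

lemma hasCell_rootIndex {m : ℕ} (s : Fin (2 ^ m)) : (rootIndex n).1.HasCell s := by
  change (s : ℕ) / 2 ^ (m - 0) = 0
  exact Nat.div_eq_of_lt s.2

lemma norm_levelVec_rootIndex : ‖levelVec X r n (Pi.single (rootIndex n) 1)‖ = 1 := by
  rw [norm_levelVec_single n.lt_succ_self, ← stepNorm_one X (n + 1)]
  congr 1
  funext s
  exact abs_cellHaar (level_lt _) (hasCell_rootIndex s)

/-- The index of the interval of level `a` that contains a given cell. -/
def indexAt {m : ℕ} (s : Fin (2 ^ m)) (a : ℕ) (h : a ≤ m) : Fin (2 ^ a) := (intervalAt s a h).index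

lemma abs_cellHaar_mk {m a : ℕ} (h : a < m) (q : Fin (2 ^ a)) (s : Fin (2 ^ m)) :
    |cellHaar m ⟨a, q⟩ s| = if indexAt s a h.le = q then 1 else 0 := by
  have e : indexAt s a h.le = q ↔ (⟨a, q⟩ : DyadicInterval).HasCell s := Fin.ext_iff
  split_ifs with hs
  · exact abs_cellHaar (I := ⟨a, q⟩) h (e.1 hs)
  · rw [cellHaar_eq_zero (I := ⟨a, q⟩) h fun h' => hs (e.2 h'), abs_zero]

/-- For each sign pattern, pairing the signed sum with `h_K` leaves only `± |K| b_K`; the triangle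
inequality is then averaged over the signs. -/
lemma abs_coeff_mul_length_le {m : ℕ} (hm : n < m) (b : LevelIndex n → ℝ) (K : LevelIndex n) :
    K.1.length * |b K| ≤ 𝔼 s, |cellHaar m K.1 s| * squareFun r m id b s := by
  have hs : ∀ b, |r.sign b| = 1 := fun b => by
    cases r
    · exact abs_sgn b
    · exact abs_one
  have hl : ∀ J : LevelIndex n, J.1.level < m := fun J => J.2.trans_lt hm
  have hlen : 0 ≤ K.1.length := by unfold DyadicInterval.length; positivity
  simp only [squareFun, Finset.mul_expect]
  rw [Finset.expect_comm, ← Fintype.expect_const (ι := LevelIndex n → Bool) (_ * _)]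
  refine Finset.expect_le_expect fun ε _ => ?_
  calc K.1.length * |b K|
      = |𝔼 s, cellHaar m K.1 s * ∑ I, r.sign (ε (id I)) * (b I * cellHaar m I.1 s)| := by
        simp only [Finset.mul_sum]
        rw [Finset.expect_sum_comm, Finset.sum_eq_single K]
        · have : ∀ s, cellHaar m K.1 s * (r.sign (ε (id K)) * (b K * cellHaar m K.1 s))
              = r.sign (ε K) * b K * (cellHaar m K.1 s * cellHaar m K.1 s) := fun s => by
            simp only [id]; ring
          simp only [this]
          rw [← Finset.mul_expect, expect_cellHaar_sq (hl K), abs_mul, abs_mul, hs, one_mul,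
            abs_of_nonneg hlen, mul_comm]
        · intro J _ hJ
          have : ∀ s, cellHaar m K.1 s * (r.sign (ε (id J)) * (b J * cellHaar m J.1 s))
              = r.sign (ε J) * b J * (cellHaar m K.1 s * cellHaar m J.1 s) := fun s => by
            simp only [id]; ring
          simp only [this]
          rw [← Finset.mul_expect, expect_cellHaar_mul_cellHaar (hl K) (hl J)
            fun h => hJ (Subtype.ext h).symm, mul_zero]
        · simp
    _ ≤ 𝔼 s, |cellHaar m K.1 s * ∑ I, r.sign (ε (id I)) * (b I * cellHaar m I.1 s)| :=
        Finset.abs_expect_le _ _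
    _ = _ := by simp only [abs_mul]

/-- A coefficient of a vector in `Y_n` is controlled by the norm, in comparison with the norm of an
arbitrary Haar function. -/
theorem coeff_mul_norm_single_le {a : ℕ} (b : LevelIndex n → ℝ) (K L : LevelIndex n)
    (hK : a ≤ K.1.level) (hL : a ≤ L.1.level) :
    2 ^ a * (K.1.length * |b K|) * ‖levelVec X r n (Pi.single L 1)‖ ≤ ‖levelVec X r n b‖ := by
  have ha : a < n + 1 := Nat.lt_succ_of_le (hK.trans K.2)
  obtain ⟨k, hk⟩ := exists_hasCell (m := n + 1) (level_lt K).le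
  obtain ⟨l, hl⟩ := exists_hasCell (m := n + 1) (level_lt L).le
  -- The kernel `w` averages over the intervals of level `a`, after exchanging the ones above `K`
  -- and `L`. It transports mass from `K` to `L` and is doubly stochastic.
  let idx : Fin (2 ^ (n + 1)) → Fin (2 ^ a) := fun s => indexAt s a ha.le
  let σ : Equiv.Perm (Fin (2 ^ a)) := Equiv.swap (idx l) (idx k)
  let w : Fin (2 ^ (n + 1)) → Fin (2 ^ (n + 1)) → ℝ := fun x s =>
    2 ^ a * |cellHaar (n + 1) ⟨a, σ (idx x)⟩ s|
  have hw0 : ∀ x s, 0 ≤ w x s := fun x s => by positivity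
  have hw1 : ∀ x, 𝔼 s, w x s = 1 := fun x => by
    simp only [w]
    rw [← Finset.mul_expect, expect_abs_cellHaar (I := ⟨a, σ (idx x)⟩) ha, DyadicInterval.length]
    field_simp
  have hsymm : ∀ x s, w x s = w s x := by
    intro x s
    simp only [w]
    rw [abs_cellHaar_mk ha, abs_cellHaar_mk ha]
    congr 1
    have : idx s = σ (idx x) ↔ idx x = σ (idx s) := by
      rw [eq_comm, ← Equiv.eq_symm_apply, Equiv.symm_swap]
    by_cases h : idx s = σ (idx x)
    · rw [if_pos h, if_pos (this.1 h)]
    · rw [if_neg h, if_neg fun h' => h (this.2 h')]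
  have hw2 : ∀ s, 𝔼 x, w x s = 1 := fun s => by
    simp only [hsymm _ s]
    exact hw1 s
  have hidx : ∀ (J : LevelIndex n) (s s' : Fin (2 ^ (n + 1))), a ≤ J.1.level → J.1.HasCell s →
      J.1.HasCell s' → idx s = idx s' := by
    intro J s s' hJ hs hs'
    have := (hs.congr (I := intervalAt s' a ha.le) hs' hJ (level_lt J).le).2
      (hasCell_intervalAt s' a ha.le)
    exact Fin.ext this
  -- On `L` the kernel averages over the interval of level `a` that contains `K`, which dominates `2
  -- ^ a` times the integral over `K`.
  have key : ∀ x, 2 ^ a * (K.1.length * |b K|) * |cellHaar (n + 1) L.1 x|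
      ≤ 𝔼 s, w x s * squareFun r (n + 1) id b s := by
    intro x
    by_cases hx : L.1.HasCell x
    · rw [abs_cellHaar (level_lt L) hx, mul_one]
      refine (mul_le_mul_of_nonneg_left
        (abs_coeff_mul_length_le (r := r) n.lt_succ_self b K) (by positivity)).trans ?_
      rw [Finset.mul_expect]
      refine Finset.expect_le_expect fun s _ => ?_
      rw [← mul_assoc]
      refine mul_le_mul_of_nonneg_right ?_ (squareFun_nonneg _ _ _ _)
      refine mul_le_mul_of_nonneg_left ?_ (by positivity)
      by_cases hs : K.1.HasCell s
      · rw [abs_cellHaar (level_lt K) hs, abs_cellHaar_mk ha, if_pos]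
        change idx s = σ (idx x)
        rw [hidx L x l hL hx hl, hidx K s k hK hs hk, Equiv.swap_apply_left]
      · rw [cellHaar_eq_zero (level_lt K) hs, abs_zero]
        exact abs_nonneg _
    · rw [cellHaar_eq_zero (level_lt L) hx, abs_zero, mul_zero]
      exact Finset.expect_nonneg fun s _ => mul_nonneg (hw0 x s) (squareFun_nonneg _ _ _ _)
  have hc : 0 ≤ 2 ^ a * (K.1.length * |b K|) := by
    unfold DyadicInterval.length; positivity
  rw [norm_levelVec_single n.lt_succ_self, norm_levelVec n.lt_succ_self (separatesCells_id _ n)]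
  calc 2 ^ a * (K.1.length * |b K|) * X.stepNorm (n + 1) (fun s => |cellHaar (n + 1) L.1 s|)
      = X.stepNorm (n + 1)
          ((2 ^ a * (K.1.length * |b K|)) • fun s => |cellHaar (n + 1) L.1 s|) := by
        rw [map_smul_eq_mul, Real.norm_of_nonneg hc]
    _ ≤ X.stepNorm (n + 1) (fun x => 𝔼 s, w x s * squareFun r (n + 1) id b s) := by
        refine X.stepNorm_mono fun x => ?_
        rw [Pi.smul_apply, smul_eq_mul, abs_of_nonneg (mul_nonneg hc (abs_nonneg _))]
        exact (key x).trans (le_abs_self _)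
    _ ≤ _ := X.stepNorm_average_le w hw0 hw1 hw2 _

lemma length_mul_abs_coeff_le (b : LevelIndex n → ℝ) (K : LevelIndex n) :
    K.1.length * |b K| ≤ ‖levelVec X r n b‖ := by
  have := coeff_mul_norm_single_le (X := X) (r := r) (a := 0) b K (rootIndex n) (Nat.zero_le _)
    (Nat.zero_le _)
  rwa [norm_levelVec_rootIndex, pow_zero, one_mul, mul_one] at this

/-! ### The matrix of an operator in the Haar system -/

/-- The matrix entries `⟨h_K, T h_L⟩` of an operator. -/
noncomputable def opEntry (T : levelSpace X r M →L[ℝ] levelSpace X r M) (K L : LevelIndex M) : ℝ :=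
  K.1.length * (levelVec X r M).symm (T (levelVec X r M (Pi.single L 1))) K

lemma pairing_eq_opEntry (T : levelSpace X r M →L[ℝ] levelSpace X r M) (K L : LevelIndex M) :
    pairing (haar (some K.1)) (T (levelHaar X r M L.1 L.2) : HardySpan X r).toFunction
      = opEntry T K L := by
  rw [opEntry, ← levelVec_single, ← pairing_levelVec (X := X) (r := r),
    LinearEquiv.apply_symm_apply]

/-- The coefficient of `T h_L` at `K` is measured against the norm of `h_L` itself, so this norm
cancels and no lower bound for it is needed. -/
lemma abs_opEntry_le {T : levelSpace X r M →L[ℝ] levelSpace X r M} {Γ : ℝ} (hT : ‖T‖ ≤ Γ)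
    {a : ℕ} {K L : LevelIndex M} (hK : a ≤ K.1.level) (hL : a ≤ L.1.level) :
    |opEntry T K L| ≤ Γ / 2 ^ a := by
  have h1 := coeff_mul_norm_single_le (X := X) (r := r)
    ((levelVec X r M).symm (T (levelVec X r M (Pi.single L 1)))) K L hK hL
  rw [LinearEquiv.apply_symm_apply] at h1
  have h2 := h1.trans (T.le_of_opNorm_le hT _)
  have h3 := le_of_mul_le_mul_right h2 (norm_levelVec_single_pos L)
  have hlen : 0 ≤ K.1.length := by unfold DyadicInterval.length; positivity
  rw [opEntry, abs_mul, abs_of_nonneg hlen, le_div_iff₀ (by positivity), mul_comm]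
  exact h3

/-- The operator acts in coordinates through its matrix. -/
lemma length_mul_symm_apply (T : levelSpace X r M →L[ℝ] levelSpace X r M) (b : LevelIndex M → ℝ)
    (K : LevelIndex M) :
    K.1.length * (levelVec X r M).symm (T (levelVec X r M b)) K = ∑ L, opEntry T K L * b L := by
  have hb : b = ∑ L, b L • (Pi.single L (1 : ℝ) : LevelIndex M → ℝ) := by
    funext J
    simp [Finset.sum_apply, Pi.single_apply]
  conv_lhs => rw [hb]
  simp only [map_sum, map_smul, Finset.sum_apply, Pi.smul_apply, smul_eq_mul, Finset.mul_sum,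
    opEntry]
  exact Finset.sum_congr rfl fun L _ => by ring

end

section

/-! ### Layered families of intervals -/

variable {n M : ℕ}

/-- The sign of the Haar functions of level `j` on an interval of level greater than `j`. -/
noncomputable def DyadicInterval.signAt (I : DyadicInterval) (j : ℕ) : ℝ :=
  if Even ((I.index : ℕ) / 2 ^ (I.level - (j + 1))) then 1 else -1

lemma rademacher_eq_signAt {m j : ℕ} {I : DyadicInterval} {x : Fin (2 ^ m)} (hI : I.HasCell x)
    (hj : j < I.level) (hm : I.level ≤ m) : rademacher j (cellPoint m x) = I.signAt j := by
  rw [rademacher_apply j (cellPoint_mem m x), DyadicInterval.signAt]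
  simp only [floor_cellPoint (Nat.succ_le_of_lt (hj.trans_le hm)), Int.even_coe_nat]
  rw [div_pow_of_le hm (Nat.succ_le_of_lt hj), hI]

lemma abs_rademacher_cellPoint (m j : ℕ) (x : Fin (2 ^ m)) :
    |rademacher j (cellPoint m x)| = 1 := by
  rw [rademacher_apply j (cellPoint_mem m x)]
  split_ifs <;> simp

lemma sum_level_cellHaar {m j : ℕ} (hj : j ≤ n) (x : Fin (2 ^ m)) :
    ∑ I : LevelIndex n with I.1.level = j, cellHaar m I.1 x = rademacher j (cellPoint m x) := by
  rw [rademacher, Finset.sum_apply]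
  symm
  refine Finset.sum_bij (fun i _ => (⟨⟨j, i⟩, hj⟩ : LevelIndex n)) ?_ ?_ ?_ ?_
  · intro i _; simp
  · intro i _ i' _ h
    simpa using h
  · rintro ⟨⟨l, i⟩, hl⟩ h
    obtain rfl : l = j := by simpa using h
    exact ⟨i, Finset.mem_univ _, rfl⟩
  · intro i _; rfl

/-- A cell contained in a given interval. -/
noncomputable def repCell (K : LevelIndex M) : Fin (2 ^ (M + 1)) :=
  (exists_hasCell (level_lt K).le).choose

lemma hasCell_repCell (K : LevelIndex M) : K.1.HasCell (repCell K) :=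
  (exists_hasCell (level_lt K).le).choose_spec

/-- The signed sum of the Haar functions of a layer. -/
noncomputable def layerFun (G : ℕ → Finset (LevelIndex M)) (θ : LevelIndex M → Bool) (j : ℕ)
    (s : Fin (2 ^ (M + 1))) : ℝ := ∑ K ∈ G j, sgn (θ K) * cellHaar (M + 1) K.1 s

/-- This is `1` if the signed Haar functions of the layers lead from the interval `K` to `I`, and
`0` otherwise. -/
noncomputable def pathWeight (G : ℕ → Finset (LevelIndex M)) (θ : LevelIndex M → Bool)
    (I : DyadicInterval) (K : LevelIndex M) : ℝ :=
  ∏ j ∈ Finset.range I.level, (1 + I.signAt j * layerFun G θ j (repCell K)) / 2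

/-- The coefficients of the block system that is given by a layered family and signs. -/
noncomputable def layerCoef (G : ℕ → Finset (LevelIndex M)) (θ : LevelIndex M → Bool)
    (I : LevelIndex n) (K : LevelIndex M) : ℝ :=
  if K ∈ G I.1.level then sgn (θ K) * pathWeight G θ I.1 K else 0

/-- The layers `G_0, …, G_n` consist of disjoint intervals, and every interval in a layer is
contained in a half of an interval of each earlier layer. -/
structure IsLayering (n : ℕ) (G : ℕ → Finset (LevelIndex M)) : Prop where
  disjoint : ∀ j ≤ n, ∀ K ∈ G j, ∀ L ∈ G j, ∀ s : Fin (2 ^ (M + 1)), K.1.HasCell s →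
    L.1.HasCell s → K = L
  nested : ∀ i j, i < j → j ≤ n → ∀ K ∈ G j, ∃ L ∈ G i, L.1.level < K.1.level ∧
    ∀ s : Fin (2 ^ (M + 1)), K.1.HasCell s → L.1.HasCell s

/-- The term with index `i` of this telescoping expansion is the contribution of layer `i`,
multiplied by a product over the earlier layers that becomes a path weight. -/
lemma prod_one_add_eq (u : ℕ → ℝ) (k : ℕ) : ∏ j ∈ Finset.range k, (1 + u j)
    = 1 + ∑ i ∈ Finset.range k, u i * ∏ j ∈ Finset.range i, (1 + u j) := by
  induction k with
  | zero => simp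
  | succ k ih => rw [Finset.prod_range_succ, Finset.sum_range_succ, ← add_assoc, ← ih]; ring

namespace IsLayering

variable {G : ℕ → Finset (LevelIndex M)} {θ : LevelIndex M → Bool}

lemma layerFun_eq (h : IsLayering n G) {j : ℕ} (hj : j ≤ n) {K : LevelIndex M} (hK : K ∈ G j)
    {s : Fin (2 ^ (M + 1))} (hs : K.1.HasCell s) :
    layerFun G θ j s = sgn (θ K) * cellHaar (M + 1) K.1 s := by
  rw [layerFun, Finset.sum_eq_single K]
  · intro L hL hLK
    rw [cellHaar_eq_zero (level_lt L) fun hs' => hLK (h.disjoint j hj L hL K hK s hs' hs), mul_zero]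
  · exact fun h' => absurd hK h'

lemma layerFun_eq_zero {j : ℕ} {s : Fin (2 ^ (M + 1))}
    (hs : ∀ K ∈ G j, ¬ K.1.HasCell s) : layerFun G θ j s = 0 :=
  Finset.sum_eq_zero fun K hK => by rw [cellHaar_eq_zero (level_lt K) (hs K hK), mul_zero]

lemma abs_layerFun_le (h : IsLayering n G) {j : ℕ} (hj : j ≤ n) (s : Fin (2 ^ (M + 1))) :
    |layerFun G θ j s| ≤ 1 := by
  by_cases hs : ∃ K ∈ G j, K.1.HasCell s
  · obtain ⟨K, hK, hs⟩ := hs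
    rw [h.layerFun_eq hj hK hs, abs_mul, abs_sgn, one_mul]
    exact abs_cellHaar_le (level_lt K) s
  · push Not at hs
    rw [layerFun_eq_zero hs, abs_zero]
    exact zero_le_one

/-- An interval of layer `j` lies in one half of an interval of layer `i`. Hence path weights do not
depend on the choice of `repCell`. -/
lemma layerFun_congr (h : IsLayering n G) {i j : ℕ} (hij : i < j) (hj : j ≤ n)
    {K : LevelIndex M} (hK : K ∈ G j) {s s' : Fin (2 ^ (M + 1))} (hs : K.1.HasCell s)
    (hs' : K.1.HasCell s') : layerFun G θ i s = layerFun G θ i s' := by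
  obtain ⟨L, hL, hlt, hLK⟩ := h.nested i j hij hj K hK
  rw [h.layerFun_eq (hij.le.trans hj) hL (hLK s hs),
    h.layerFun_eq (hij.le.trans hj) hL (hLK s' hs'),
    cellHaar_congr hs hs' hlt (level_lt K).le]

lemma eq_of_mem (h : IsLayering n G) {i j : ℕ} (hi : i ≤ n) (hj : j ≤ n) {K : LevelIndex M}
    (hKi : K ∈ G i) (hKj : K ∈ G j) : i = j := by
  have aux : ∀ i j : ℕ, i < j → j ≤ n → K ∈ G i → K ∈ G j → False := by
    intro i j hij hj hKi hKj
    obtain ⟨L, hL, hlt, hLK⟩ := h.nested i j hij hj K hKj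
    have := h.disjoint i (hij.le.trans hj) L hL K hKi (repCell K) (hLK _ (hasCell_repCell K))
      (hasCell_repCell K)
    rw [this] at hlt
    exact lt_irrefl _ hlt
  rcases lt_trichotomy i j with hlt | rfl | hlt
  · exact (aux i j hlt hj hKi hKj).elim
  · rfl
  · exact (aux j i hlt hi hKj hKi).elim

/-- The label of an interval by its layer. -/
noncomputable def label (n : ℕ) (G : ℕ → Finset (LevelIndex M)) (K : LevelIndex M) :
    Fin (n + 1) ⊕ LevelIndex M :=
  open Classical in
  if hK : ∃ i : Fin (n + 1), K ∈ G i then .inl hK.choose else .inr K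

lemma label_eq (h : IsLayering n G) {K : LevelIndex M} (i : Fin (n + 1)) (hK : K ∈ G i) :
    label n G K = .inl i := by
  have hex : ∃ i : Fin (n + 1), K ∈ G i := ⟨i, hK⟩
  rw [label, dif_pos hex]
  congr 1
  exact Fin.ext (h.eq_of_mem (Nat.le_of_lt_succ hex.choose.2) (Nat.le_of_lt_succ i.2)
    hex.choose_spec hK)

lemma mem_of_label_eq {K : LevelIndex M} (i : Fin (n + 1)) (hK : label n G K = .inl i) :
    K ∈ G i := by
  unfold label at hK
  split_ifs at hK with hex
  rw [← Sum.inl_injective hK]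
  exact hex.choose_spec

/-- Within a layer the intervals are disjoint; intervals outside all layers are their own labels. -/
lemma separatesCells_label (h : IsLayering n G) : SeparatesCells (M + 1) (label n G) := by
  intro s K hK L hL hKL
  rcases hlab : label n G L with i | J
  · rw [hlab] at hKL
    exact h.disjoint i (Nat.le_of_lt_succ i.2) K (mem_of_label_eq i hKL) L
      (mem_of_label_eq i hlab) s hK hL
  · have aux : ∀ K : LevelIndex M, label n G K = .inr J → K = J := by
      intro K hK
      unfold label at hK
      split_ifs at hK
      exact Sum.inr_injective hK
    rw [aux L hlab, aux K (hKL.trans hlab)]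

/-- The kernel of a layered block system is a Riesz product. -/
lemma blockKernel_eq (h : IsLayering n G) (hn : n ≤ M) (x s : Fin (2 ^ (M + 1))) :
    blockKernel (layerCoef (n := n) G θ) x s = ∏ j ∈ Finset.range (n + 1),
      (1 + rademacher j (cellPoint (M + 1) x) * layerFun G θ j s) := by
  set u : ℕ → ℝ := fun j => rademacher j (cellPoint (M + 1) x) * layerFun G θ j s with hu
  have hI : ∀ I : LevelIndex n,
      ∑ K, 2 ^ I.1.level * cellHaar (M + 1) I.1 x * layerCoef G θ I K * cellHaar (M + 1) K.1 s
      = cellHaar (M + 1) I.1 x * layerFun G θ I.1.level s *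
        ∏ j ∈ Finset.range I.1.level, (1 + u j) := by
    intro I
    by_cases hx : I.1.HasCell x
    swap
    · simp [cellHaar_eq_zero (Nat.lt_succ_of_le (I.2.trans hn)) hx]
    rw [layerFun, Finset.mul_sum, Finset.sum_mul,
      ← Finset.sum_subset (Finset.subset_univ (G I.1.level))]
    swap
    · intro K _ hK
      rw [layerCoef, if_neg hK]; ring
    refine Finset.sum_congr rfl fun K hK => ?_
    by_cases hs : K.1.HasCell s
    swap
    · simp [cellHaar_eq_zero (level_lt K) hs]
    -- On the cells of `I` and `K`, `signAt` is the value of the Rademacher function, and the power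
    -- of `2` absorbs the halves in the path weight.
    have hw : 2 ^ I.1.level * pathWeight G θ I.1 K = ∏ j ∈ Finset.range I.1.level, (1 + u j) := by
      rw [pathWeight, ← Finset.card_range I.1.level, ← Finset.prod_const, Finset.card_range,
        ← Finset.prod_mul_distrib]
      refine Finset.prod_congr rfl fun j hj => ?_
      have hj := Finset.mem_range.1 hj
      simp only [hu]
      rw [rademacher_eq_signAt hx hj (I.2.trans (hn.trans M.le_succ)),
        h.layerFun_congr hj I.2 hK (hasCell_repCell K) hs]
      ring
    rw [← hw, layerCoef, if_pos hK]
    ring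
  rw [prod_one_add_eq, blockKernel]
  congr 1
  rw [Finset.sum_congr rfl fun I _ => hI I]
  -- Grouping by level: the Haar functions of one level add up to a Rademacher function.
  rw [← Finset.sum_fiberwise_of_maps_to (s := Finset.univ) (t := Finset.range (n + 1))
    (g := fun I : LevelIndex n => I.1.level) fun I _ => Finset.mem_range.2 (Nat.lt_succ_of_le I.2)]
  refine Finset.sum_congr rfl fun i hi => ?_
  simp only [hu]
  rw [← sum_level_cellHaar (n := n) (Nat.le_of_lt_succ (Finset.mem_range.1 hi)) x,
    Finset.sum_mul, Finset.sum_mul]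
  refine Finset.sum_congr rfl fun I hI => ?_
  rw [(Finset.mem_filter.1 hI).2]

/-- Every factor of the Riesz product is nonnegative, since layer functions are bounded by `1`. -/
theorem isBlockSystem (h : IsLayering n G) (hn : n ≤ M) (θ : LevelIndex M → Bool) :
    IsBlockSystem (layerCoef (n := n) G θ) (label n G) where
  le := hn
  label_eq I K hβ := by
    refine h.label_eq ⟨I.1.level, Nat.lt_succ_of_le I.2⟩ ?_
    by_contra hK
    exact hβ (if_neg hK)
  separates := h.separatesCells_label
  kernel_nonneg x s := by
    rw [h.blockKernel_eq hn]
    refine Finset.prod_nonneg fun j hj => ?_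
    have h1 := abs_layerFun_le (θ := θ) h (Nat.le_of_lt_succ (Finset.mem_range.1 hj)) s
    have h2 : |rademacher j (cellPoint (M + 1) x) * layerFun G θ j s| ≤ 1 := by
      rwa [abs_mul, abs_rademacher_cellPoint, one_mul]
    linarith [(abs_le.1 h2).1]

end IsLayering

end

/-! ### Averages over random signs -/

section RandomSigns

variable {ι : Type*} [DecidableEq ι]

/-- Change the sign with a given label. -/
def flipAt (Q : ι) : Equiv.Perm (ι → Bool) :=
  Function.Involutive.toPerm (fun θ => Function.update θ Q (!θ Q)) fun θ => by
    simp

lemma flipAt_self (Q : ι) (θ : ι → Bool) : flipAt Q θ Q = !θ Q := by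
  change Function.update θ Q (!θ Q) Q = _
  simp

lemma flipAt_of_ne {Q K : ι} (h : K ≠ Q) (θ : ι → Bool) : flipAt Q θ K = θ K := by
  change Function.update θ Q (!θ Q) K = _
  simp [h]

variable [Fintype ι]

lemma expect_eq_zero_of_flipAt (Q : ι) (F : (ι → Bool) → ℝ)
    (hF : ∀ θ, F (flipAt Q θ) = -F θ) : 𝔼 θ, F θ = 0 := by
  have h := Fintype.expect_equiv (flipAt Q) (fun θ => F (flipAt Q θ)) F fun θ => rfl
  simp only [hF] at h
  rw [Finset.expect_neg_distrib] at h
  linarith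

/-- If the random variables are orthogonal except for few pairs, the second moment of a linear
combination is controlled by the sum of the squares of the coefficients. -/
lemma expect_sq_sum_le {π Ω : Type*} [Fintype Ω] [Nonempty Ω] (P : Finset π) (c : π → ℝ)
    (Z : π → Ω → ℝ) (hZ : ∀ p ∈ P, ∀ θ, |Z p θ| ≤ 1) (R : π → π → Prop) [DecidableRel R]
    (hR : ∀ p q, R p q → R q p) (k : ℕ) (hk : ∀ p ∈ P, (P.filter (R p)).card ≤ k)
    (h0 : ∀ p ∈ P, ∀ q ∈ P, ¬ R p q → 𝔼 θ, Z p θ * Z q θ = 0) :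
    𝔼 θ, (∑ p ∈ P, c p * Z p θ) ^ 2 ≤ k * ∑ p ∈ P, c p ^ 2 := by
  have e1 : 𝔼 θ, (∑ p ∈ P, c p * Z p θ) ^ 2
      = ∑ p ∈ P, ∑ q ∈ P, c p * c q * 𝔼 θ, Z p θ * Z q θ := by
    simp only [sq, Finset.sum_mul_sum]
    rw [Finset.expect_sum_comm]
    refine Finset.sum_congr rfl fun p _ => ?_
    rw [Finset.expect_sum_comm]
    refine Finset.sum_congr rfl fun q _ => ?_
    rw [Finset.mul_expect]
    exact Finset.expect_congr rfl fun θ _ => by ring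
  -- Correlations are at most `1` in modulus, and the arithmetic-geometric mean inequality splits
  -- each cross term into squares. Symmetry of `R` then lets both squares be charged to `p`.
  have e2 : ∀ p ∈ P, ∀ q ∈ P, c p * c q * 𝔼 θ, Z p θ * Z q θ
      ≤ if R p q then (c p ^ 2 + c q ^ 2) / 2 else 0 := by
    intro p hp q hq
    split_ifs with hpq
    · have hle : |𝔼 θ, Z p θ * Z q θ| ≤ 1 := by
        refine (Finset.abs_expect_le _ _).trans ?_
        rw [← Fintype.expect_const (ι := Ω) (1 : ℝ)]
        refine Finset.expect_le_expect fun θ _ => ?_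
        rw [abs_mul]
        exact mul_le_one₀ (hZ p hp θ) (abs_nonneg _) (hZ q hq θ)
      have h1 : c p * c q * 𝔼 θ, Z p θ * Z q θ ≤ |c p| * |c q| * 1 := by
        refine (le_abs_self _).trans ?_
        rw [abs_mul, abs_mul]
        exact mul_le_mul_of_nonneg_left hle (by positivity)
      nlinarith [sq_nonneg (|c p| - |c q|), sq_abs (c p), sq_abs (c q)]
    · rw [h0 p hp q hq hpq, mul_zero]
  rw [e1]
  refine (Finset.sum_le_sum fun p hp => Finset.sum_le_sum fun q hq => e2 p hp q hq).trans ?_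
  have e3 : ∑ p ∈ P, ∑ q ∈ P, (if R p q then (c p ^ 2 + c q ^ 2) / 2 else 0)
      = ∑ p ∈ P, ∑ q ∈ P, if R p q then c p ^ 2 else 0 := by
    have e4 : ∑ p ∈ P, ∑ q ∈ P, (if R p q then c q ^ 2 else 0)
        = ∑ p ∈ P, ∑ q ∈ P, if R p q then c p ^ 2 else 0 := by
      rw [Finset.sum_comm]
      refine Finset.sum_congr rfl fun p _ => Finset.sum_congr rfl fun q _ => ?_
      by_cases h : R p q
      · rw [if_pos h, if_pos (hR p q h)]
      · rw [if_neg h, if_neg fun h' => h (hR q p h')]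
    have e5 : ∀ p q, (if R p q then (c p ^ 2 + c q ^ 2) / 2 else 0)
        = ((if R p q then c p ^ 2 else 0) + if R p q then c q ^ 2 else 0) / 2 := by
      intro p q; split_ifs <;> simp
    simp only [e5, ← Finset.sum_div, Finset.sum_add_distrib]
    rw [e4]
    ring
  rw [e3, Finset.mul_sum]
  refine Finset.sum_le_sum fun p hp => ?_
  rw [← Finset.sum_filter, Finset.sum_const, nsmul_eq_mul]
  exact mul_le_mul_of_nonneg_right (by exact_mod_cast hk p hp) (sq_nonneg _)

/-- When a new sign is adjoined, its odd powers average out. With `V` the old sum of squares, the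
fourth moment is then at most `c⁴ + 6 c² V + 3 V² ≤ 3 (V + c²)²`. -/
lemma expect_signSum_moments (S : Finset ι) (c : ι → ℝ) :
    𝔼 θ : ι → Bool, (∑ i ∈ S, sgn (θ i) * c i) ^ 2 = ∑ i ∈ S, c i ^ 2 ∧
    𝔼 θ : ι → Bool, (∑ i ∈ S, sgn (θ i) * c i) ^ 4 ≤ 3 * (∑ i ∈ S, c i ^ 2) ^ 2 := by
  induction S using Finset.induction_on with
  | empty => simp
  | insert i S hi ih =>
    obtain ⟨ih2, ih4⟩ := ih
    set Y : (ι → Bool) → ℝ := fun θ => ∑ i ∈ S, sgn (θ i) * c i with hY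
    have hflip : ∀ θ, Y (flipAt i θ) = Y θ := fun θ =>
      Finset.sum_congr rfl fun j hj => by
        rw [flipAt_of_ne (ne_of_mem_of_not_mem hj hi)]
    have hodd : ∀ F : ℝ → ℝ, 𝔼 θ : ι → Bool, sgn (θ i) * F (Y θ) = 0 := fun F =>
      expect_eq_zero_of_flipAt i _ fun θ => by
        rw [hflip, flipAt_self, sgn_not]; ring
    have hs : ∀ θ : ι → Bool, ∑ j ∈ insert i S, sgn (θ j) * c j = sgn (θ i) * c i + Y θ :=
      fun θ => Finset.sum_insert hi
    have hsq : ∀ θ : ι → Bool, sgn (θ i) * sgn (θ i) = 1 := fun θ => sgn_mul_self _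
    have e2 : ∀ θ : ι → Bool, (sgn (θ i) * c i + Y θ) ^ 2
        = c i ^ 2 + 2 * c i * (sgn (θ i) * Y θ) + Y θ ^ 2 := fun θ => by
      linear_combination (c i ^ 2) * hsq θ
    have e4 : ∀ θ : ι → Bool, (sgn (θ i) * c i + Y θ) ^ 4
        = c i ^ 4 + 4 * c i ^ 3 * (sgn (θ i) * Y θ) + 6 * c i ^ 2 * Y θ ^ 2
          + 4 * c i * (sgn (θ i) * Y θ ^ 3) + Y θ ^ 4 := fun θ => by
      linear_combination (c i ^ 4 * (sgn (θ i) * sgn (θ i) + 1)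
        + 4 * c i ^ 3 * sgn (θ i) * Y θ + 6 * c i ^ 2 * Y θ ^ 2) * hsq θ
    simp only [hs, e2, e4, Finset.sum_insert hi]
    simp only [Finset.expect_add_distrib, ← Finset.mul_expect, Fintype.expect_const]
    rw [hodd (fun y => y), hodd (fun y => y ^ 3), ih2]
    refine ⟨by ring, ?_⟩
    nlinarith [sq_nonneg (c i ^ 2)]

/-- Khintchine's inequality. -/
lemma sqrt_sum_sq_le_expect (S : Finset ι) (c : ι → ℝ) :
    5 / 9 * √(∑ i ∈ S, c i ^ 2) ≤ 𝔼 θ : ι → Bool, |∑ i ∈ S, sgn (θ i) * c i| := by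
  obtain ⟨h2, h4⟩ := expect_signSum_moments S c
  set V := ∑ i ∈ S, c i ^ 2 with hV
  have hV0 : 0 ≤ V := Finset.sum_nonneg fun i _ => sq_nonneg _
  rcases hV0.eq_or_lt with h | hpos
  · rw [← h, Real.sqrt_zero, mul_zero]
    exact Finset.expect_nonneg fun _ _ => abs_nonneg _
  set σ := √V with hσ
  have hσ0 : 0 < σ := Real.sqrt_pos.2 hpos
  have hσ2 : σ ^ 2 = V := Real.sq_sqrt hV0
  -- This minorant of the absolute value touches it at `0` and at `3 σ / 2`. Its mean is at least `σ
  -- - 4 / 27 * 3 * σ = 5 / 9 * σ`.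
  have key : ∀ θ : ι → Bool, (∑ i ∈ S, sgn (θ i) * c i) ^ 2 / σ
      - 4 / 27 * (∑ i ∈ S, sgn (θ i) * c i) ^ 4 / σ ^ 3 ≤ |∑ i ∈ S, sgn (θ i) * c i| := by
    intro θ
    set y := |∑ i ∈ S, sgn (θ i) * c i| with hy
    have hy0 : 0 ≤ y := abs_nonneg _
    have e1 : (∑ i ∈ S, sgn (θ i) * c i) ^ 2 = y ^ 2 := (sq_abs _).symm
    have e2 : (∑ i ∈ S, sgn (θ i) * c i) ^ 4 = y ^ 4 := by
      rw [show (4 : ℕ) = 2 * 2 by rfl, pow_mul, pow_mul, e1]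
    rw [e1, e2]
    have : y - (y ^ 2 / σ - 4 / 27 * y ^ 4 / σ ^ 3)
        = y * ((2 * y / (3 * σ) - 1) ^ 2 * (y / (3 * σ) + 1)) := by
      field_simp
      ring
    have h' : 0 ≤ y * ((2 * y / (3 * σ) - 1) ^ 2 * (y / (3 * σ) + 1)) := by positivity
    linarith
  have h5 := Finset.expect_le_expect (s := Finset.univ) fun θ (_ : θ ∈ Finset.univ) => key θ
  refine le_trans ?_ h5
  rw [Finset.expect_sub_distrib, ← Finset.expect_div, ← Finset.expect_div, ← Finset.mul_expect, h2]
  have h6 : 4 / 27 * (𝔼 θ : ι → Bool, (∑ i ∈ S, sgn (θ i) * c i) ^ 4) / σ ^ 3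
      ≤ 4 / 27 * (3 * V ^ 2) / σ ^ 3 := by gcongr
  have h7 : 4 / 27 * (3 * V ^ 2) / σ ^ 3 = 4 / 9 * σ := by
    rw [← hσ2]; field_simp; ring
  have h8 : V / σ = σ := by rw [← hσ2]; field_simp
  rw [h8]
  linarith

end RandomSigns

/-- A matrix with small entries that is bounded as a bilinear form on sign vectors has a small
Hilbert–Schmidt norm. -/
lemma sum_sq_le_of_signSums {ι ι' : Type*} [Fintype ι'] [DecidableEq ι']
    (S : Finset ι) (S' : Finset ι') (t : ι → ι' → ℝ) {Γ ν : ℝ}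
    (hΓ : 0 ≤ Γ) (hν : 0 ≤ ν) (ht : ∀ i ∈ S, ∀ j ∈ S', |t i j| ≤ Γ * ν ^ 2)
    (hs : ∀ (θ : ι → Bool) (φ : ι' → Bool),
      |∑ i ∈ S, ∑ j ∈ S', sgn (θ i) * sgn (φ j) * t i j| ≤ Γ) :
    ∑ i ∈ S, ∑ j ∈ S', t i j ^ 2 ≤ 2 * Γ ^ 2 * ν := by
  have hsgn : ∀ x : ℝ, sgn (decide (0 ≤ x)) * x = |x| := fun x => by
    by_cases h : 0 ≤ x
    · simp [sgn, h, abs_of_nonneg h]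
    · simp [sgn, h, abs_of_neg (not_le.1 h)]
  -- The sign of each row is chosen to match its signed sum.
  have h1 : ∀ φ : ι' → Bool, ∑ i ∈ S, |∑ j ∈ S', sgn (φ j) * t i j| ≤ Γ := by
    intro φ
    refine le_trans (le_of_eq ?_) ((le_abs_self _).trans
      (hs (fun i => decide (0 ≤ ∑ j ∈ S', sgn (φ j) * t i j)) φ))
    refine Finset.sum_congr rfl fun i _ => ?_
    rw [← hsgn, Finset.mul_sum]
    exact Finset.sum_congr rfl fun j _ => by ring
  have h2 : ∑ i ∈ S, 5 / 9 * √(∑ j ∈ S', t i j ^ 2) ≤ Γ := by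
    refine (Finset.sum_le_sum fun i _ => sqrt_sum_sq_le_expect S' (t i)).trans ?_
    rw [← Finset.expect_sum_comm, ← Fintype.expect_const (ι := ι' → Bool) Γ]
    exact Finset.expect_le_expect fun φ _ => h1 φ
  -- With `φ` adapted to row `i`, that row alone already contributes its full `ℓ¹` norm.
  have h3 : ∀ i ∈ S, ∑ j ∈ S', |t i j| ≤ Γ := by
    intro i hi
    have h := h1 fun j => decide (0 ≤ t i j)
    refine le_trans (le_of_eq ?_) ((Finset.single_le_sum (fun i _ => abs_nonneg _) hi).trans h)
    simp only [hsgn]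
    exact (abs_of_nonneg (Finset.sum_nonneg fun j _ => abs_nonneg _)).symm
  -- The squared `ℓ²` norm of a row is at most its largest entry times its `ℓ¹` norm. Together with
  -- the bound `h2` on the sum of the row norms this controls the sum of their squares.
  have h4 : ∀ i ∈ S, √(∑ j ∈ S', t i j ^ 2) ≤ Γ * ν := by
    intro i hi
    refine Real.sqrt_le_iff.2 ⟨by positivity, ?_⟩
    calc ∑ j ∈ S', t i j ^ 2 ≤ ∑ j ∈ S', Γ * ν ^ 2 * |t i j| := by
          refine Finset.sum_le_sum fun j hj => ?_
          rw [← sq_abs, sq]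
          exact mul_le_mul_of_nonneg_right (ht i hi j hj) (abs_nonneg _)
      _ = Γ * ν ^ 2 * ∑ j ∈ S', |t i j| := by rw [Finset.mul_sum]
      _ ≤ Γ * ν ^ 2 * Γ := mul_le_mul_of_nonneg_left (h3 i hi) (by positivity)
      _ = (Γ * ν) ^ 2 := by ring
  calc ∑ i ∈ S, ∑ j ∈ S', t i j ^ 2
      ≤ ∑ i ∈ S, Γ * ν * √(∑ j ∈ S', t i j ^ 2) := by
        refine Finset.sum_le_sum fun i hi => ?_
        have h5 : 0 ≤ ∑ j ∈ S', t i j ^ 2 := Finset.sum_nonneg fun j _ => sq_nonneg _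
        nth_rw 1 [← Real.sq_sqrt h5]
        rw [sq]
        exact mul_le_mul_of_nonneg_right (h4 i hi) (Real.sqrt_nonneg _)
    _ = Γ * ν * (9 / 5) * ∑ i ∈ S, 5 / 9 * √(∑ j ∈ S', t i j ^ 2) := by
        rw [← Finset.mul_sum, ← Finset.mul_sum]; ring
    _ ≤ Γ * ν * (9 / 5) * Γ := mul_le_mul_of_nonneg_left h2 (by positivity)
    _ ≤ 2 * Γ ^ 2 * ν := by nlinarith [mul_nonneg (mul_nonneg hΓ hΓ) hν]

section

/-! ### Path weights under random signs -/

variable {n M : ℕ} {G : ℕ → Finset (LevelIndex M)} {θ : LevelIndex M → Bool}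

lemma layerFun_flipAt_of_not {Q : LevelIndex M} {j : ℕ} {s : Fin (2 ^ (M + 1))}
    (hQ : Q ∈ G j → ¬ Q.1.HasCell s) : layerFun G (flipAt Q θ) j s = layerFun G θ j s := by
  refine Finset.sum_congr rfl fun K hK => ?_
  by_cases h : K = Q
  · subst h
    rw [cellHaar_eq_zero (level_lt K) (hQ hK), mul_zero, mul_zero]
  · rw [flipAt_of_ne h]

lemma pathWeight_flipAt {Q K : LevelIndex M} {I : DyadicInterval}
    (hQ : ∀ j < I.level, Q ∈ G j → ¬ Q.1.HasCell (repCell K)) :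
    pathWeight G (flipAt Q θ) I K = pathWeight G θ I K := by
  refine Finset.prod_congr rfl fun j hj => ?_
  rw [layerFun_flipAt_of_not (hQ j (Finset.mem_range.1 hj))]

lemma DyadicInterval.signAt_eq_or (I : DyadicInterval) (j : ℕ) :
    I.signAt j = 1 ∨ I.signAt j = -1 := by
  unfold signAt; split_ifs <;> simp

/-- The signs of an interval encode the binary digits of its index, hence determine it among the
intervals of its level. -/
lemma exists_signAt_ne {I J : DyadicInterval} (hl : I.level = J.level) (hne : I ≠ J) :
    ∃ j < I.level, I.signAt j ≠ J.signAt j := by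
  obtain ⟨l, i⟩ := I
  obtain ⟨l', i'⟩ := J
  obtain rfl : l = l' := hl
  by_contra! h
  refine hne (congrArg _ (Fin.ext (Nat.eq_of_testBit_eq fun k => ?_)))
  by_cases hk : k < l
  · have := h (l - 1 - k) (by simp only; omega)
    simp only [DyadicInterval.signAt] at this
    rw [show l - (l - 1 - k + 1) = k by omega] at this
    rw [Nat.testBit_eq_decide_div_mod_eq, Nat.testBit_eq_decide_div_mod_eq]
    simp only [Nat.even_iff] at this
    rcases Nat.mod_two_eq_zero_or_one ((i : ℕ) / 2 ^ k) with h1 | h1 <;>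
    rcases Nat.mod_two_eq_zero_or_one ((i' : ℕ) / 2 ^ k) with h2 | h2 <;>
    simp [h1, h2] at this ⊢ <;> norm_num at this
  · have : 2 ^ l ≤ 2 ^ k := Nat.pow_le_pow_right (by norm_num) (not_lt.1 hk)
    rw [Nat.testBit_lt_two_pow (i.2.trans_le this), Nat.testBit_lt_two_pow (i'.2.trans_le this)]

namespace IsLayering

lemma layerFun_flipAt_self (h : IsLayering n G) {j : ℕ} (hj : j ≤ n) {Q : LevelIndex M}
    (hQ : Q ∈ G j) {s : Fin (2 ^ (M + 1))} (hs : Q.1.HasCell s) :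
    layerFun G (flipAt Q θ) j s = -layerFun G θ j s := by
  rw [h.layerFun_eq hj hQ hs, h.layerFun_eq hj hQ hs, flipAt_self, sgn_not, neg_mul]

/-- In a layer, the sign functions of the earlier layers take the values `1` and `-1`. -/
lemma layerFun_eq_or (h : IsLayering n G) {i j : ℕ} (hij : i < j) (hj : j ≤ n)
    {K : LevelIndex M} (hK : K ∈ G j) :
    layerFun G θ i (repCell K) = 1 ∨ layerFun G θ i (repCell K) = -1 := by
  obtain ⟨L, hL, -, hLK⟩ := h.nested i j hij hj K hK
  have hL' := hLK _ (hasCell_repCell K)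
  rw [h.layerFun_eq (hij.le.trans hj) hL hL']
  have : |sgn (θ L) * cellHaar (M + 1) L.1 (repCell K)| = 1 := by
    rw [abs_mul, abs_sgn, abs_cellHaar (level_lt L) hL', one_mul]
  exact eq_or_eq_neg_of_abs_eq this

/-- On a layer the earlier layer functions are `± 1`, so each factor is `0` or `1`. -/
lemma pathWeight_eq_or (h : IsLayering n G) {I : LevelIndex n} {K : LevelIndex M}
    (hK : K ∈ G I.1.level) : pathWeight G θ I.1 K = 0 ∨ pathWeight G θ I.1 K = 1 := by
  have key : ∀ j ∈ Finset.range I.1.level,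
      (1 + I.1.signAt j * layerFun G θ j (repCell K)) / 2 = 0 ∨
      (1 + I.1.signAt j * layerFun G θ j (repCell K)) / 2 = 1 := by
    intro j hj
    rcases h.layerFun_eq_or (θ := θ) (Finset.mem_range.1 hj) I.2 hK with h1 | h1 <;>
    rcases I.1.signAt_eq_or j with h2 | h2 <;> rw [h1, h2] <;> norm_num
  by_cases h0 : ∃ j ∈ Finset.range I.1.level,
      (1 + I.1.signAt j * layerFun G θ j (repCell K)) / 2 = 0
  · obtain ⟨j, hj, h0⟩ := h0
    exact Or.inl (Finset.prod_eq_zero hj h0)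
  · push Not at h0
    exact Or.inr (Finset.prod_eq_one fun j hj => (key j hj).resolve_left (h0 j hj))

/-- A path leads to only one interval of a given level: where the signs of `I` and `J` differ, one
of the two factors vanishes. -/
lemma pathWeight_mul_eq_zero (h : IsLayering n G) {I J : LevelIndex n} (hl : I.1.level = J.1.level)
    (hne : I ≠ J) {K : LevelIndex M} (hK : K ∈ G I.1.level) :
    pathWeight G θ I.1 K * pathWeight G θ J.1 K = 0 := by
  obtain ⟨j, hj, hs⟩ := exists_signAt_ne hl fun h => hne (Subtype.ext h)
  rw [pathWeight, pathWeight, ← hl, ← Finset.prod_mul_distrib]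
  refine Finset.prod_eq_zero (Finset.mem_range.2 hj) ?_
  rcases h.layerFun_eq_or (θ := θ) hj I.2 hK with h1 | h1 <;>
  rcases I.1.signAt_eq_or j with h2 | h2 <;> rcases J.1.signAt_eq_or j with h3 | h3 <;>
  first | exact absurd (h2.trans h3.symm) hs | (rw [h1, h2, h3]; norm_num)

lemma abs_pathWeight_le (h : IsLayering n G) {I : LevelIndex n} {K : LevelIndex M}
    (hK : K ∈ G I.1.level) : |pathWeight G θ I.1 K| ≤ 1 := by
  rcases h.pathWeight_eq_or (θ := θ) hK with h | h <;> rw [h] <;> norm_num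

/-- The path weight of `K` has mean `|I|`, even if multiplied with a function of the signs that
does not depend on the signs of the intervals containing `K`. -/
lemma expect_pathWeight_mul (h : IsLayering n G) {I : LevelIndex n} {K : LevelIndex M}
    (hK : K ∈ G I.1.level) (Y : (LevelIndex M → Bool) → ℝ)
    (hY : ∀ j < I.1.level, ∀ Q ∈ G j, Q.1.HasCell (repCell K) → ∀ θ, Y (flipAt Q θ) = Y θ) :
    𝔼 θ, pathWeight G θ I.1 K * Y θ = 1 / 2 ^ I.1.level * 𝔼 θ, Y θ := by
  have key : ∀ k ≤ I.1.level, 𝔼 θ, (∏ j ∈ Finset.range k,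
      (1 + I.1.signAt j * layerFun G θ j (repCell K)) / 2) * Y θ = 1 / 2 ^ k * 𝔼 θ, Y θ := by
    intro k
    induction k with
    | zero => intro _; simp
    | succ k ih =>
      intro hk
      obtain ⟨Q, hQ, -, hQK⟩ := h.nested k I.1.level hk I.2 K hK
      have hQ' := hQK _ (hasCell_repCell K)
      have hkn : k ≤ n := (Nat.le_of_succ_le hk).trans I.2
      -- Flipping the sign of the interval `Q` of layer `k` above `K` negates the `k`-th layer
      -- function there and leaves all earlier factors and `Y` unchanged.
      have h0 : 𝔼 θ, (∏ j ∈ Finset.range k,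
          (1 + I.1.signAt j * layerFun G θ j (repCell K)) / 2) *
            layerFun G θ k (repCell K) * Y θ = 0 := by
        refine expect_eq_zero_of_flipAt Q _ fun θ => ?_
        rw [hY k hk Q hQ hQ', h.layerFun_flipAt_self hkn hQ hQ']
        have : ∀ j ∈ Finset.range k, (1 + I.1.signAt j * layerFun G (flipAt Q θ) j (repCell K)) / 2
            = (1 + I.1.signAt j * layerFun G θ j (repCell K)) / 2 := by
          intro j hj
          have hj := Finset.mem_range.1 hj
          rw [layerFun_flipAt_of_not fun hQj => ?_]
          exact absurd (h.eq_of_mem (hj.le.trans hkn) hkn hQj hQ) hj.ne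
        rw [Finset.prod_congr rfl this]
        ring
      have e : ∀ θ, (∏ j ∈ Finset.range (k + 1),
          (1 + I.1.signAt j * layerFun G θ j (repCell K)) / 2) * Y θ
          = 1 / 2 * ((∏ j ∈ Finset.range k,
            (1 + I.1.signAt j * layerFun G θ j (repCell K)) / 2) * Y θ)
          + I.1.signAt k / 2 * ((∏ j ∈ Finset.range k,
            (1 + I.1.signAt j * layerFun G θ j (repCell K)) / 2) *
              layerFun G θ k (repCell K) * Y θ) := fun θ => by
        rw [Finset.prod_range_succ]; ring
      simp only [e]
      rw [Finset.expect_add_distrib, ← Finset.mul_expect, ← Finset.mul_expect, h0,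
        ih (Nat.le_of_succ_le hk), pow_succ]
      ring
  exact key _ le_rfl

lemma expect_pathWeight (h : IsLayering n G) {I : LevelIndex n} {K : LevelIndex M}
    (hK : K ∈ G I.1.level) : 𝔼 θ, pathWeight G θ I.1 K = 1 / 2 ^ I.1.level := by
  have := h.expect_pathWeight_mul hK (fun _ => 1) fun _ _ _ _ _ _ => rfl
  simpa using this

/-- The path weights of intervals in different intervals of the first layer are uncorrelated. -/
lemma expect_pathWeight_sub_mul (h : IsLayering n G) {I : LevelIndex n} {K L : LevelIndex M}
    (hK : K ∈ G I.1.level) (hL : L ∈ G I.1.level)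
    (hKL : ∀ Q ∈ G 0, Q.1.HasCell (repCell K) → ¬ Q.1.HasCell (repCell L)) :
    𝔼 θ, (pathWeight G θ I.1 K - 1 / 2 ^ I.1.level) *
      (pathWeight G θ I.1 L - 1 / 2 ^ I.1.level) = 0 := by
  have h1 : 𝔼 θ, pathWeight G θ I.1 K * pathWeight G θ I.1 L
      = 1 / 2 ^ I.1.level * (1 / 2 ^ I.1.level) := by
    rw [h.expect_pathWeight_mul hK, h.expect_pathWeight hL]
    intro j hj Q hQ hQK θ
    -- An interval above both `K` and `L` would lie in a member of layer `0` above both.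
    refine pathWeight_flipAt fun i hi hQi hQL => ?_
    rcases Nat.eq_zero_or_pos j with rfl | hj0
    · exact hKL Q hQ hQK hQL
    · obtain ⟨R, hR, -, hRQ⟩ := h.nested 0 j hj0 (hj.le.trans I.2) Q hQ
      exact hKL R hR (hRQ _ hQK) (hRQ _ hQL)
  have e : ∀ θ, (pathWeight G θ I.1 K - 1 / 2 ^ I.1.level) *
      (pathWeight G θ I.1 L - 1 / 2 ^ I.1.level)
      = pathWeight G θ I.1 K * pathWeight G θ I.1 L
        - 1 / 2 ^ I.1.level * pathWeight G θ I.1 L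
        - (1 / 2 ^ I.1.level * pathWeight G θ I.1 K
          - 1 / 2 ^ I.1.level * (1 / 2 ^ I.1.level)) := fun θ => by ring
  simp only [e]
  rw [Finset.expect_sub_distrib, Finset.expect_sub_distrib, Finset.expect_sub_distrib,
    ← Finset.mul_expect, ← Finset.mul_expect, h1, h.expect_pathWeight hL,
    h.expect_pathWeight hK, Fintype.expect_const]
  ring

/-! ### Correlations of signed pairs -/

/-- The random signed weight of a pair of intervals. -/
noncomputable def pairWeight (G : ℕ → Finset (LevelIndex M)) (J I : LevelIndex n)
    (p : LevelIndex M × LevelIndex M) (θ : LevelIndex M → Bool) : ℝ :=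
  sgn (θ p.1) * pathWeight G θ J.1 p.1 * (sgn (θ p.2) * pathWeight G θ I.1 p.2)

lemma pairWeight_swap (J I : LevelIndex n) (p : LevelIndex M × LevelIndex M) :
    pairWeight G J I p θ = pairWeight G I J p.swap θ := by
  unfold pairWeight
  simp only [Prod.fst_swap, Prod.snd_swap]
  ring

lemma abs_pairWeight_le (h : IsLayering n G) {J I : LevelIndex n}
    {p : LevelIndex M × LevelIndex M} (h1 : p.1 ∈ G J.1.level) (h2 : p.2 ∈ G I.1.level) :
    |pairWeight G J I p θ| ≤ 1 := by
  rw [pairWeight, abs_mul, abs_mul, abs_mul, abs_sgn, abs_sgn, one_mul, one_mul]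
  exact mul_le_one₀ (h.abs_pathWeight_le h1) (abs_nonneg _) (h.abs_pathWeight_le h2)

/-- Here `Q` occurs exactly once among the four intervals and in none of the path weights, so
flipping its sign negates the product. -/
lemma expect_pairWeight_mul_of_flip {J I : LevelIndex n}
    {p q : LevelIndex M × LevelIndex M} (Q : LevelIndex M)
    (hQ : (Q = p.1 ∧ Q ≠ p.2 ∧ Q ≠ q.1 ∧ Q ≠ q.2) ∨ (Q ≠ p.1 ∧ Q = p.2 ∧ Q ≠ q.1 ∧ Q ≠ q.2))
    (h1 : ∀ K, K = p.1 ∨ K = q.1 → ∀ j < J.1.level, Q ∈ G j → ¬ Q.1.HasCell (repCell K))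
    (h2 : ∀ L, L = p.2 ∨ L = q.2 → ∀ j < I.1.level, Q ∈ G j → ¬ Q.1.HasCell (repCell L)) :
    𝔼 θ, pairWeight G J I p θ * pairWeight G J I q θ = 0 := by
  refine expect_eq_zero_of_flipAt Q _ fun θ => ?_
  simp only [pairWeight]
  rw [pathWeight_flipAt (h1 p.1 (.inl rfl)), pathWeight_flipAt (h1 q.1 (.inr rfl)),
    pathWeight_flipAt (h2 p.2 (.inl rfl)), pathWeight_flipAt (h2 q.2 (.inr rfl))]
  rcases hQ with ⟨e1, e2, e3, e4⟩ | ⟨e1, e2, e3, e4⟩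
  · rw [← e1, flipAt_self, flipAt_of_ne e2.symm, flipAt_of_ne e3.symm, flipAt_of_ne e4.symm,
      sgn_not]
    ring
  · rw [← e2, flipAt_self, flipAt_of_ne e1.symm, flipAt_of_ne e3.symm, flipAt_of_ne e4.symm,
      sgn_not]
    ring

/-- The task is to find an interval to flip. In distinct layers with `p.2 ≠ q.2`, `p.2` works, since
signs of the later layer enter no path weight. If `p.2 = q.2`, then `p.1` and `q.1` are disjoint,
and one not containing `p.2` works. In a single layer no sign of that layer enters the path weights,
and some component of `p` is absent from `q`. -/
lemma expect_pairWeight_mul_of_le (h : IsLayering n G) {J I : LevelIndex n}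
    (hl : J.1.level ≤ I.1.level) {p q : LevelIndex M × LevelIndex M} (hp1 : p.1 ∈ G J.1.level)
    (hp2 : p.2 ∈ G I.1.level) (hq1 : q.1 ∈ G J.1.level) (hq2 : q.2 ∈ G I.1.level)
    (hp : p.1 ≠ p.2) (hq : q.1 ≠ q.2) (hpq : q ≠ p) (hpq' : q ≠ p.swap) :
    𝔼 θ, pairWeight G J I p θ * pairWeight G J I q θ = 0 := by
  -- an interval of layer `c` does not belong to earlier layers
  have aux : ∀ {Q : LevelIndex M} {c : ℕ}, c ≤ n → Q ∈ G c → ∀ k ≤ c, ∀ K : LevelIndex M,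
      ∀ j < k, Q ∈ G j → ¬ Q.1.HasCell (repCell K) := fun hc hQ k hk K j hj hQj =>
    absurd (h.eq_of_mem ((hj.le.trans hk).trans hc) hc hQj hQ) (hj.trans_le hk).ne
  rcases hl.lt_or_eq with hlt | heq
  · have hdiff : ∀ {K L : LevelIndex M}, K ∈ G J.1.level → L ∈ G I.1.level → K ≠ L := by
      rintro K _ hK hL rfl
      exact hlt.ne (h.eq_of_mem J.2 I.2 hK hL)
    by_cases hL : p.2 = q.2
    · have hK : p.1 ≠ q.1 := fun hK => hpq (Prod.ext hK.symm hL.symm)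
      by_cases hc : p.1.1.HasCell (repCell p.2)
      · have hc' : ¬ q.1.1.HasCell (repCell p.2) := fun hc' =>
          hK (h.disjoint _ J.2 _ hp1 _ hq1 _ hc hc')
        simp only [mul_comm (pairWeight G J I p _)]
        refine expect_pairWeight_mul_of_flip q.1
          (.inl ⟨rfl, hq, hK.symm, hdiff hq1 hp2⟩) (fun K _ => aux J.2 hq1 _ le_rfl K) ?_
        rintro L (rfl | rfl) j _ _
        · rwa [← hL]
        · exact hc'
      · refine expect_pairWeight_mul_of_flip p.1
          (.inl ⟨rfl, hp, hK, hdiff hp1 hq2⟩) (fun K _ => aux J.2 hp1 _ le_rfl K) ?_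
        rintro L (rfl | rfl) j _ _
        · exact hc
        · rwa [← hL]
    · exact expect_pairWeight_mul_of_flip p.2
        (.inr ⟨hp.symm, rfl, (hdiff hq1 hp2).symm, hL⟩)
        (fun K _ => aux I.2 hp2 _ hl K) (fun K _ => aux I.2 hp2 _ le_rfl K)
  · by_cases h1 : p.1 = q.1 ∨ p.1 = q.2
    · have h2 : p.2 ≠ q.1 ∧ p.2 ≠ q.2 := by
        constructor
        · intro h2
          rcases h1 with h1 | h1
          · exact hp (h1.trans h2.symm)
          · exact hpq' (Prod.ext h2.symm h1.symm)
        · intro h2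
          rcases h1 with h1 | h1
          · exact hpq (Prod.ext h1.symm h2.symm)
          · exact hp (h1.trans h2.symm)
      exact expect_pairWeight_mul_of_flip p.2 (.inr ⟨hp.symm, rfl, h2.1, h2.2⟩)
        (fun K _ => aux I.2 hp2 _ hl K) (fun K _ => aux I.2 hp2 _ le_rfl K)
    · push Not at h1
      exact expect_pairWeight_mul_of_flip p.1 (.inl ⟨rfl, hp, h1.1, h1.2⟩)
        (fun K _ => aux J.2 hp1 _ le_rfl K) (fun K _ => aux J.2 hp1 _ heq.ge K)

lemma expect_pairWeight_mul (h : IsLayering n G) {J I : LevelIndex n}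
    {p q : LevelIndex M × LevelIndex M} (hp1 : p.1 ∈ G J.1.level)
    (hp2 : p.2 ∈ G I.1.level) (hq1 : q.1 ∈ G J.1.level) (hq2 : q.2 ∈ G I.1.level)
    (hp : p.1 ≠ p.2) (hq : q.1 ≠ q.2) (hpq : q ≠ p) (hpq' : q ≠ p.swap) :
    𝔼 θ, pairWeight G J I p θ * pairWeight G J I q θ = 0 := by
  rcases le_total J.1.level I.1.level with hl | hl
  · exact h.expect_pairWeight_mul_of_le hl hp1 hp2 hq1 hq2 hp hq hpq hpq'
  · simp only [pairWeight_swap J I]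
    refine h.expect_pairWeight_mul_of_le hl (p := p.swap) (q := q.swap) hp2 hp1 hq2 hq1 hp.symm
      hq.symm (fun e => hpq (Prod.swap_injective e)) fun e => hpq' (Prod.swap_injective e)

/-- The off-diagonal part of a random quadratic form has a small second moment. -/
theorem expect_offDiag_sq_le (h : IsLayering n G) (J I : LevelIndex n)
    (t : LevelIndex M → LevelIndex M → ℝ) :
    𝔼 θ, (∑ p ∈ (G J.1.level ×ˢ G I.1.level).filter (fun p => p.1 ≠ p.2),
      t p.1 p.2 * pairWeight G J I p θ) ^ 2
      ≤ 2 * ∑ K ∈ G J.1.level, ∑ L ∈ G I.1.level, t K L ^ 2 := by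
  classical
  set P := (G J.1.level ×ˢ G I.1.level).filter (fun p => p.1 ≠ p.2) with hP
  have hmem : ∀ p ∈ P, p.1 ∈ G J.1.level ∧ p.2 ∈ G I.1.level ∧ p.1 ≠ p.2 := fun p hp => by
    rw [hP, Finset.mem_filter, Finset.mem_product] at hp
    exact ⟨hp.1.1, hp.1.2, hp.2⟩
  -- A pair correlates at most with itself and with its swap, so the orthogonality defect is `2`.
  have key := expect_sq_sum_le P (fun p => t p.1 p.2) (pairWeight G J I)
    (fun p hp θ => h.abs_pairWeight_le (hmem p hp).1 (hmem p hp).2.1)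
    (fun p q => q = p ∨ q = p.swap) (by
      rintro p q (rfl | rfl)
      · exact .inl rfl
      · exact .inr (Prod.swap_swap p).symm) 2 (fun p _ => by
      refine (Finset.card_le_card (t := {p, p.swap}) fun q hq => ?_).trans Finset.card_le_two
      simpa using (Finset.mem_filter.1 hq).2) (fun p hp q hq hR => by
      push Not at hR
      obtain ⟨hp1, hp2, hp3⟩ := hmem p hp
      obtain ⟨hq1, hq2, hq3⟩ := hmem q hq
      exact h.expect_pairWeight_mul hp1 hp2 hq1 hq2 hp3 hq3 hR.1 hR.2)
  refine key.trans ?_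
  push_cast
  refine mul_le_mul_of_nonneg_left ?_ zero_le_two
  rw [← Finset.sum_product' (f := fun K L => t K L ^ 2)]
  exact Finset.sum_le_sum_of_subset_of_nonneg (Finset.filter_subset _ _) fun _ _ _ => sq_nonneg _

end IsLayering

end

section

/-! ### The choice of the signs -/

variable {n M : ℕ} {G : ℕ → Finset (LevelIndex M)}

lemma length_pos (I : DyadicInterval) : 0 < I.length := by
  unfold DyadicInterval.length; positivity

lemma sum_length_eq_expect (S : Finset (LevelIndex M)) :
    ∑ L ∈ S, L.1.length = 𝔼 s, ∑ L ∈ S, |cellHaar (M + 1) L.1 s| := by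
  rw [Finset.expect_sum_comm]
  exact Finset.sum_congr rfl fun L _ => (expect_abs_cellHaar (level_lt L)).symm

lemma sum_abs_cellHaar_eq_one {S : Finset (LevelIndex M)} {s : Fin (2 ^ (M + 1))}
    (hS : ∀ K ∈ S, ∀ L ∈ S, K.1.HasCell s → L.1.HasCell s → K = L) {K : LevelIndex M}
    (hK : K ∈ S) (hs : K.1.HasCell s) : ∑ L ∈ S, |cellHaar (M + 1) L.1 s| = 1 := by
  rw [Finset.sum_eq_single K, abs_cellHaar (level_lt K) hs]
  · intro L hL hLK
    rw [cellHaar_eq_zero (level_lt L) fun h => hLK (hS L hL K hK h hs), abs_zero]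
  · exact fun h => absurd hK h

/-- The total length of disjoint subintervals of an interval. -/
lemma sum_length_le {S : Finset (LevelIndex M)}
    (hS : ∀ K ∈ S, ∀ L ∈ S, ∀ s : Fin (2 ^ (M + 1)), K.1.HasCell s → L.1.HasCell s → K = L)
    {Q : LevelIndex M} (hQ : ∀ L ∈ S, ∀ s : Fin (2 ^ (M + 1)), L.1.HasCell s → Q.1.HasCell s) :
    ∑ L ∈ S, L.1.length ≤ Q.1.length := by
  rw [sum_length_eq_expect, ← expect_abs_cellHaar (level_lt Q)]
  refine Finset.expect_le_expect fun s _ => ?_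
  by_cases hs : ∃ K ∈ S, K.1.HasCell s
  · obtain ⟨K, hK, hs⟩ := hs
    rw [sum_abs_cellHaar_eq_one (fun K hK L hL => hS K hK L hL s) hK hs,
      abs_cellHaar (level_lt Q) (hQ K hK s hs)]
  · push Not at hs
    rw [Finset.sum_eq_zero fun L hL => by rw [cellHaar_eq_zero (level_lt L) (hs L hL), abs_zero]]
    exact abs_nonneg _

/-- The total length of disjoint intervals. -/
lemma sum_length_le_one {S : Finset (LevelIndex M)}
    (hS : ∀ K ∈ S, ∀ L ∈ S, ∀ s : Fin (2 ^ (M + 1)), K.1.HasCell s → L.1.HasCell s → K = L) :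
    ∑ L ∈ S, L.1.length ≤ 1 := by
  refine (sum_length_le hS (Q := rootIndex M) fun _ _ s _ => hasCell_rootIndex s).trans ?_
  simp [rootIndex, DyadicInterval.length]

namespace IsLayering

/-- The diagonal part of a random quadratic form is concentrated around its mean. -/
theorem expect_diag_sq_le (h : IsLayering n G) (I : LevelIndex n) (c : LevelIndex M → ℝ)
    {Γ ν : ℝ} (hΓ : 0 ≤ Γ) (hc : ∀ K, |c K| ≤ Γ * K.1.length)
    (hν : ∀ Q ∈ G 0, Q.1.length ≤ ν) (hν0 : 0 ≤ ν) :
    𝔼 θ, (∑ K ∈ G I.1.level, c K * (pathWeight G θ I.1 K - 1 / 2 ^ I.1.level)) ^ 2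
      ≤ Γ ^ 2 * ν := by
  classical
  set i := I.1.level with hi
  -- Only intervals below a common member of layer `0` can have correlated path weights.
  let R : LevelIndex M → LevelIndex M → Prop := fun K L =>
    ∃ Q ∈ G 0, Q.1.HasCell (repCell K) ∧ Q.1.HasCell (repCell L)
  have hdisj := h.disjoint i I.2
  have hZ : ∀ K ∈ G i, ∀ θ, |pathWeight G θ I.1 K - 1 / 2 ^ i| ≤ 1 := by
    intro K hK θ
    have h1 : (0 : ℝ) < 1 / 2 ^ i := by positivity
    have h2 : (1 : ℝ) / 2 ^ i ≤ 1 := by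
      rw [div_le_one (by positivity)]; exact one_le_pow₀ one_le_two
    rw [abs_le]
    rcases h.pathWeight_eq_or (θ := θ) hK with h | h <;> rw [h] <;> constructor <;> linarith
  have e1 : 𝔼 θ, (∑ K ∈ G i, c K * (pathWeight G θ I.1 K - 1 / 2 ^ i)) ^ 2
      = ∑ K ∈ G i, ∑ L ∈ G i, c K * c L * 𝔼 θ, (pathWeight G θ I.1 K - 1 / 2 ^ i) *
        (pathWeight G θ I.1 L - 1 / 2 ^ i) := by
    simp only [sq, Finset.sum_mul_sum]
    rw [Finset.expect_sum_comm]
    refine Finset.sum_congr rfl fun p _ => ?_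
    rw [Finset.expect_sum_comm]
    refine Finset.sum_congr rfl fun q _ => ?_
    rw [Finset.mul_expect]
    exact Finset.expect_congr rfl fun θ _ => by ring
  have e2 : ∀ K ∈ G i, ∀ L ∈ G i, c K * c L * (𝔼 θ, (pathWeight G θ I.1 K - 1 / 2 ^ i) *
        (pathWeight G θ I.1 L - 1 / 2 ^ i)) ≤ if R K L then |c K| * |c L| else 0 := by
    intro K hK L hL
    split_ifs with hR
    · have hle : |𝔼 θ, (pathWeight G θ I.1 K - 1 / 2 ^ i) *
          (pathWeight G θ I.1 L - 1 / 2 ^ i)| ≤ 1 := by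
        refine (Finset.abs_expect_le _ _).trans ?_
        refine (Finset.expect_le_expect (g := fun _ => (1 : ℝ)) fun θ _ => ?_).trans
          (Fintype.expect_const _).le
        rw [abs_mul]
        exact mul_le_one₀ (hZ K hK θ) (abs_nonneg _) (hZ L hL θ)
      refine (le_abs_self _).trans ?_
      rw [abs_mul, abs_mul]
      exact mul_le_of_le_one_right (by positivity) hle
    · rw [h.expect_pathWeight_sub_mul hK hL fun Q hQ hQK hQL => hR ⟨Q, hQ, hQK, hQL⟩, mul_zero]
  -- The intervals correlated with `K` are disjoint and lie in one member of layer `0`, of length at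
  -- most `ν`.
  have e3 : ∀ K ∈ G i, ∑ L ∈ G i with R K L, |c L| ≤ Γ * ν := by
    intro K hK
    by_cases hQ : ∃ Q ∈ G 0, Q.1.HasCell (repCell K)
    swap
    · rw [Finset.filter_false_of_mem, Finset.sum_empty]
      · positivity
      · rintro L - ⟨Q, hQ0, hQK, -⟩
        exact hQ ⟨Q, hQ0, hQK⟩
    obtain ⟨Q, hQ, hQK⟩ := hQ
    calc ∑ L ∈ G i with R K L, |c L| ≤ ∑ L ∈ G i with R K L, Γ * L.1.length :=
          Finset.sum_le_sum fun L _ => hc L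
      _ = Γ * ∑ L ∈ G i with R K L, L.1.length := by rw [Finset.mul_sum]
      _ ≤ Γ * Q.1.length := by
          refine mul_le_mul_of_nonneg_left (sum_length_le (fun K hK L hL => hdisj K
            (Finset.mem_of_mem_filter K hK) L (Finset.mem_of_mem_filter L hL)) ?_) hΓ
          intro L hL s hs
          obtain ⟨hLi, Q', hQ', hQ'K, hQ'L⟩ := Finset.mem_filter.1 hL
          have hQQ' := h.disjoint 0 (Nat.zero_le n) Q hQ Q' hQ' _ hQK hQ'K
          rcases Nat.eq_zero_or_pos i with hi0 | hi0
          · rw [hi0] at hLi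
            rw [hQQ', h.disjoint 0 (Nat.zero_le n) Q' hQ' L hLi _ hQ'L (hasCell_repCell L)]
            exact hs
          · obtain ⟨Q'', hQ'', -, hsub⟩ := h.nested 0 i hi0 I.2 L hLi
            rw [hQQ', h.disjoint 0 (Nat.zero_le n) Q' hQ' Q'' hQ'' _ hQ'L
              (hsub _ (hasCell_repCell L))]
            exact hsub s hs
      _ ≤ Γ * ν := mul_le_mul_of_nonneg_left (hν Q hQ) hΓ
  rw [e1]
  calc _ ≤ ∑ K ∈ G i, ∑ L ∈ G i, (if R K L then |c K| * |c L| else 0) :=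
        Finset.sum_le_sum fun K hK => Finset.sum_le_sum fun L hL => e2 K hK L hL
    _ = ∑ K ∈ G i, |c K| * ∑ L ∈ G i with R K L, |c L| := by
        refine Finset.sum_congr rfl fun K _ => ?_
        rw [Finset.mul_sum, Finset.sum_filter]
    _ ≤ ∑ K ∈ G i, Γ * K.1.length * (Γ * ν) := by
        refine Finset.sum_le_sum fun K hK => ?_
        exact mul_le_mul (hc K) (e3 K hK) (Finset.sum_nonneg fun _ _ => abs_nonneg _)
          (mul_nonneg hΓ (length_pos _).le)
    _ = Γ ^ 2 * ν * ∑ K ∈ G i, K.1.length := by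
        rw [Finset.mul_sum]
        exact Finset.sum_congr rfl fun K _ => by ring
    _ ≤ Γ ^ 2 * ν := mul_le_of_le_one_right (by positivity) (sum_length_le_one hdisj)

/-! ### The matrix of an operator in a random block system -/

/-- The matrix entries of an operator in a block system, up to normalization. -/
noncomputable def _root_.HaarHardy.layerEntry (G : ℕ → Finset (LevelIndex M))
    (t : LevelIndex M → LevelIndex M → ℝ) (θ : LevelIndex M → Bool) (J I : LevelIndex n) : ℝ :=
  ∑ K, ∑ L, layerCoef G θ J K * t K L * layerCoef G θ I L

/-- On the diagonal `K = L` the signs square to `1`, while the path weights of distinct `J` and `I`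
annihilate each other and equal ones are idempotent. -/
lemma layerEntry_eq (h : IsLayering n G) (t : LevelIndex M → LevelIndex M → ℝ)
    (θ : LevelIndex M → Bool) (J I : LevelIndex n) : layerEntry G t θ J I =
    (∑ p ∈ (G J.1.level ×ˢ G I.1.level).filter (fun p => p.1 ≠ p.2),
      t p.1 p.2 * pairWeight G J I p θ) +
    if J = I then ∑ K ∈ G I.1.level, t K K * pathWeight G θ I.1 K else 0 := by
  classical
  have e1 : layerEntry G t θ J I
      = ∑ p ∈ G J.1.level ×ˢ G I.1.level, t p.1 p.2 * pairWeight G J I p θ := by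
    rw [Finset.sum_product, layerEntry, ← Finset.sum_subset (Finset.subset_univ (G J.1.level))]
    · refine Finset.sum_congr rfl fun K hK => ?_
      rw [← Finset.sum_subset (Finset.subset_univ (G I.1.level))]
      · refine Finset.sum_congr rfl fun L hL => ?_
        rw [layerCoef, layerCoef, if_pos hK, if_pos hL, pairWeight]
        ring
      · intro L _ hL
        have : layerCoef G θ I L = 0 := if_neg hL
        rw [this, mul_zero]
    · intro K _ hK
      refine Finset.sum_eq_zero fun L _ => ?_
      rw [layerCoef, if_neg hK]
      ring
  rw [e1, ← Finset.sum_filter_add_sum_filter_not _ (fun p => p.1 ≠ p.2)]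
  congr 1
  have e2 : ∀ p : LevelIndex M × LevelIndex M, p.1 = p.2 → t p.1 p.2 * pairWeight G J I p θ
      = t p.1 p.1 * (pathWeight G θ J.1 p.1 * pathWeight G θ I.1 p.1) := by
    rintro ⟨K, L⟩ hKL
    obtain rfl : K = L := hKL
    simp only [pairWeight]
    linear_combination (t K K * (pathWeight G θ J.1 K * pathWeight G θ I.1 K)) * sgn_mul_self (θ K)
  split_ifs with hJI
  · subst hJI
    symm
    refine Finset.sum_bij (fun K _ => (K, K)) (fun K hK => ?_) (fun K _ L _ hKL => ?_)
      (fun p hp => ?_) fun K hK => ?_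
    · simpa using hK
    · exact congrArg Prod.fst hKL
    · obtain ⟨hp1, hp2⟩ := Finset.mem_filter.1 hp
      have hp2 := not_not.1 hp2
      exact ⟨p.1, (Finset.mem_product.1 hp1).1, Prod.ext rfl hp2⟩
    · rw [e2 _ rfl]
      rcases h.pathWeight_eq_or (θ := θ) hK with h | h <;> rw [h] <;> ring
  · refine Finset.sum_eq_zero fun p hp => ?_
    obtain ⟨hp1, hp2⟩ := Finset.mem_filter.1 hp
    have hp2 := not_not.1 hp2
    obtain ⟨hJ, hI⟩ := Finset.mem_product.1 hp1
    rw [← hp2] at hI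
    rw [e2 p hp2, h.pathWeight_mul_eq_zero (h.eq_of_mem J.2 I.2 hJ hI) hJI hJ, mul_zero]

/-- For a suitable choice of the signs, all the entries of the matrix with respect to the block
system are close to those of the diagonal matrix of the traces over the layers. -/
theorem exists_signs (h : IsLayering n G) (t : LevelIndex M → LevelIndex M → ℝ)
    {Γ ν τ : ℝ} (hΓ : 0 ≤ Γ) (hdiag : ∀ K, |t K K| ≤ Γ * K.1.length)
    (hν : ∀ Q ∈ G 0, Q.1.length ≤ ν) (hν0 : 0 ≤ ν)
    (hHS : ∀ i ≤ n, ∀ j ≤ n, ∑ K ∈ G i, ∑ L ∈ G j, t K L ^ 2 ≤ 2 * Γ ^ 2 * ν)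
    (hτ0 : 0 ≤ τ) (hτ : 40 * 16 ^ n * Γ ^ 2 * ν ≤ τ ^ 2) :
    ∃ θ : LevelIndex M → Bool, ∀ J I : LevelIndex n,
      |2 ^ J.1.level * layerEntry G t θ J I - if J = I then ∑ K ∈ G I.1.level, t K K else 0|
        ≤ τ := by
  set D : LevelIndex n → LevelIndex n → (LevelIndex M → Bool) → ℝ := fun J I θ =>
    2 ^ J.1.level * layerEntry G t θ J I - if J = I then ∑ K ∈ G I.1.level, t K K else 0 with hD
  have hDsq : ∀ J I, 𝔼 θ, D J I θ ^ 2 ≤ 10 * 4 ^ n * Γ ^ 2 * ν := by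
    intro J I
    set U : (LevelIndex M → Bool) → ℝ := fun θ =>
      ∑ p ∈ (G J.1.level ×ˢ G I.1.level).filter (fun p => p.1 ≠ p.2),
        t p.1 p.2 * pairWeight G J I p θ with hU
    set V : (LevelIndex M → Bool) → ℝ := fun θ =>
      ∑ K ∈ G I.1.level, t K K * (pathWeight G θ I.1 K - 1 / 2 ^ I.1.level) with hV
    -- The mean path weight is `2 ^ (-level)`, so the normalized mean of the diagonal part is
    -- exactly the trace that `D` subtracts.
    have hUV : ∀ θ, D J I θ = 2 ^ J.1.level * (U θ + if J = I then V θ else 0) := by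
      intro θ
      simp only [hD, h.layerEntry_eq, hU, hV]
      split_ifs with hJI
      · subst hJI
        simp only [mul_sub, Finset.sum_sub_distrib, mul_add]
        rw [← Finset.sum_mul]
        field_simp
        ring
      · ring
    have hsq : ∀ θ, D J I θ ^ 2 ≤ 4 ^ n * (2 * U θ ^ 2 + 2 * V θ ^ 2) := by
      intro θ
      have h4 : ((2 : ℝ) ^ J.1.level) ^ 2 ≤ 4 ^ n := by
        rw [← pow_mul, mul_comm, pow_mul]
        norm_num
        exact pow_le_pow_right₀ (by norm_num) J.2
      have h5 : (U θ + if J = I then V θ else 0) ^ 2 ≤ 2 * U θ ^ 2 + 2 * V θ ^ 2 := by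
        split_ifs
        · nlinarith [sq_nonneg (U θ - V θ)]
        · nlinarith [sq_nonneg (U θ), sq_nonneg (V θ)]
      rw [hUV, mul_pow]
      exact mul_le_mul h4 h5 (sq_nonneg _) (by positivity)
    have hU2 : 𝔼 θ, U θ ^ 2 ≤ 2 * (2 * Γ ^ 2 * ν) :=
      (h.expect_offDiag_sq_le J I t).trans
        (mul_le_mul_of_nonneg_left (hHS _ J.2 _ I.2) zero_le_two)
    have hV2 : 𝔼 θ, V θ ^ 2 ≤ Γ ^ 2 * ν :=
      h.expect_diag_sq_le I (fun K => t K K) hΓ hdiag hν hν0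
    calc 𝔼 θ, D J I θ ^ 2 ≤ 𝔼 θ, 4 ^ n * (2 * U θ ^ 2 + 2 * V θ ^ 2) :=
          Finset.expect_le_expect fun θ _ => hsq θ
      _ = 4 ^ n * (2 * 𝔼 θ, U θ ^ 2 + 2 * 𝔼 θ, V θ ^ 2) := by
          rw [← Finset.mul_expect, Finset.expect_add_distrib, ← Finset.mul_expect,
            ← Finset.mul_expect]
      _ ≤ 4 ^ n * (2 * (2 * (2 * Γ ^ 2 * ν)) + 2 * (Γ ^ 2 * ν)) := by gcongr
      _ = 10 * 4 ^ n * Γ ^ 2 * ν := by ring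
  -- There are at most `(2 ^ (n + 1)) ^ 2` entries, each of second moment at most `10 * 4 ^ n * Γ ^
  -- 2 * ν`. Summing all squares allows one choice of signs to serve every entry.
  have hsum : 𝔼 θ, ∑ J, ∑ I, D J I θ ^ 2 ≤ τ ^ 2 := by
    refine le_trans ?_ hτ
    rw [Finset.expect_sum_comm]
    simp only [Finset.expect_sum_comm _ _ fun θ I => D _ I θ ^ 2]
    refine (Finset.sum_le_sum fun J _ => Finset.sum_le_sum fun I _ => hDsq J I).trans ?_
    simp only [Finset.sum_const, nsmul_eq_mul, Finset.card_univ]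
    have hcard : (Fintype.card (LevelIndex n) : ℝ) ≤ 2 ^ (n + 1) := by
      exact_mod_cast card_levelIndex_le n
    have h0 : 0 ≤ 10 * 4 ^ n * Γ ^ 2 * ν := by positivity
    have h16 : (16 : ℝ) ^ n = 2 ^ n * 2 ^ n * 4 ^ n := by
      rw [← mul_pow, ← mul_pow]; norm_num
    calc (Fintype.card (LevelIndex n) : ℝ) * (Fintype.card (LevelIndex n) *
          (10 * 4 ^ n * Γ ^ 2 * ν)) ≤ 2 ^ (n + 1) * (2 ^ (n + 1) * (10 * 4 ^ n * Γ ^ 2 * ν)) := by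
          gcongr
      _ = 40 * 16 ^ n * Γ ^ 2 * ν := by rw [h16, pow_succ]; ring
  obtain ⟨θ, -, hθ⟩ := Finset.exists_le_of_expect_le Finset.univ_nonempty hsum
  refine ⟨θ, fun J I => abs_le_of_sq_le_sq ?_ hτ0⟩
  refine le_trans ?_ hθ
  refine le_trans ?_ (Finset.single_le_sum (f := fun J => ∑ I, D J I θ ^ 2)
    (fun J _ => Finset.sum_nonneg fun I _ => sq_nonneg _) (Finset.mem_univ J))
  exact Finset.single_le_sum (f := fun I => D J I θ ^ 2) (fun I _ => sq_nonneg _)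
    (Finset.mem_univ I)

end IsLayering

end

section

/-! ### Matrix entries over two layers -/

variable {X : HaarSystemNorm} {r : RademacherChoice} {n M : ℕ}

/-- A single family of disjoint intervals. -/
lemma isLayering_const {S : Finset (LevelIndex M)}
    (hS : ∀ K ∈ S, ∀ L ∈ S, ∀ s : Fin (2 ^ (M + 1)), K.1.HasCell s → L.1.HasCell s → K = L) :
    IsLayering 0 fun _ => S where
  disjoint _ _ := hS
  nested _ _ hij hj := absurd (hij.trans_le hj) (Nat.not_lt_zero _)

lemma layerCoef_rootIndex (G : ℕ → Finset (LevelIndex M)) (θ : LevelIndex M → Bool)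
    (K : LevelIndex M) :
    layerCoef G θ (rootIndex n) K = if K ∈ G 0 then sgn (θ K) else 0 := by
  simp [layerCoef, rootIndex, pathWeight]

lemma length_rootIndex : (rootIndex n).1.length = 1 := by
  simp [rootIndex, DyadicInterval.length]

/-- A signed sum of Haar functions over disjoint intervals is a block system with `n = 0`. Thus it
has norm at most `1`, and pairing with such a sum is a functional of norm at most `1`. -/
lemma abs_signSum_opEntry_le {T : levelSpace X r M →L[ℝ] levelSpace X r M} {Γ : ℝ}
    (hT : ‖T‖ ≤ Γ) {S S' : Finset (LevelIndex M)}
    (hS : ∀ K ∈ S, ∀ L ∈ S, ∀ s : Fin (2 ^ (M + 1)), K.1.HasCell s → L.1.HasCell s → K = L)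
    (hS' : ∀ K ∈ S', ∀ L ∈ S', ∀ s : Fin (2 ^ (M + 1)), K.1.HasCell s → L.1.HasCell s → K = L)
    (θ φ : LevelIndex M → Bool) :
    |∑ K ∈ S, ∑ L ∈ S', sgn (θ K) * sgn (φ L) * opEntry T K L| ≤ Γ := by
  have h := (isLayering_const hS).isBlockSystem (Nat.zero_le M) θ
  have h' := (isLayering_const hS').isBlockSystem (Nat.zero_le M) φ
  set β := layerCoef (n := 0) (fun _ => S) θ
  set β' := layerCoef (n := 0) (fun _ => S') φ
  set b := blockSum β' (Pi.single (rootIndex 0) 1) with hb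
  set c := (levelVec X r M).symm (T (levelVec X r M b)) with hc
  have hbL : ∀ L, b L = if L ∈ S' then sgn (φ L) else 0 := by
    intro L
    have : b L = β' (rootIndex 0) L := by
      simp [hb, blockSum, Pi.single_apply]
    exact this.trans (layerCoef_rootIndex _ φ L)
  have h1 : ‖levelVec X r M b‖ ≤ 1 :=
    (h'.norm_blockSum_le _).trans (norm_levelVec_single_le _)
  have h2 : ‖levelVec X r M c‖ ≤ Γ := by
    rw [hc, LinearEquiv.apply_symm_apply]
    refine (T.le_of_opNorm_le hT _).trans ?_
    exact mul_le_of_le_one_right ((norm_nonneg T).trans hT) h1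
  have h3 := (length_mul_abs_coeff_le (X := X) (r := r) (blockCoord β c) (rootIndex 0)).trans
    ((h.norm_blockCoord_le c).trans h2)
  rw [length_rootIndex, one_mul] at h3
  have hβ : ∀ K, β (rootIndex 0) K = if K ∈ S then sgn (θ K) else 0 := layerCoef_rootIndex _ θ
  suffices e : blockCoord β c (rootIndex 0)
      = ∑ K ∈ S, ∑ L ∈ S', sgn (θ K) * sgn (φ L) * opEntry T K L by rwa [e] at h3
  simp only [blockCoord, LinearMap.coe_mk, AddHom.coe_mk, hβ]
  rw [← Finset.sum_subset (Finset.subset_univ S)]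
  · refine Finset.sum_congr rfl fun K hK => ?_
    rw [if_pos hK, mul_assoc, hc, length_mul_symm_apply,
      ← Finset.sum_subset (Finset.subset_univ S'), Finset.mul_sum]
    · refine Finset.sum_congr rfl fun L hL => ?_
      rw [hbL, if_pos hL]
      simp only [rootIndex, pow_zero]
      ring
    · intro L _ hL
      rw [hbL, if_neg hL, mul_zero]
  · intro K _ hK
    rw [if_neg hK]
    ring

/-- The Hilbert–Schmidt norm of the matrix of an operator, restricted to two families of short
disjoint intervals, is small. -/
theorem sum_sq_opEntry_le {T : levelSpace X r M →L[ℝ] levelSpace X r M} {Γ : ℝ}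
    (hT : ‖T‖ ≤ Γ) {S S' : Finset (LevelIndex M)}
    (hS : ∀ K ∈ S, ∀ L ∈ S, ∀ s : Fin (2 ^ (M + 1)), K.1.HasCell s → L.1.HasCell s → K = L)
    (hS' : ∀ K ∈ S', ∀ L ∈ S', ∀ s : Fin (2 ^ (M + 1)), K.1.HasCell s → L.1.HasCell s → K = L)
    {q : ℕ} (hq : ∀ K ∈ S, 2 * q ≤ K.1.level) (hq' : ∀ K ∈ S', 2 * q ≤ K.1.level) :
    ∑ K ∈ S, ∑ L ∈ S', opEntry T K L ^ 2 ≤ 2 * Γ ^ 2 * (1 / 2) ^ q := by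
  -- Here `ν = (1 / 2) ^ q`: levels at least `2 * q` give entries at most `Γ / 2 ^ (2 * q) = Γ * ν ^
  -- 2`.
  refine sum_sq_le_of_signSums S S' (opEntry T) ((norm_nonneg T).trans hT) (by positivity) ?_
    (abs_signSum_opEntry_le hT hS hS')
  intro K hK L hL
  refine (abs_opEntry_le hT (hq K hK) (hq' L hL)).trans (le_of_eq ?_)
  rw [← pow_mul, mul_comm q 2, one_div, inv_pow, div_eq_mul_inv]

end

section

/-! ### The layers of a set of intervals -/

lemma exists_count_eq (p : ℕ → Prop) [DecidablePred p] {i k : ℕ} (h : i < Nat.count p k) :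
    ∃ l < k, p l ∧ Nat.count p l = i := by
  induction k with
  | zero => simp at h
  | succ k ih =>
    by_cases hk : i < Nat.count p k
    · obtain ⟨l, hl, hl'⟩ := ih hk
      exact ⟨l, hl.trans k.lt_succ_self, hl'⟩
    · rw [Nat.count_succ] at h
      split_ifs at h with hpk
      · exact ⟨k, k.lt_succ_self, hpk, by omega⟩
      · omega

variable {n M : ℕ}

open Classical in
/-- The number of intervals in `P`, of level less than `l`, that contain a given cell. -/
noncomputable def pathCount (P : LevelIndex M → Prop) (s : Fin (2 ^ (M + 1))) (l : ℕ) : ℕ :=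
  Nat.count (fun j => ∃ K : LevelIndex M, K.1.level = j ∧ K.1.HasCell s ∧ P K) l

open Classical in
/-- The intervals in `P` that are strictly contained in exactly `g` intervals of `P`. -/
noncomputable def layer (P : LevelIndex M → Prop) (g : ℕ) : Finset (LevelIndex M) :=
  Finset.univ.filter fun K => P K ∧ pathCount P (repCell K) K.1.level = g

variable {P : LevelIndex M → Prop}

lemma pathCount_congr {K : LevelIndex M} {s s' : Fin (2 ^ (M + 1))} (hs : K.1.HasCell s)
    (hs' : K.1.HasCell s') {l : ℕ} (hl : l ≤ K.1.level) : pathCount P s l = pathCount P s' l := by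
  classical
  unfold pathCount
  rw [Nat.count_eq_card_filter_range, Nat.count_eq_card_filter_range]
  congr 1
  refine Finset.filter_congr fun j hj => ?_
  have hj := (Finset.mem_range.1 hj).trans_le hl
  constructor
  · rintro ⟨L, hL, hLs, hPL⟩
    exact ⟨L, hL, (hs.congr hs' (hL ▸ hj.le) (level_lt K).le).1 hLs, hPL⟩
  · rintro ⟨L, hL, hLs, hPL⟩
    exact ⟨L, hL, (hs.congr hs' (hL ▸ hj.le) (level_lt K).le).2 hLs, hPL⟩

lemma mem_layer {K : LevelIndex M} {g : ℕ} {s : Fin (2 ^ (M + 1))} (hs : K.1.HasCell s) :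
    K ∈ layer P g ↔ P K ∧ pathCount P s K.1.level = g := by
  classical
  rw [layer, Finset.mem_filter, pathCount_congr (hasCell_repCell K) hs le_rfl]
  simp

lemma pathCount_succ {K : LevelIndex M} {s : Fin (2 ^ (M + 1))} (hs : K.1.HasCell s) (hK : P K) :
    pathCount P s (K.1.level + 1) = pathCount P s K.1.level + 1 := by
  classical
  unfold pathCount
  rw [Nat.count_succ, if_pos ⟨K, rfl, hs, hK⟩]

/-- If one of two intervals of `P` strictly contains the other, its own count is strictly smaller.
-/
lemma layer_disjoint (g : ℕ) {K L : LevelIndex M} (hK : K ∈ layer P g) (hL : L ∈ layer P g)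
    {s : Fin (2 ^ (M + 1))} (hKs : K.1.HasCell s) (hLs : L.1.HasCell s) : K = L := by
  have aux : ∀ K L : LevelIndex M, K ∈ layer P g → L ∈ layer P g → K.1.HasCell s →
      L.1.HasCell s → ¬ K.1.level < L.1.level := by
    intro K L hK hL hKs hLs hlt
    obtain ⟨hPK, hgK⟩ := (mem_layer hKs).1 hK
    obtain ⟨hPL, hgL⟩ := (mem_layer hLs).1 hL
    have h1 : pathCount P s (K.1.level + 1) ≤ pathCount P s L.1.level := by
      classical
      exact Nat.count_monotone _ hlt
    rw [pathCount_succ hKs hPK] at h1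
    omega
  refine Subtype.ext (hKs.eq hLs ?_)
  have h1 := aux K L hK hL hKs hLs
  have h2 := aux L K hL hK hLs hKs
  omega

/-- At most one interval of each level contains a given cell. Late layers therefore consist of short
intervals. -/
lemma le_level_of_mem_layer {g : ℕ} {K : LevelIndex M} (hK : K ∈ layer P g) : g ≤ K.1.level := by
  obtain ⟨-, h⟩ := (mem_layer (hasCell_repCell K)).1 hK
  rw [← h]
  classical
  exact Nat.count_le _

lemma exists_mem_layer {g l : ℕ} {s : Fin (2 ^ (M + 1))} (h : g < pathCount P s l) :
    ∃ K ∈ layer P g, K.1.HasCell s ∧ K.1.level < l := by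
  classical
  obtain ⟨j, hj, ⟨K, hKj, hKs, hPK⟩, hc⟩ := exists_count_eq _ h
  refine ⟨K, (mem_layer hKs).2 ⟨hPK, ?_⟩, hKs, hKj ▸ hj⟩
  rw [hKj]
  exact hc

lemma layer_nested {i j : ℕ} (hij : i < j) {K : LevelIndex M} (hK : K ∈ layer P j) :
    ∃ L ∈ layer P i, L.1.level < K.1.level ∧
      ∀ s : Fin (2 ^ (M + 1)), K.1.HasCell s → L.1.HasCell s := by
  obtain ⟨-, h⟩ := (mem_layer (hasCell_repCell K)).1 hK
  obtain ⟨L, hL, hLK, hlt⟩ := exists_mem_layer (hij.trans_eq h.symm)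
  exact ⟨L, hL, hlt, fun s hs => ((hasCell_repCell K).congr hs hlt.le (level_lt K).le).1 hLK⟩

/-- Increasing subsequences of the sequence of layers are layerings. -/
lemma isLayering_layer {k : ℕ → ℕ} (hk : ∀ i j, i < j → j ≤ n → k i < k j) :
    IsLayering n fun i => layer P (k i) where
  disjoint j _ _ hK _ hL _ hKs hLs := layer_disjoint (k j) hK hL hKs hLs
  nested i j hij hj _ hK := layer_nested (hk i j hij hj) hK

/-- Each level contributes exactly one interval containing the cell, either in `P` or in its
complement. -/
lemma pathCount_add_pathCount_not (P : LevelIndex M → Prop) (s : Fin (2 ^ (M + 1))) :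
    pathCount P s (M + 1) + pathCount (fun K => ¬ P K) s (M + 1) = M + 1 := by
  classical
  have key : ∀ l ≤ M + 1, pathCount P s l + pathCount (fun K => ¬ P K) s l = l := by
    intro l
    induction l with
    | zero => intro _; simp [pathCount]
    | succ l ih =>
      intro hl
      have ih := ih (Nat.le_of_succ_le hl)
      have hlM : l ≤ M := Nat.le_of_succ_le_succ hl
      let K : LevelIndex M := ⟨intervalAt s l (Nat.le_of_succ_le hl), hlM⟩
      have hK : K.1.HasCell s := hasCell_intervalAt s l (Nat.le_of_succ_le hl)
      have huniq : ∀ L : LevelIndex M, L.1.level = l → L.1.HasCell s → L = K := fun L hL hLs =>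
        Subtype.ext (hLs.eq hK hL)
      unfold pathCount at ih ⊢
      rw [Nat.count_succ, Nat.count_succ]
      by_cases hP : P K
      · rw [if_pos ⟨K, rfl, hK, hP⟩, if_neg]
        · omega
        · rintro ⟨L, hL, hLs, hPL⟩
          exact hPL (huniq L hL hLs ▸ hP)
      · rw [if_pos (⟨K, rfl, hK, hP⟩ : ∃ L : LevelIndex M, L.1.level = l ∧ L.1.HasCell s ∧ ¬ P L),
          if_neg]
        · omega
        · rintro ⟨L, hL, hLs, hPL⟩
          exact hP (huniq L hL hLs ▸ hPL)
  exact key _ le_rfl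

/-- The first layers of a set of intervals, or of its complement, have total length at least
`1 / 2`. -/
theorem half_le_sum_length_layer (P : LevelIndex M → Prop) {R : ℕ} (hR : 2 * R ≤ M) :
    (∀ g < R, 1 / 2 ≤ ∑ K ∈ layer P g, K.1.length) ∨
      ∀ g < R, 1 / 2 ≤ ∑ K ∈ layer (fun K => ¬ P K) g, K.1.length := by
  classical
  -- The indicator of the cells lying in at least `R` intervals of `P`; each of the first `R` layers
  -- covers these cells.
  let F : (LevelIndex M → Prop) → Fin (2 ^ (M + 1)) → ℝ := fun P s =>
    if R ≤ pathCount P s (M + 1) then 1 else 0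
  have hF : ∀ P : LevelIndex M → Prop, ∀ g < R, 𝔼 s, F P s ≤ ∑ K ∈ layer P g, K.1.length := by
    intro P g hg
    rw [sum_length_eq_expect]
    refine Finset.expect_le_expect fun s _ => ?_
    simp only [F]
    split_ifs with h
    · obtain ⟨K, hK, hKs, -⟩ := exists_mem_layer (hg.trans_le h)
      rw [sum_abs_cellHaar_eq_one (fun K hK L hL => layer_disjoint g hK hL) hK hKs]
    · exact Finset.sum_nonneg fun _ _ => abs_nonneg _
  -- The two counts add up to `M + 1 > 2 * R`, so every cell is counted for `P` or for its
  -- complement.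
  have hsum : 1 ≤ 𝔼 s, F P s + 𝔼 s, F (fun K => ¬ P K) s := by
    rw [← Finset.expect_add_distrib, ← Fintype.expect_const (ι := Fin (2 ^ (M + 1))) (1 : ℝ)]
    refine Finset.expect_le_expect fun s _ => ?_
    have := pathCount_add_pathCount_not P s
    simp only [F]
    split_ifs <;> first | omega | norm_num
  rcases le_total (1 / 2) (𝔼 s, F P s) with h | h
  · exact .inl fun g hg => h.trans (hF P g hg)
  · exact .inr fun g hg => le_trans (by linarith) (hF _ g hg)

/-! ### Pigeonhole selection of layers -/

/-- Among sufficiently many numbers in `[0, Γ]` there are `n + 1` that are close to each other. -/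
lemma exists_close_subsequence (m : ℕ → ℝ) {Γ : ℝ} (hΓ : 0 < Γ) {a B R : ℕ} (hB : 0 < B)
    (hm : ∀ g < R, 0 ≤ m g ∧ m g ≤ Γ) (hR : a + (B + 1) * (n + 1) ≤ R) :
    ∃ k : ℕ → ℕ, (∀ i j, i < j → j ≤ n → k i < k j) ∧ (∀ i ≤ n, a ≤ k i ∧ k i < R) ∧
      ∀ i ≤ n, |m (k i) - m (k 0)| ≤ Γ / B := by
  have hB' : (0 : ℝ) < B := by exact_mod_cast hB
  -- Bins of width `Γ / B`; there are `B + 1` of them because the value `Γ` itself falls into an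
  -- extra bin.
  have hmaps : ∀ g ∈ Finset.Ico a R, ⌊m g * B / Γ⌋₊ ∈ Finset.range (B + 1) := by
    intro g hg
    obtain ⟨h0, h1⟩ := hm g (Finset.mem_Ico.1 hg).2
    rw [Finset.mem_range, Nat.lt_succ_iff]
    refine Nat.floor_le_of_le ?_
    rw [div_le_iff₀ hΓ]
    nlinarith
  obtain ⟨y, -, hy⟩ := Finset.exists_lt_card_fiber_of_mul_lt_card_of_maps_to (n := n) hmaps (by
    rw [Finset.card_range, Nat.card_Ico]
    have : (B + 1) * (n + 1) = (B + 1) * n + (B + 1) := by ring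
    omega)
  set S := (Finset.Ico a R).filter fun g => ⌊m g * B / Γ⌋₊ = y with hS
  let e : Fin (n + 1) ↪o ℕ := S.orderEmbOfCardLe hy
  have he : ∀ i, e i ∈ S := fun i => Finset.orderEmbOfCardLe_mem S hy i
  -- The default value `0` beyond `n` is never consulted.
  let k : ℕ → ℕ := fun i => if h : i ≤ n then e ⟨i, Nat.lt_succ_of_le h⟩ else 0
  have hk : ∀ i ≤ n, k i ∈ S := fun i hi => by
    simp only [k, dif_pos hi]; exact he _
  refine ⟨k, fun i j hij hj => ?_, fun i hi => ?_, fun i hi => ?_⟩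
  · simp only [k, dif_pos hj, dif_pos (hij.le.trans hj)]
    exact e.strictMono hij
  · exact Finset.mem_Ico.1 (Finset.mem_filter.1 (hk i hi)).1
  · have key : ∀ i ≤ n, (y : ℝ) ≤ m (k i) * B / Γ ∧ m (k i) * B / Γ < y + 1 := by
      intro i hi
      obtain ⟨h1, h2⟩ := Finset.mem_filter.1 (hk i hi)
      obtain ⟨h3, -⟩ := hm _ (Finset.mem_Ico.1 h1).2
      have h4 : 0 ≤ m (k i) * B / Γ := by positivity
      exact (Nat.floor_eq_iff h4).1 h2
    obtain ⟨h1, h2⟩ := key i hi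
    obtain ⟨h3, h4⟩ := key 0 (Nat.zero_le n)
    have h5 : |m (k i) * B / Γ - m (k 0) * B / Γ| ≤ 1 := abs_le.2 ⟨by linarith, by linarith⟩
    rw [← sub_div, ← sub_mul, abs_div, abs_mul, abs_of_pos hB', abs_of_pos hΓ,
      div_le_one hΓ] at h5
    rwa [le_div_iff₀ hB']

end

section

/-! ### Factorization of the identity -/

variable {X : HaarSystemNorm} {r : RademacherChoice} {n M : ℕ}

lemma FactorsThrough.mono {E F : Type*} [NormedAddCommGroup E] [NormedSpace ℝ E]
    [NormedAddCommGroup F] [NormedSpace ℝ F] {S : E →L[ℝ] E} {T : F →L[ℝ] F} {C D : ℝ}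
    (h : FactorsThrough S T C) (hCD : C ≤ D) : FactorsThrough S T D := by
  obtain ⟨B, A, hAB, hS⟩ := h
  exact ⟨B, A, hAB.trans hCD, hS⟩

lemma FactorsThrough.of_neg {E F : Type*} [NormedAddCommGroup E] [NormedSpace ℝ E]
    [NormedAddCommGroup F] [NormedSpace ℝ F] {S : E →L[ℝ] E} {T : F →L[ℝ] F} {C : ℝ}
    (h : FactorsThrough S (-T) C) : FactorsThrough S T C := by
  obtain ⟨B, A, hAB, hS⟩ := h
  refine ⟨B, -A, by rwa [norm_neg], ?_⟩
  rw [hS]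
  ext x
  simp

/-- A small perturbation of a multiple of the identity is invertible. -/
lemma exists_inverse_of_norm_sub_smul_le {E : Type*} [NormedAddCommGroup E] [NormedSpace ℝ E]
    [FiniteDimensional ℝ E] (S : E →L[ℝ] E) {c τ d : ℝ} (hd : 0 < d) (hc : d + τ ≤ c)
    (hS : ∀ f, ‖S f - c • f‖ ≤ τ * ‖f‖) :
    ∃ V : E →L[ℝ] E, ‖V‖ ≤ 1 / d ∧ V ∘L S = ContinuousLinearMap.id ℝ E := by
  -- This lower bound gives injectivity, hence invertibility in finite dimension, and also the norm
  -- of the inverse.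
  have hlow : ∀ f, d * ‖f‖ ≤ ‖S f‖ := by
    intro f
    have h1 : ‖c • f‖ ≤ ‖S f - c • f‖ + ‖S f‖ := by
      have := norm_sub_le (S f) (S f - c • f)
      rw [sub_sub_cancel] at this
      linarith
    have h2 : c * ‖f‖ ≤ ‖c • f‖ := by
      rw [norm_smul]
      exact mul_le_mul_of_nonneg_right (le_abs_self c) (norm_nonneg f)
    have h3 := mul_le_mul_of_nonneg_right hc (norm_nonneg f)
    linarith [hS f]
  have hinj : Function.Injective (S : E →ₗ[ℝ] E) := by
    rw [injective_iff_map_eq_zero]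
    intro f hf
    have h1 := hlow f
    have h2 : S f = 0 := hf
    rw [h2, norm_zero] at h1
    exact norm_le_zero_iff.1 (by nlinarith)
  let e := LinearEquiv.ofInjectiveEndo (S : E →ₗ[ℝ] E) hinj
  have he : ∀ f, e f = S f := fun f => rfl
  refine ⟨(e.symm : E →ₗ[ℝ] E).mkContinuous (1 / d) fun g => ?_, ?_, ?_⟩
  · have := hlow (e.symm g)
    rw [← he, LinearEquiv.apply_symm_apply] at this
    rw [one_div, inv_mul_eq_div, le_div_iff₀ hd, mul_comm]
    exact this
  · exact LinearMap.mkContinuous_norm_le _ (by positivity) _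
  · ext f
    change e.symm (S f) = f
    rw [← he, LinearEquiv.symm_apply_apply]

instance (n : ℕ) : FiniteDimensional ℝ (levelSpace X r n) :=
  (levelVec X r n).finiteDimensional

lemma abs_coeff_le (b : LevelIndex n → ℝ) (K : LevelIndex n) :
    |b K| ≤ 2 ^ n * ‖levelVec X r n b‖ := by
  have h := length_mul_abs_coeff_le (X := X) (r := r) b K
  rw [DyadicInterval.length, one_div, inv_mul_le_iff₀ (by positivity)] at h
  refine h.trans (mul_le_mul_of_nonneg_right ?_ (norm_nonneg _))
  exact pow_le_pow_right₀ one_le_two K.2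

lemma norm_levelVec_le_sum (b : LevelIndex n → ℝ) : ‖levelVec X r n b‖ ≤ ∑ K, |b K| := by
  have hb : b = ∑ L, b L • (Pi.single L (1 : ℝ) : LevelIndex n → ℝ) := by
    funext J
    simp [Finset.sum_apply, Pi.single_apply]
  conv_lhs => rw [hb]
  rw [map_sum]
  refine norm_sum_le_of_le _ fun K _ => ?_
  rw [map_smul, norm_smul, Real.norm_eq_abs]
  exact mul_le_of_le_one_right (abs_nonneg _) (norm_levelVec_single_le K)

/-- A matrix with small entries acts with small norm. -/
lemma norm_levelVec_matrix_le {e : LevelIndex n → LevelIndex n → ℝ} {τ : ℝ}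
    (hτ : 0 ≤ τ) (he : ∀ J I, |e J I| ≤ τ) (a : LevelIndex n → ℝ) :
    ‖levelVec X r n fun J => ∑ I, e J I * a I‖ ≤ 8 ^ (n + 1) * τ * ‖levelVec X r n a‖ := by
  set f := ‖levelVec X r n a‖
  have hf : 0 ≤ f := norm_nonneg _
  have hcard : (Fintype.card (LevelIndex n) : ℝ) ≤ 2 ^ (n + 1) := by
    exact_mod_cast card_levelIndex_le n
  -- Each row has at most `2 ^ (n + 1)` terms of size at most `τ * 2 ^ n * f`. Adding at most `2 ^
  -- (n + 1)` rows gives the factor `4 * 8 ^ n`.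
  have h1 : ∀ J, |∑ I, e J I * a I| ≤ 2 ^ (n + 1) * (τ * (2 ^ n * f)) := by
    intro J
    calc |∑ I, e J I * a I| ≤ ∑ I, |e J I * a I| := Finset.abs_sum_le_sum_abs _ _
      _ ≤ ∑ _I : LevelIndex n, τ * (2 ^ n * f) := by
        refine Finset.sum_le_sum fun I _ => ?_
        rw [abs_mul]
        exact mul_le_mul (he J I) (abs_coeff_le a I) (abs_nonneg _) hτ
      _ ≤ _ := by
        rw [Finset.sum_const, nsmul_eq_mul, Finset.card_univ]
        exact mul_le_mul_of_nonneg_right hcard (by positivity)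
  calc ‖levelVec X r n fun J => ∑ I, e J I * a I‖ ≤ ∑ J, |∑ I, e J I * a I| :=
        norm_levelVec_le_sum _
    _ ≤ ∑ _J : LevelIndex n, 2 ^ (n + 1) * (τ * (2 ^ n * f)) := Finset.sum_le_sum fun J _ => h1 J
    _ ≤ 2 ^ (n + 1) * (2 ^ (n + 1) * (τ * (2 ^ n * f))) := by
        rw [Finset.sum_const, nsmul_eq_mul, Finset.card_univ]
        exact mul_le_mul_of_nonneg_right hcard (by positivity)
    _ = 4 * (2 ^ n) ^ 3 * τ * f := by ring
    _ ≤ 8 ^ (n + 1) * τ * f := by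
        have : (8 : ℝ) ^ (n + 1) = 8 * (2 ^ n) ^ 3 := by
          rw [← pow_mul, mul_comm n 3, pow_mul, pow_succ]; norm_num; ring
        rw [this]
        gcongr
        norm_num

/-- An operator whose matrix with respect to a block system is close to a multiple of the identity
is a factor of the identity. -/
theorem IsBlockSystem.factorsThrough {β : LevelIndex n → LevelIndex M → ℝ}
    {κ : LevelIndex M → Fin (n + 1) ⊕ LevelIndex M} (h : IsBlockSystem β κ)
    (T : levelSpace X r M →L[ℝ] levelSpace X r M) {c d τ : ℝ} (hτ : 0 ≤ τ) (hd : 0 < d)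
    (hc : d + 8 ^ (n + 1) * τ ≤ c)
    (hβ : ∀ J I, |2 ^ J.1.level * (∑ K, ∑ L, β J K * opEntry T K L * β I L)
      - if J = I then c else 0| ≤ τ) :
    FactorsThrough (ContinuousLinearMap.id ℝ (levelSpace X r n)) T (1 / d) := by
  let B : levelSpace X r n →L[ℝ] levelSpace X r M :=
    ((levelVec X r M).toLinearMap ∘ₗ blockSum β ∘ₗ (levelVec X r n).symm.toLinearMap).mkContinuous 1
      fun f => by
        rw [one_mul]
        refine (h.norm_blockSum_le _).trans (le_of_eq ?_)
        exact congrArg _ ((levelVec X r n).apply_symm_apply f)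
  let A : levelSpace X r M →L[ℝ] levelSpace X r n :=
    ((levelVec X r n).toLinearMap ∘ₗ blockCoord β ∘ₗ
      (levelVec X r M).symm.toLinearMap).mkContinuous 1
      fun f => by
        rw [one_mul]
        refine (h.norm_blockCoord_le _).trans (le_of_eq ?_)
        exact congrArg _ ((levelVec X r M).apply_symm_apply f)
  have hB : ‖B‖ ≤ 1 := LinearMap.mkContinuous_norm_le _ zero_le_one _
  have hA : ‖A‖ ≤ 1 := LinearMap.mkContinuous_norm_le _ zero_le_one _
  -- In coordinates `A T B` acts by the normalized matrix `|J|⁻¹ ⟨g_J, T g_I⟩`.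
  have hATB : ∀ a, (A ∘L T ∘L B) (levelVec X r n a)
      = levelVec X r n fun J =>
        ∑ I, (2 ^ J.1.level * ∑ K, ∑ L, β J K * opEntry T K L * β I L) * a I := by
    intro a
    change levelVec X r n (blockCoord β ((levelVec X r M).symm
      (T (levelVec X r M (blockSum β ((levelVec X r n).symm (levelVec X r n a))))))) = _
    rw [LinearEquiv.symm_apply_apply]
    congr 1
    funext J
    have hcoord : ∀ b : LevelIndex M → ℝ,
        blockCoord β b J = ∑ K, 2 ^ J.1.level * β J K * (K.1.length * b K) := fun b =>
      Finset.sum_congr rfl fun K _ => by ring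
    have hsum : ∀ L, blockSum β a L = ∑ I, a I * β I L := fun L => rfl
    rw [hcoord]
    simp only [length_mul_symm_apply, hsum, Finset.mul_sum, Finset.sum_mul]
    calc _ = ∑ K, ∑ I, ∑ L, 2 ^ J.1.level * β J K * (opEntry T K L * (a I * β I L)) :=
          Finset.sum_congr rfl fun K _ => Finset.sum_comm
      _ = ∑ I, ∑ K, ∑ L, 2 ^ J.1.level * β J K * (opEntry T K L * (a I * β I L)) :=
          Finset.sum_comm
      _ = _ := Finset.sum_congr rfl fun I _ => Finset.sum_congr rfl fun K _ =>
          Finset.sum_congr rfl fun L _ => by ring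
  -- The entrywise error `τ` becomes an operator error `8 ^ (n + 1) * τ`, which `hc` leaves room
  -- for.
  obtain ⟨V, hV, hVS⟩ := exists_inverse_of_norm_sub_smul_le (A ∘L T ∘L B) hd hc fun f => by
    obtain ⟨a, rfl⟩ := (levelVec X r n).surjective f
    rw [hATB, ← map_smul, ← map_sub]
    convert norm_levelVec_matrix_le (X := X) (r := r) hτ hβ a using 4 with J
    simp [sub_mul, Finset.sum_sub_distrib]
  refine ⟨B, V ∘L A, ?_, ?_⟩
  · have h1 : ‖V ∘L A‖ ≤ 1 / d * 1 := (ContinuousLinearMap.opNorm_comp_le V A).trans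
      (mul_le_mul hV hA A.opNorm_nonneg (by positivity))
    calc ‖V ∘L A‖ * ‖B‖ ≤ (1 / d * 1) * 1 :=
          mul_le_mul h1 hB B.opNorm_nonneg (by positivity)
      _ = 1 / d := by ring
  · rw [ContinuousLinearMap.comp_assoc]
    exact hVS.symm

lemma abs_opEntry_self_le {T : levelSpace X r M →L[ℝ] levelSpace X r M} {Γ : ℝ} (hT : ‖T‖ ≤ Γ)
    (K : LevelIndex M) : |opEntry T K K| ≤ Γ * K.1.length := by
  refine (abs_opEntry_le hT le_rfl le_rfl).trans (le_of_eq ?_)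
  rw [DyadicInterval.length, mul_one_div]

/-- If the diagonal is bounded from below on a sufficiently large set of intervals, then the
operator is a factor of the identity. -/
theorem factorsThrough_of_layers {T : levelSpace X r M →L[ℝ] levelSpace X r M} {Γ δ τ d : ℝ}
    (hΓ : 0 < Γ) (hδ : 0 < δ) (hT : ‖T‖ ≤ Γ) (P : LevelIndex M → Prop)
    (hP : ∀ K, P K → δ * K.1.length ≤ opEntry T K K) {q B R : ℕ} (hn : n ≤ M)
    (hlen : ∀ g < R, 1 / 2 ≤ ∑ K ∈ layer P g, K.1.length) (hB : 0 < B)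
    (hR : 2 * q + (B + 1) * (n + 1) ≤ R) (hτ : 0 ≤ τ) (hBτ : Γ / B ≤ τ / 2)
    (hq : 40 * 16 ^ n * Γ ^ 2 * (1 / 2) ^ q ≤ (τ / 2) ^ 2) (hd : 0 < d)
    (hdτ : d + 8 ^ (n + 1) * τ ≤ δ / 2) :
    FactorsThrough (ContinuousLinearMap.id ℝ (levelSpace X r n)) T (1 / d) := by
  set m : ℕ → ℝ := fun g => ∑ K ∈ layer P g, opEntry T K K with hm
  have hPl : ∀ g, ∀ K ∈ layer P g, P K := fun g K hK =>
    ((mem_layer (hasCell_repCell K)).1 hK).1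
  have hlow : ∀ g < R, δ / 2 ≤ m g := by
    intro g hg
    calc δ / 2 = δ * (1 / 2) := by ring
      _ ≤ δ * ∑ K ∈ layer P g, K.1.length := mul_le_mul_of_nonneg_left (hlen g hg) hδ.le
      _ ≤ m g := by
        rw [Finset.mul_sum]
        exact Finset.sum_le_sum fun K hK => hP K (hPl g K hK)
  have hup : ∀ g, m g ≤ Γ := by
    intro g
    calc m g ≤ ∑ K ∈ layer P g, Γ * K.1.length :=
          Finset.sum_le_sum fun K _ => (le_abs_self _).trans (abs_opEntry_self_le hT K)
      _ = Γ * ∑ K ∈ layer P g, K.1.length := (Finset.mul_sum _ _ _).symm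
      _ ≤ Γ * 1 := mul_le_mul_of_nonneg_left
          (sum_length_le_one fun K hK L hL s hs hs' => layer_disjoint g hK hL hs hs') hΓ.le
      _ = Γ := mul_one Γ
  -- Discarding the layers before `2 * q` ensures that all remaining intervals have level at least
  -- `2 * q`.
  obtain ⟨k, hk, hkR, hkm⟩ := exists_close_subsequence (n := n) m hΓ hB
    (fun g hg => ⟨by linarith [hlow g hg], hup g⟩) hR
  have hG := isLayering_layer (P := P) hk
  have hlev : ∀ i ≤ n, ∀ K ∈ layer P (k i), 2 * q ≤ K.1.level := fun i hi K hK =>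
    (hkR i hi).1.trans (le_level_of_mem_layer hK)
  obtain ⟨θ, hθ⟩ := hG.exists_signs (opEntry T) (ν := (1 / 2) ^ q) (τ := τ / 2) hΓ.le
    (abs_opEntry_self_le hT) (fun Q hQ => by
      rw [DyadicInterval.length, ← one_div_pow]
      exact pow_le_pow_of_le_one (by norm_num) (by norm_num)
        (le_trans (by omega) (hlev 0 (Nat.zero_le n) Q hQ))) (by positivity)
    (fun i hi j hj => sum_sq_opEntry_le hT
      (fun K hK L hL s => layer_disjoint (k i) hK hL)
      (fun K hK L hL s => layer_disjoint (k j) hK hL) (hlev i hi) (hlev j hj))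
    (by positivity) hq
  refine (hG.isBlockSystem hn θ).factorsThrough T (c := m (k 0)) hτ hd
    (hdτ.trans (hlow _ (hkR 0 (Nat.zero_le n)).2)) fun J I => ?_
  have h1 := hθ J I
  -- The error `τ` is shared equally between the random signs and the variation of the traces over
  -- the chosen layers.
  have h2 : |(if J = I then m (k I.1.level) else 0) - if J = I then m (k 0) else 0| ≤ τ / 2 := by
    split_ifs
    · exact (hkm _ I.2).trans hBτ
    · rw [sub_zero, abs_zero]; positivity
  have h3 := (abs_sub_le _ _ _).trans (add_le_add h1 h2)
  rw [add_halves] at h3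
  exact h3

end

section

/-! ### The dimension bounds -/

/-- The factors in front of `2 ^ N` are at least `1`; the exponential alone provides the dimension
needed. -/
lemma zpow_le_NTildeMin {ε : ℝ} (hε : 0 < ε) {N : ℤ} (hN : 1 ≤ N) :
    (2 : ℝ) ^ N ≤ NTildeMin ε N := by
  have hN' : (1 : ℝ) ≤ N := by exact_mod_cast hN
  have h1 : (1 : ℝ) ≤ ⌈(N : ℝ) / ε + 1⌉ := by
    have : (1 : ℝ) ≤ (N : ℝ) / ε + 1 := le_add_of_nonneg_left (by positivity)
    exact this.trans (Int.le_ceil _)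
  have h2 : (1 : ℝ) ≤ 2 * N * ⌈(N : ℝ) / ε + 1⌉ := by nlinarith
  exact le_mul_of_one_le_left (by positivity) h2

/-- A lower bound for the dimension that is sufficient for the factorization. -/
lemma pow_mul_ratio_le_NTildeMin {ε ρ : ℝ} (hε : 0 < ε) (hρ : 1 ≤ ρ) {n : ℕ} {N : ℤ}
    (hN : 42 * (n : ℤ) + 42 + ⌊4 * Real.logb 2 ρ⌋ ≤ N) :
    2 ^ (42 * n + 41) * ρ ^ 4 ≤ NTildeMin ε N := by
  have hlog : 0 ≤ Real.logb 2 ρ := Real.logb_nonneg one_lt_two hρ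
  have hfl : 0 ≤ ⌊4 * Real.logb 2 ρ⌋ := Int.floor_nonneg.2 (by positivity)
  have hN1 : 1 ≤ N := by omega
  refine le_trans ?_ (zpow_le_NTildeMin hε hN1)
  -- The floor loses less than `1`, which lowers `42` to `41`.
  have h1 : ((42 * n + 41 : ℕ) : ℝ) + 4 * Real.logb 2 ρ ≤ N := by
    have h2 : ((42 * (n : ℤ) + 42 + ⌊4 * Real.logb 2 ρ⌋ : ℤ) : ℝ) ≤ N := by exact_mod_cast hN
    have h3 := Int.lt_floor_add_one (4 * Real.logb 2 ρ)
    push_cast at h2 ⊢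
    linarith
  calc (2 : ℝ) ^ (42 * n + 41) * ρ ^ 4
      = (2 : ℝ) ^ (((42 * n + 41 : ℕ) : ℝ) + 4 * Real.logb 2 ρ) := by
        rw [Real.rpow_add two_pos, Real.rpow_natCast, mul_comm (4 : ℝ),
          Real.rpow_mul two_pos.le, Real.rpow_logb two_pos (by norm_num) (by linarith)]
        norm_cast
    _ ≤ (2 : ℝ) ^ (N : ℝ) := Real.rpow_le_rpow_of_exponent_le one_le_two h1
    _ = (2 : ℝ) ^ N := Real.rpow_intCast _ _

lemma le_NMin {Γ δ ε : ℝ} (h : 0 < ratio Γ δ ε) (n : ℕ) :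
    42 * (n : ℤ) + 42 + ⌊4 * Real.logb 2 (ratio Γ δ ε)⌋ ≤ NMin Γ δ ε n := by
  have h1 : 1 ≤ ⌈ratio Γ δ ε⌉ := Int.one_le_ceil_iff.2 h
  have h2 : 42 * (n : ℤ) ≤ 42 * n * (n + 1) * ⌈ratio Γ δ ε⌉ := by
    rw [mul_assoc (42 * (n : ℤ))]
    exact le_mul_of_one_le_right (by positivity) (by nlinarith)
  rw [NMin]
  linarith

lemma le_NMinK {K Γ δ ε : ℝ} (hK : 1 ≤ K) (h : 0 < ratio Γ δ ε) (n : ℕ) :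
    42 * (n : ℤ) + 42 + ⌊4 * Real.logb 2 (ratio Γ δ ε)⌋ ≤ NMinK K Γ δ ε n := by
  have h1 : 1 ≤ ⌈K * ratio Γ δ ε⌉ := Int.one_le_ceil_iff.2 (by positivity)
  have h2 : 42 * (n : ℤ) ≤ 42 * n * ⌈K * ratio Γ δ ε⌉ :=
    le_mul_of_one_le_right (by positivity) h1
  rw [NMinK]
  linarith

/-- The denominator `δ ε / (2 (1 + ε))` is the gap between `δ / 2` and `δ / (2 (1 + ε))`, the room
left for the perturbation. The two sides differ exactly by the factor `1 + ε`. -/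
lemma six_mul_le_ratio {Γ δ ε : ℝ} (hΓ : 0 < Γ) (hδ : 0 < δ) (hε : 0 < ε) :
    6 * (Γ / (δ * ε / (2 * (1 + ε)))) ≤ ratio (2 * (1 + ε) * Γ) δ ε := by
  have e : ratio (2 * (1 + ε) * Γ) δ ε = 6 * (Γ / (δ * ε / (2 * (1 + ε)))) * (1 + ε) := by
    rw [ratio]
    field_simp
  rw [e]
  exact le_mul_of_one_le_right (by positivity) (by linarith)

lemma one_le_ratio {Γ δ ε : ℝ} (hδ : 0 < δ) (hε : 0 < ε) (hδΓ : δ ≤ Γ) :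
    1 ≤ ratio (2 * (1 + ε) * Γ) δ ε := by
  rw [ratio, le_div_iff₀ (by positivity), one_mul, div_mul_eq_mul_div,
    div_le_iff₀ (by positivity)]
  have h1 : ε * δ ≤ ε * Γ := mul_le_mul_of_nonneg_left hδΓ hε.le
  nlinarith [mul_pos hε (hδ.trans_le hδΓ), mul_pos (mul_pos hε hε) (hδ.trans_le hδΓ)]

/-- The choice of the parameters of the construction. -/
lemma exists_parameters {Γ σ ρ : ℝ} (hΓ : 0 < Γ) (hσ : 0 < σ) (hρ : 1 ≤ ρ) (h : 6 * (Γ / σ) ≤ ρ)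
    {n M : ℕ} (hM : 2 ^ (42 * n + 41) * ρ ^ 4 ≤ M) :
    ∃ q B R : ℕ, 0 < B ∧ 2 * q + (B + 1) * (n + 1) ≤ R ∧ 2 * R ≤ M ∧
      Γ / B ≤ σ / 8 ^ (n + 1) / 2 ∧
      40 * 16 ^ n * Γ ^ 2 * (1 / 2) ^ q ≤ (σ / 8 ^ (n + 1) / 2) ^ 2 := by
  set y : ℝ := 2 ^ n with hy
  have hy1 : 1 ≤ y := one_le_pow₀ one_le_two
  have h8 : (8 : ℝ) ^ (n + 1) = 8 * y ^ 3 := by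
    rw [hy, ← pow_mul, mul_comm n 3, pow_mul, pow_succ]; norm_num; ring
  have h16 : (16 : ℝ) ^ n = y ^ 4 := by
    rw [hy, ← pow_mul, mul_comm n 4, pow_mul]; norm_num
  have hpow : (2 : ℝ) ^ (42 * n + 41) = 2 ^ 41 * y ^ 42 := by
    rw [hy, ← pow_mul, mul_comm n 42, pow_add]; ring
  have hΓσ : Γ ≤ ρ * σ / 6 := by
    rw [← mul_div_assoc, div_le_iff₀ hσ] at h
    linarith
  -- Since `Γ ≤ ρ * σ / 6`, the last condition follows from `2 ^ q ≥ 512 * y ^ 10 * ρ ^ 2`, and `2 ^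
  -- q ≥ q` suffices for this.
  set q := ⌈512 * y ^ 10 * ρ ^ 2⌉₊ with hq
  -- The number of bins that makes their width at most `σ / (16 * y ^ 3)`, half of the admissible
  -- error.
  set B := ⌈16 * y ^ 3 * (Γ / σ)⌉₊ with hB
  have hBpos : 0 < B := Nat.ceil_pos.2 (by positivity)
  have hq1 : 512 * y ^ 10 * ρ ^ 2 ≤ q := Nat.le_ceil _
  have hq2 : (q : ℝ) < 512 * y ^ 10 * ρ ^ 2 + 1 := Nat.ceil_lt_add_one (by positivity)
  have hB1 : 16 * y ^ 3 * (Γ / σ) ≤ B := Nat.le_ceil _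
  have hB2 : (B : ℝ) < 16 * y ^ 3 * (Γ / σ) + 1 := Nat.ceil_lt_add_one (by positivity)
  refine ⟨q, B, 2 * q + (B + 1) * (n + 1), hBpos, le_rfl, ?_, ?_, ?_⟩
  -- The required dimension is at most a modest multiple of `y ^ 10 * ρ ^ 2`, so the available `2 ^
  -- 41 * y ^ 42 * ρ ^ 4` is ample.
  · suffices h' : ((2 * (2 * q + (B + 1) * (n + 1)) : ℕ) : ℝ) ≤ M by exact_mod_cast h'
    push_cast
    refine le_trans ?_ hM
    rw [hpow]
    have hn : (n : ℝ) + 1 ≤ y := by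
      have : n + 1 ≤ 2 ^ n := Nat.lt_two_pow_self
      rw [hy]
      exact_mod_cast this
    set Z : ℝ := y ^ 10 * ρ ^ 2 with hZ
    have hρ2 : 1 ≤ ρ ^ 2 := one_le_pow₀ hρ
    have hy10 : 1 ≤ y ^ 10 := one_le_pow₀ hy1
    have hZ1 : 1 ≤ Z := one_le_mul_of_one_le_of_one_le hy10 hρ2
    have h1 : (B + 1 : ℝ) * (n + 1) ≤ 5 * Z := by
      have hρy : 1 ≤ y ^ 3 * ρ := one_le_mul_of_one_le_of_one_le (one_le_pow₀ hy1) hρ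
      have h2 : (B : ℝ) + 1 ≤ 5 * (y ^ 3 * ρ) := by
        have : 16 * y ^ 3 * (Γ / σ) ≤ 16 * y ^ 3 * (ρ / 6) :=
          mul_le_mul_of_nonneg_left (by linarith) (by positivity)
        linarith
      calc (B + 1 : ℝ) * (n + 1) ≤ 5 * (y ^ 3 * ρ) * y :=
            mul_le_mul h2 hn (by positivity) (by positivity)
        _ = 5 * (y ^ 4 * ρ) := by ring
        _ ≤ 5 * Z := by
          refine mul_le_mul_of_nonneg_left ?_ (by norm_num)
          exact mul_le_mul (pow_le_pow_right₀ hy1 (by norm_num))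
            (le_self_pow₀ hρ (by norm_num)) (by positivity) (by positivity)
    calc 2 * (2 * (q : ℝ) + (B + 1) * (n + 1)) ≤ 2 ^ 41 * Z := by
          have : 512 * y ^ 10 * ρ ^ 2 = 512 * Z := by rw [hZ]; ring
          norm_num
          linarith
      _ ≤ 2 ^ 41 * (y ^ 42 * ρ ^ 4) := by
          refine mul_le_mul_of_nonneg_left ?_ (by norm_num)
          exact mul_le_mul (pow_le_pow_right₀ hy1 (by norm_num))
            (pow_le_pow_right₀ hρ (by norm_num)) (by positivity) (by positivity)
      _ = 2 ^ 41 * y ^ 42 * ρ ^ 4 := by ring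
  · rw [h8, div_le_iff₀ (by exact_mod_cast hBpos)]
    calc Γ = σ / (8 * y ^ 3) / 2 * (16 * y ^ 3 * (Γ / σ)) := by field_simp; norm_num
      _ ≤ _ := mul_le_mul_of_nonneg_left hB1 (by positivity)
  · have h2q : 512 * y ^ 10 * ρ ^ 2 ≤ 2 ^ q :=
      hq1.trans (by exact_mod_cast Nat.lt_two_pow_self.le)
    have hΓ2 : Γ ^ 2 ≤ (ρ * σ / 6) ^ 2 := pow_le_pow_left₀ hΓ.le hΓσ 2
    rw [h8, h16, one_div_pow, mul_one_div, div_le_iff₀ (by positivity)]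
    calc 40 * y ^ 4 * Γ ^ 2 ≤ 40 * y ^ 4 * (ρ * σ / 6) ^ 2 :=
          mul_le_mul_of_nonneg_left hΓ2 (by positivity)
      _ = 10 / 9 * (y ^ 4 * ρ ^ 2 * σ ^ 2) := by ring
      _ ≤ 2 * (y ^ 4 * ρ ^ 2 * σ ^ 2) :=
          mul_le_mul_of_nonneg_right (by norm_num) (by positivity)
      _ = (σ / (8 * y ^ 3) / 2) ^ 2 * (512 * y ^ 10 * ρ ^ 2) := by
          field_simp; norm_num
      _ ≤ _ := mul_le_mul_of_nonneg_left h2q (by positivity)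

/-! ### The factorization theorem -/

variable {X : HaarSystemNorm} {r : RademacherChoice} {n M : ℕ}

lemma opEntry_neg (T : levelSpace X r M →L[ℝ] levelSpace X r M) (K L : LevelIndex M) :
    opEntry (-T) K L = -opEntry T K L := by
  simp [opEntry]

/-- An operator with large diagonal on a space of sufficiently large dimension is a factor of the
identity. -/
theorem HasLargeDiagonal.factorsThrough {Γ δ ε : ℝ} (hΓ : 0 < Γ) (hδ : 0 < δ) (hε : 0 < ε)
    {T : levelSpace X r M →L[ℝ] levelSpace X r M} (hT : ‖T‖ ≤ Γ) (hdiag : HasLargeDiagonal T δ)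
    (hM : 1 ≤ ratio (2 * (1 + ε) * Γ) δ ε →
      2 ^ (42 * n + 41) * ratio (2 * (1 + ε) * Γ) δ ε ^ 4 ≤ M) :
    FactorsThrough (ContinuousLinearMap.id ℝ (levelSpace X r n)) T (2 * (1 + ε) / δ) := by
  have hd : ∀ K : LevelIndex M, δ * K.1.length ≤ |opEntry T K K| := fun K => by
    rw [← pairing_eq_opEntry]
    exact hdiag K.1 K.2
  -- The diagonal entry at `[0, 1)` lies between `δ` and `Γ`; this makes the ratio at least `1`, as
  -- `hM` requires.
  have hδΓ : δ ≤ Γ := by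
    have h := (hd (rootIndex M)).trans (abs_opEntry_self_le hT _)
    rwa [length_rootIndex, mul_one, mul_one] at h
  have hρ := one_le_ratio hδ hε hδΓ
  set σ : ℝ := δ * ε / (2 * (1 + ε)) with hσdef
  have hσ : 0 < σ := by positivity
  obtain ⟨q, B, R, hB, hR, hRM, hBσ, hq⟩ :=
    exists_parameters hΓ hσ hρ (six_mul_le_ratio hΓ hδ hε) (hM hρ)
  have hnM : n ≤ M := by nlinarith
  have hdσ : δ / (2 * (1 + ε)) + 8 ^ (n + 1) * (σ / 8 ^ (n + 1)) ≤ δ / 2 := by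
    rw [mul_div_cancel₀ _ (by positivity), hσdef, ← add_div]
    refine le_of_eq ?_
    field_simp
  have hC : 2 * (1 + ε) / δ = 1 / (δ / (2 * (1 + ε))) := by rw [one_div_div]
  rw [hC]
  -- Outside `P` the large diagonal must be negative, and the argument applies to `-T` with the
  -- complement of `P`.
  set P : LevelIndex M → Prop := fun K => δ * K.1.length ≤ opEntry T K K with hP
  rcases half_le_sum_length_layer P hRM with h | h
  · exact factorsThrough_of_layers hΓ hδ hT P (fun K hK => hK) hnM h hB hR (by positivity) hBσ hq
      (by positivity) hdσ
  · refine (factorsThrough_of_layers hΓ hδ ((T.opNorm_neg).trans_le hT)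
      (fun K => ¬ P K) (fun K hK => ?_)
      hnM h hB hR (by positivity) hBσ hq (by positivity) hdσ).of_neg
    rw [opEntry_neg]
    rcases le_abs.1 (hd K) with h' | h'
    · exact absurd h' hK
    · exact h'

end

end HaarHardy

theorem corollary1p3 (X : HaarHardy.HaarSystemNorm) (r : HaarHardy.RademacherChoice)
    (Γ δ ε : ℝ) (hΓ : 0 < Γ) (hδ : 0 < δ) (hε : 0 < ε) (n Ntilde : ℕ)
    (hN : HaarHardy.NTildeMin ε (HaarHardy.NMin (2 * (1 + ε) * Γ) δ ε n) ≤ Ntilde ∨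
      ∃ K : ℝ, 1 ≤ K ∧ HaarHardy.IsUnconditional X r K ∧
        HaarHardy.NTildeMin ε (HaarHardy.NMinK K (2 * (1 + ε) * Γ) δ ε n) ≤ Ntilde)
    (T : HaarHardy.levelSpace X r Ntilde →L[ℝ] HaarHardy.levelSpace X r Ntilde)
    (hT : ‖T‖ ≤ Γ) (hdiag : HaarHardy.HasLargeDiagonal T δ) :
    HaarHardy.FactorsThrough (ContinuousLinearMap.id ℝ (HaarHardy.levelSpace X r n)) T
      (2 * (1 + ε) ^ 2 / δ) := by
  refine (hdiag.factorsThrough hΓ hδ hε hT fun hρ => ?_).mono ?_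
  · have hρ0 : 0 < HaarHardy.ratio (2 * (1 + ε) * Γ) δ ε := one_pos.trans_le hρ
    rcases hN with h | ⟨K, hK, -, h⟩
    · exact (HaarHardy.pow_mul_ratio_le_NTildeMin hε hρ (HaarHardy.le_NMin hρ0 n)).trans h
    · exact (HaarHardy.pow_mul_ratio_le_NTildeMin hε hρ (HaarHardy.le_NMinK hK hρ0 n)).trans h
  -- The construction yields the constant `2 (1 + ε) / δ`, and `1 + ε ≤ (1 + ε) ^ 2`.
  · gcongr
    exact le_self_pow₀ (by linarith) two_ne_zero
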